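/- Let MinPAC be the following problem: given a strongly connected directed graph $G$ with at least one vertex and arc weights $w\colon A(G)\to\mathbb{N}$, find a strongly connected spanning subgraph $H$ of $G$ minimizing $\sum_{v\in V(G)}\max_{vu\in A(H)}w(vu)$ (where the maximum over the empty set is $0$). A vertex lower bound is a function $\ell\colon V(G)\to\mathbb{N}$ such that $\ell(v)\le\max_{vu\in A(H)}w(vu)$ for every optimal solution $H$ and every vertex $v$; the obligatory subgraph induced by $\ell$ is $G_\ell=(V(G),\{vu\in A(G)\mid w(vu)\le\ell(v)\})$. Theorem. There is an algorithm (on a random access machine with uniform cost whose arithmetic operations are addition and truncated subtraction, together with comparisons) that, given such an instance $(G,w)$ and a vertex lower bound $\ell$ for it, outputs an optimal solution of MinPAC in $$O\bigl(c^2\cdot 2^c\cdot n+m+4^c\cdot c^{2c-3/2}\bigr)$$ time, where $n=|V(G)|$, $m=|A(G)|$, and $c$ is the number of strongly connected components of $G_\ell$. The constant hidden in the $O$ is absolute. -/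

import Mathlib

/-! ### The machine model: additive random access machines with uniform cost

A program manipulates finitely many integer registers and finitely many zero-initialised
arrays. One step is a constant assignment, a copy, an addition, a truncated subtraction, an
indirect read or write of an array cell, or a comparison of two registers. There is no
multiplication, division or bitwise operation. Control flow is structured. -/

namespace RAM

/-- The contents of the registers and of the arrays (`arr a i` is cell `i` of array `a`). -/
structure State where
  reg : ℕ → ℕ
  arr : ℕ → ℕ → ℕ

/-- Elementary instructions; the arguments are names of registers (`x y z`), names of arrays (`a`)
and numerical constants of the program (`k`). -/
inductive Instr where
  /-- `x := k` -/
  | const (x k : ℕ)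
  /-- `x := y` -/
  | copy (x y : ℕ)
  /-- `x := y + z` -/
  | add (x y z : ℕ)
  /-- `x := max (y - z) 0` -/
  | sub (x y z : ℕ)
  /-- `x := a[y]` -/
  | load (x a y : ℕ)
  /-- `a[x] := y` -/
  | store (a x y : ℕ)

/-- Tests of two registers. -/
inductive Test where
  /-- `x < y` -/
  | lt (x y : ℕ)
  /-- `x = y` -/
  | eq (x y : ℕ)

/-- Programs. -/
inductive Prog where
  | skip
  | instr (i : Instr)
  | seq (p q : Prog)
  | ite (b : Test) (p q : Prog)
  | while (b : Test) (p : Prog)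

/-- Assignment to a register. -/
def State.setReg (s : State) (x k : ℕ) : State :=
  { s with reg := Function.update s.reg x k }

/-- Assignment to an array cell. -/
def State.setArr (s : State) (a i k : ℕ) : State :=
  { s with arr := Function.update s.arr a (Function.update (s.arr a) i k) }

/-- The effect of an elementary instruction. -/
def Instr.apply : Instr → State → State
  | .const x k, s => s.setReg x k
  | .copy x y, s => s.setReg x (s.reg y)
  | .add x y z, s => s.setReg x (s.reg y + s.reg z)
  | .sub x y z, s => s.setReg x (s.reg y - s.reg z)
  | .load x a y, s => s.setReg x (s.arr a (s.reg y))
  | .store a x y, s => s.setArr a (s.reg x) (s.reg y)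

/-- The outcome of a test. -/
def Test.Holds : Test → State → Prop
  | .lt x y, s => s.reg x < s.reg y
  | .eq x y, s => s.reg x = s.reg y

/-- `Exec p s s' t`: started in state `s`, the program `p` halts in state `s'` after exactly `t`
steps. Every elementary instruction and every evaluation of a test is one step. -/
inductive Exec : Prog → State → State → ℕ → Prop
  | skip (s : State) : Exec .skip s s 0
  | instr (i : Instr) (s : State) : Exec (.instr i) s (i.apply s) 1
  | seq {p q : Prog} {s s₁ s₂ : State} {t₁ t₂ : ℕ} :
      Exec p s s₁ t₁ → Exec q s₁ s₂ t₂ → Exec (.seq p q) s s₂ (t₁ + t₂)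
  | iteTrue {b : Test} {p q : Prog} {s s₁ : State} {t : ℕ} :
      b.Holds s → Exec p s s₁ t → Exec (.ite b p q) s s₁ (t + 1)
  | iteFalse {b : Test} {p q : Prog} {s s₁ : State} {t : ℕ} :
      ¬ b.Holds s → Exec q s s₁ t → Exec (.ite b p q) s s₁ (t + 1)
  | whileFalse {b : Test} {p : Prog} {s : State} :
      ¬ b.Holds s → Exec (.while b p) s s 1
  | whileTrue {b : Test} {p : Prog} {s s₁ s₂ : State} {t₁ t₂ : ℕ} :
      b.Holds s → Exec p s s₁ t₁ → Exec (.while b p) s₁ s₂ t₂ →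
        Exec (.while b p) s s₂ (t₁ + t₂ + 1)

/-- The machine is deterministic: the final state and the number of steps are unique. -/
theorem Exec.deterministic {p : Prog} {s s₁ s₂ : State} {t₁ t₂ : ℕ}
    (h₁ : Exec p s s₁ t₁) (h₂ : Exec p s s₂ t₂) : s₁ = s₂ ∧ t₁ = t₂ := by
  induction h₁ generalizing s₂ t₂ with
  | skip => cases h₂; exact ⟨rfl, rfl⟩
  | instr => cases h₂; exact ⟨rfl, rfl⟩
  | seq _ _ ih₁ ih₂ =>
    cases h₂ with
    | seq k₁ k₂ =>
      obtain ⟨rfl, rfl⟩ := ih₁ k₁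
      obtain ⟨rfl, rfl⟩ := ih₂ k₂
      exact ⟨rfl, rfl⟩
  | iteTrue hb _ ih =>
    cases h₂ with
    | iteTrue _ k => obtain ⟨rfl, rfl⟩ := ih k; exact ⟨rfl, rfl⟩
    | iteFalse hb' _ => exact absurd hb hb'
  | iteFalse hb _ ih =>
    cases h₂ with
    | iteTrue hb' _ => exact absurd hb' hb
    | iteFalse _ k => obtain ⟨rfl, rfl⟩ := ih k; exact ⟨rfl, rfl⟩
  | whileFalse hb =>
    cases h₂ with
    | whileFalse _ => exact ⟨rfl, rfl⟩
    | whileTrue hb' _ _ => exact absurd hb' hb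
  | whileTrue hb _ _ ih₁ ih₂ =>
    cases h₂ with
    | whileFalse hb' => exact absurd hb hb'
    | whileTrue _ k₁ k₂ =>
      obtain ⟨rfl, rfl⟩ := ih₁ k₁
      obtain ⟨rfl, rfl⟩ := ih₂ k₂
      exact ⟨rfl, rfl⟩

end RAM

/-! ### Min-Power Asymmetric Connectivity

An instance is a digraph `G` with arc weights `w`, where `w v u` is the weight of the arc `vu`;
the values of `w` at pairs that are not arcs of `G` are never used. `H ≤ G` says that `H` is a
spanning subgraph of `G`. -/

namespace MinPAC

/-- There is a (possibly trivial) directed path from `u` to `v`. -/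
def Reach {V : Type*} (G : Digraph V) (u v : V) : Prop :=
  Relation.ReflTransGen G.Adj u v

/-- Strong connectivity. -/
def StronglyConnected {V : Type*} (G : Digraph V) : Prop :=
  ∀ u v : V, Reach G u v

/-- The strongly connected component of `v`. -/
def scc {V : Type*} (G : Digraph V) (v : V) : Set V :=
  {u | Reach G v u ∧ Reach G u v}

/-- The number of strongly connected components. -/
noncomputable def numSCC {V : Type*} (G : Digraph V) : ℕ :=
  (Set.range (scc G)).ncard

open Classical in
/-- The cost paid by `v` in `H`: the weight of its heaviest outgoing arc (`0` if there is none). -/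
noncomputable def vertexCost {V : Type*} [Fintype V] (w : V → V → ℕ) (H : Digraph V) (v : V) : ℕ :=
  (Finset.univ.filter fun u => H.Adj v u).sup (w v)

/-- The cost of `H`. -/
noncomputable def cost {V : Type*} [Fintype V] (w : V → V → ℕ) (H : Digraph V) : ℕ :=
  ∑ v, vertexCost w H v

/-- `H` is an optimal solution of the instance `(G, w)`. -/
def IsOptimal {V : Type*} [Fintype V] (G : Digraph V) (w : V → V → ℕ) (H : Digraph V) : Prop :=
  (H ≤ G ∧ StronglyConnected H) ∧
    ∀ H' : Digraph V, H' ≤ G → StronglyConnected H' → cost w H ≤ cost w H'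

/-- `l` is a vertex lower bound: in every optimal solution, every vertex `v` pays at
least `l v`. -/
def IsVertexLowerBound {V : Type*} [Fintype V] (G : Digraph V) (w : V → V → ℕ) (l : V → ℕ) :
    Prop :=
  ∀ H : Digraph V, IsOptimal G w H → ∀ v, l v ≤ vertexCost w H v

/-- The obligatory subgraph induced by `l`. -/
def obligatory {V : Type*} (G : Digraph V) (w : V → V → ℕ) (l : V → ℕ) : Digraph V where
  Adj v u := G.Adj v u ∧ w v u ≤ l v

/-- `L` lists every arc of `G` exactly once, in some order. -/
def IsArcList {V : Type*} (G : Digraph V) (L : List (V × V)) : Prop :=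
  L.Nodup ∧ ∀ v u, (v, u) ∈ L ↔ G.Adj v u

/-- The initial state of the machine on the instance with vertex set `{0, …, n - 1}`, list of
arcs `L`, weights `w` and lower bound `l`: register `0` holds the number of vertices, register `1`
the number of arcs, arrays `0`, `1`, `2` the initial vertices, terminal vertices and weights of the
arcs, and array `3` the lower bounds; everything else is `0`. -/
def inputState {n : ℕ} (L : List (Fin n × Fin n)) (w : Fin n → Fin n → ℕ) (l : Fin n → ℕ) :
    RAM.State where
  reg x := if x = 0 then n else if x = 1 then L.length else 0
  arr a i :=
    if a = 0 then if h : i < L.length then (L[i].1 : ℕ) else 0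
    else if a = 1 then if h : i < L.length then (L[i].2 : ℕ) else 0
    else if a = 2 then if h : i < L.length then w L[i].1 L[i].2 else 0
    else if a = 3 then if h : i < n then l ⟨i, h⟩ else 0
    else 0

/-- The state `s` presents the list of arcs `L` as output: register `0` holds its length, arrays
`0` and `1` hold the initial and terminal vertices of its arcs. -/
def Outputs {n : ℕ} (s : RAM.State) (L : List (Fin n × Fin n)) : Prop :=
  s.reg 0 = L.length ∧
    ∀ (i : ℕ) (h : i < L.length), s.arr 0 i = (L[i].1 : ℕ) ∧ s.arr 1 i = (L[i].2 : ℕ)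

/-- The program `P`, given `G`, `w` and `l`, where the arcs of `G` come in the order of `L`, halts
after at most `T` steps and outputs the arcs of an optimal solution of `(G, w)`. -/
def SolvesWithin (P : RAM.Prog) {n : ℕ} (G : Digraph (Fin n)) (w : Fin n → Fin n → ℕ)
    (l : Fin n → ℕ) (L : List (Fin n × Fin n)) (T : ℝ) : Prop :=
  ∃ (s : RAM.State) (t : ℕ) (H : Digraph (Fin n)) (M : List (Fin n × Fin n)),
    RAM.Exec P (inputState L w l) s t ∧ (t : ℝ) ≤ T ∧
      IsOptimal G w H ∧ IsArcList H M ∧ Outputs s M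

end MinPAC

/-! Every optimal solution pays at least `l v` at each vertex `v`, so its cost is the sum of `l`
plus the sum of the increases over `l`, and it suffices to minimise the increases. With the powers
`l` alone each component of the obligatory subgraph is already strongly connected. Hence powers
above `l` give a strongly connected digraph as soon as the arcs they add connect the components
strongly, which means that they contain a spanning tree directed from component `0` and one directed
to it (`exists_tree`). A pair of such trees is a pair of parent maps, that is, a number below `c ^
(c + c)` whose digits in base `c` are the parents (`exists_valid`).

A fixed pair of trees prescribes for each component the set `S` of components it must have arcs to.
Since power is paid at tails, different components can be treated separately. The least increase for
a component and a set `S` is found by a dynamic program over the vertices of the component: raising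
`v` to the level that reaches component `j` covers at once every `d` with `W v d ≤ W v j`, so there
are `c` levels to try for each vertex and each of the `2 ^ c` sets. `IsTables.le_sum` says that no
choice of increases beats the tables, `IsTables.increase` that the tabulated values are attained.

Contracting an optimal solution gives a pair of trees that costs no more
(`IsInput.exists_treeCost_le`); conversely, the powers read off for a cheapest pair yield a strongly
connected digraph (`IsInput.stronglyConnected`). Together they give `IsInput.isOptimal`.

The components are found by Kosaraju's two depth-first searches (`strong_of_lab`). Programs are
verified in a total-correctness calculus `wp` whose postconditions also see the number of steps. The
tables take `n * 2 ^ c * c ^ 2` steps up to a constant, the enumeration `c ^ 2 * c ^ (2 * c)`. As `c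
^ 2 ≤ 4 * 2 ^ c`, the surplus factor `c ^ (7 / 2)` over `c ^ (2 * c - 3 / 2)` is at most `16 * 4 ^
c` (`timeBound_le`). -/

set_option linter.unusedSimpArgs false

/-! ### A program logic for the machine -/

namespace RAM

infixr:60 " ;; " => Prog.seq

/-- The instruction does not write to the register `r`. -/
def Instr.keepsReg (r : ℕ) : Instr → Bool
  | .const x _ => x != r
  | .copy x _ => x != r
  | .add x _ _ => x != r
  | .sub x _ _ => x != r
  | .load x _ _ => x != r
  | .store _ _ _ => true

/-- The instruction does not write to the array `b`. -/
def Instr.keepsArr (b : ℕ) : Instr → Bool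
  | .store a _ _ => a != b
  | _ => true

/-- The program has no instruction that writes to the register `r`. -/
def Prog.keepsReg (r : ℕ) : Prog → Bool
  | .skip => true
  | .instr i => i.keepsReg r
  | .seq p q => p.keepsReg r && q.keepsReg r
  | .ite _ p q => p.keepsReg r && q.keepsReg r
  | .while _ p => p.keepsReg r

/-- The program has no instruction that writes to the array `b`. -/
def Prog.keepsArr (b : ℕ) : Prog → Bool
  | .skip => true
  | .instr i => i.keepsArr b
  | .seq p q => p.keepsArr b && q.keepsArr b
  | .ite _ p q => p.keepsArr b && q.keepsArr b
  | .while _ p => p.keepsArr b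

@[simp] theorem State.reg_setReg (s : State) (x k y : ℕ) :
    (s.setReg x k).reg y = if y = x then k else s.reg y := by
  simp [State.setReg, Function.update_apply]

@[simp] theorem State.arr_setReg (s : State) (x k : ℕ) : (s.setReg x k).arr = s.arr := rfl

@[simp] theorem State.reg_setArr (s : State) (a i k : ℕ) : (s.setArr a i k).reg = s.reg := rfl

@[simp] theorem State.arr_setArr (s : State) (a i k b : ℕ) :
    (s.setArr a i k).arr b = if b = a then Function.update (s.arr a) i k else s.arr b := by
  simp [State.setArr, Function.update_apply]

theorem Instr.reg_apply {i : Instr} {r : ℕ} (h : i.keepsReg r = true) (s : State) :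
    (i.apply s).reg r = s.reg r := by
  cases i with
  | store => rfl
  | _ => simp only [Instr.keepsReg, bne_iff_ne] at h; simp [Instr.apply, Ne.symm h]

theorem Instr.arr_apply {i : Instr} {b : ℕ} (h : i.keepsArr b = true) (s : State) :
    (i.apply s).arr b = s.arr b := by
  cases i with
  | store => simp only [Instr.keepsArr, bne_iff_ne] at h; simp [Instr.apply, Ne.symm h]
  | _ => rfl

/-- The states agree on every register and every array that `p` does not write to. -/
structure Frame (p : Prog) (s s' : State) : Prop where
  reg : ∀ r, p.keepsReg r = true → s'.reg r = s.reg r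
  arr : ∀ a, p.keepsArr a = true → s'.arr a = s.arr a

theorem Frame.refl (p : Prog) (s : State) : Frame p s s := ⟨fun _ _ => rfl, fun _ _ => rfl⟩

theorem Frame.trans {p : Prog} {s₁ s₂ s₃ : State} (h : Frame p s₁ s₂) (h' : Frame p s₂ s₃) :
    Frame p s₁ s₃ :=
  ⟨fun r hr => (h'.reg r hr).trans (h.reg r hr), fun a ha => (h'.arr a ha).trans (h.arr a ha)⟩

/-- Since `keepsReg` and `keepsArr` compute, for a concrete program the preservation of a register
or array follows from this by `rfl`. Specifications therefore only have to mention what changes. -/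
theorem Exec.frame {p : Prog} {s s' : State} {t : ℕ} (h : Exec p s s' t) : Frame p s s' := by
  induction h with
  | skip => exact Frame.refl _ _
  | instr i s => exact ⟨fun r hr => i.reg_apply hr s, fun a ha => i.arr_apply ha s⟩
  | seq _ _ ih₁ ih₂ =>
    refine ⟨fun r hr => ?_, fun a ha => ?_⟩
    · simp only [Prog.keepsReg, Bool.and_eq_true] at hr
      exact (ih₂.reg r hr.2).trans (ih₁.reg r hr.1)
    · simp only [Prog.keepsArr, Bool.and_eq_true] at ha
      exact (ih₂.arr a ha.2).trans (ih₁.arr a ha.1)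
  | iteTrue _ _ ih =>
    refine ⟨fun r hr => ?_, fun a ha => ?_⟩
    · simp only [Prog.keepsReg, Bool.and_eq_true] at hr
      exact ih.reg r hr.1
    · simp only [Prog.keepsArr, Bool.and_eq_true] at ha
      exact ih.arr a ha.1
  | iteFalse _ _ ih =>
    refine ⟨fun r hr => ?_, fun a ha => ?_⟩
    · simp only [Prog.keepsReg, Bool.and_eq_true] at hr
      exact ih.reg r hr.2
    · simp only [Prog.keepsArr, Bool.and_eq_true] at ha
      exact ih.arr a ha.2
  | whileFalse => exact Frame.refl _ _
  | whileTrue _ _ _ ih₁ ih₂ =>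
    exact Frame.trans ⟨fun r hr => ih₁.reg r hr, fun a ha => ih₁.arr a ha⟩ ih₂

/-- Started in the state `s`, the program `p` halts, and the final state and the number of steps
satisfy `Q`. -/
def wp (p : Prog) (s : State) (Q : State → ℕ → Prop) : Prop :=
  ∃ s' t, Exec p s s' t ∧ Q s' t

theorem wp_skip {s : State} {Q : State → ℕ → Prop} : wp .skip s Q ↔ Q s 0 :=
  ⟨fun ⟨_, _, h, hQ⟩ => by cases h; exact hQ, fun h => ⟨_, _, .skip s, h⟩⟩

theorem wp_instr {i : Instr} {s : State} {Q : State → ℕ → Prop} :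
    wp (.instr i) s Q ↔ Q (i.apply s) 1 :=
  ⟨fun ⟨_, _, h, hQ⟩ => by cases h; exact hQ, fun h => ⟨_, _, .instr i s, h⟩⟩

theorem wp_seq {p q : Prog} {s : State} {Q : State → ℕ → Prop} :
    wp (p ;; q) s Q ↔ wp p s fun s₁ t₁ => wp q s₁ fun s₂ t₂ => Q s₂ (t₁ + t₂) := by
  constructor
  · rintro ⟨_, _, h, hQ⟩
    cases h with
    | seq h₁ h₂ => exact ⟨_, _, h₁, _, _, h₂, hQ⟩
  · rintro ⟨_, _, h₁, _, _, h₂, hQ⟩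
    exact ⟨_, _, .seq h₁ h₂, hQ⟩

theorem wp_ite {b : Test} {p q : Prog} {s : State} {Q : State → ℕ → Prop} :
    wp (.ite b p q) s Q ↔ (b.Holds s → wp p s fun s' t => Q s' (t + 1)) ∧
      (¬ b.Holds s → wp q s fun s' t => Q s' (t + 1)) := by
  constructor
  · rintro ⟨_, _, h, hQ⟩
    cases h with
    | iteTrue hb h => exact ⟨fun _ => ⟨_, _, h, hQ⟩, fun hb' => absurd hb hb'⟩
    | iteFalse hb h => exact ⟨fun hb' => absurd hb' hb, fun _ => ⟨_, _, h, hQ⟩⟩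
  · rintro ⟨h₁, h₂⟩
    by_cases hb : b.Holds s
    · obtain ⟨_, _, h, hQ⟩ := h₁ hb
      exact ⟨_, _, .iteTrue hb h, hQ⟩
    · obtain ⟨_, _, h, hQ⟩ := h₂ hb
      exact ⟨_, _, .iteFalse hb h, hQ⟩

theorem wp.mono {p : Prog} {s : State} {Q R : State → ℕ → Prop} (h : wp p s Q)
    (hQR : ∀ s' t, Frame p s s' → Q s' t → R s' t) : wp p s R := by
  obtain ⟨s', t, hp, hQ⟩ := h
  exact ⟨s', t, hp, hQR s' t hp.frame hQ⟩

theorem wp.seq {p q : Prog} {s : State} {Q R : State → ℕ → Prop} (h : wp p s Q)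
    (hq : ∀ s₁ t₁, Frame p s s₁ → Q s₁ t₁ → wp q s₁ fun s₂ t₂ => R s₂ (t₁ + t₂)) :
    wp (p ;; q) s R :=
  wp_seq.2 (h.mono hq)

/-- A loop whose body decreases a potential by at least the time it takes. -/
theorem wp_while {b : Test} {p : Prog} (I : ℕ → State → Prop) {s₀ : State} {M : ℕ}
    (hp : ∀ m s, Frame p s₀ s → I m s → b.Holds s →
      wp p s fun s' t => ∃ m', t + 1 + m' ≤ m ∧ I m' s') (h₀ : I M s₀) :
    wp (.while b p) s₀ fun s' t => ∃ m, t + m ≤ M + 1 ∧ I m s' ∧ ¬ b.Holds s' := by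
  suffices H : ∀ m s, Frame p s₀ s → I m s →
      wp (.while b p) s fun s' t => ∃ m', t + m' ≤ m + 1 ∧ I m' s' ∧ ¬ b.Holds s' from
    H _ s₀ (Frame.refl _ _) h₀
  intro m
  induction m using Nat.strong_induction_on with
  | _ m ih =>
    intro s hF hI
    by_cases hb : b.Holds s
    · obtain ⟨s₁, t₁, h₁, m₁, ht₁, hI₁⟩ := hp m s hF hI hb
      obtain ⟨s₂, t₂, h₂, m₂, ht₂, hI₂⟩ := ih m₁ (by omega) s₁ (hF.trans h₁.frame) hI₁
      exact ⟨s₂, _, .whileTrue hb h₁ h₂, m₂, by omega, hI₂⟩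
    · exact ⟨s, _, .whileFalse hb, m, by omega, hI, hb⟩

/-- `for i := 0 to n - 1 do body`, where `i` and `n` are registers; the register `2` has to
contain `1`. -/
def forUp (i n : ℕ) (body : Prog) : Prog :=
  .instr (.const i 0) ;; .while (.lt i n) (body ;; .instr (.add i i 2))

/-- A round costs the body, the increment and the test; the summand `2` pays for the initialisation
and the last, failing test. The side condition `hi` is Boolean so that `rfl` settles it for concrete
bodies. -/
theorem wp_forUp {i n : ℕ} {body : Prog} {N K : ℕ} (I : ℕ → State → Prop) {s₀ : State}
    (hi : (body.keepsReg i && body.keepsReg n && body.keepsReg 2 && i != n && i != 2) = true)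
    (hone : s₀.reg 2 = 1) (hn : s₀.reg n = N)
    (h₀ : I 0 (s₀.setReg i 0))
    (hb : ∀ k < N, ∀ s, Frame (forUp i n body) s₀ s → I k s → s.reg i = k →
      wp body s fun s' t => t ≤ K ∧ I (k + 1) (s'.setReg i (k + 1))) :
    wp (forUp i n body) s₀ fun s' t => t ≤ N * (K + 2) + 2 ∧ I N s' := by
  simp only [Bool.and_eq_true, bne_iff_ne, ne_eq] at hi
  obtain ⟨⟨⟨⟨hbi, hbn⟩, hb2⟩, hin⟩, hi2⟩ := hi
  rw [forUp, wp_seq, wp_instr]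
  have hw := wp_while (b := .lt i n) (p := body ;; .instr (.add i i 2)) (s₀ := s₀.setReg i 0)
    -- The frame with respect to the start of the whole loop is part of the invariant, so that the
    -- bound in register `n` and the constant in register `2` are known in every round.
    (M := N * (K + 2)) (fun m s => m = (N - s.reg i) * (K + 2) ∧
      Frame (forUp i n body) s₀ s ∧ s.reg i ≤ N ∧ I (s.reg i) s) ?_ ?_
  · refine hw.mono ?_
    rintro s' t - ⟨m, ht, ⟨-, hF, hle, hI⟩, hlt⟩
    have hnN : s'.reg n = N := by
      rw [hF.reg n (by simp [forUp, Prog.keepsReg, Instr.keepsReg, hbn, hin]), hn]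
    simp only [Test.Holds, hnN, not_lt] at hlt
    have : s'.reg i = N := le_antisymm hle hlt
    refine ⟨?_, this ▸ hI⟩
    omega
  · rintro _ s - ⟨rfl, hF, hle, hI⟩ hlt
    have hnN : s.reg n = N := by
      rw [hF.reg n (by simp [forUp, Prog.keepsReg, Instr.keepsReg, hbn, hin]), hn]
    have h2 : s.reg 2 = 1 := by
      rw [hF.reg 2 (by simp [forUp, Prog.keepsReg, Instr.keepsReg, hb2, hi2]), hone]
    simp only [Test.Holds, hnN] at hlt
    refine (hb _ hlt s hF hI rfl).seq ?_
    rintro s₁ t₁ hF₁ ⟨ht₁, hI₁⟩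
    have e1 : s₁.reg i = s.reg i := hF₁.reg i hbi
    have e2 : s₁.reg 2 = 1 := by rw [hF₁.reg 2 hb2, h2]
    rw [wp_instr]
    simp only [Instr.apply, e1, e2]
    refine ⟨_, ?_, rfl, hF.trans ⟨fun r hr => ?_, fun a ha => ?_⟩, ?_, ?_⟩
    · simp only [State.reg_setReg, if_true]
      obtain ⟨D, hD⟩ : ∃ D, N - s.reg i = D + 1 := ⟨N - s.reg i - 1, by omega⟩
      have : N - (s.reg i + 1) = D := by omega
      rw [this, hD]
      ring_nf
      omega
    · have hr' := hr
      simp [forUp, Prog.keepsReg, Instr.keepsReg] at hr'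
      simp [Ne.symm hr'.1, hF₁.reg r hr'.2.1]
    · have ha' := ha
      simp [forUp, Prog.keepsArr, Instr.keepsArr] at ha'
      simp [hF₁.arr a ha']
    · simp; omega
    · simpa using hI₁
  · refine ⟨by simp, ⟨fun r hr => ?_, fun a ha => rfl⟩, by simp, by simpa using h₀⟩
    simp [forUp, Prog.keepsReg, Instr.keepsReg] at hr
    simp [Ne.symm hr.1]

end RAM

/-! ### Depth-first search and strongly connected components -/

namespace DFS

open Relation

/-- A state of the search: the stack (top first), the finished vertices (last one first), the
labels (`0` for vertices not seen so far), the number of trees, the arcs still to be scanned, and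
the roots already considered and still to be considered. -/
structure Config where
  stk : List ℕ
  fin : List ℕ
  lab : ℕ → ℕ
  k : ℕ
  adj : ℕ → List ℕ
  done : List ℕ
  todo : List ℕ

/-- One step of the search. -/
inductive Step : Config → Config → Prop
  | old {fin lab k adj dn r td} : lab r ≠ 0 →
      Step ⟨[], fin, lab, k, adj, dn, r :: td⟩ ⟨[], fin, lab, k, adj, dn ++ [r], td⟩
  | root {fin lab k adj dn r td} : lab r = 0 →
      Step ⟨[], fin, lab, k, adj, dn, r :: td⟩
        ⟨[r], fin, Function.update lab r (k + 1), k + 1, adj, dn ++ [r], td⟩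
  | pop {v st fin lab k adj dn td} : adj v = [] →
      Step ⟨v :: st, fin, lab, k, adj, dn, td⟩ ⟨st, v :: fin, lab, k, adj, dn, td⟩
  | skip {v st fin lab k adj dn td u us} : adj v = u :: us → lab u ≠ 0 →
      Step ⟨v :: st, fin, lab, k, adj, dn, td⟩
        ⟨v :: st, fin, lab, k, Function.update adj v us, dn, td⟩
  | push {v st fin lab k adj dn td u us} : adj v = u :: us → lab u = 0 →
      Step ⟨v :: st, fin, lab, k, adj, dn, td⟩
        ⟨u :: v :: st, fin, Function.update lab u k, k, Function.update adj v us, dn, td⟩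

/-- Whenever a vertex `x` of the list has been finished, the arcs leaving the set of the
vertices finished so far go to vertices from which `x` can be reached. -/
def FinOK (E : ℕ → ℕ → Prop) : List ℕ → Prop
  | [] => True
  | x :: l => FinOK E l ∧ ∀ a ∈ x :: l, ∀ b, E a b → b ∈ x :: l ∨ ReflTransGen E b x

/-- The invariant of the search in the digraph `E` on `{0, …, n - 1}`, with the roots taken in the
order `ord`. -/
structure Inv (n : ℕ) (E : ℕ → ℕ → Prop) (ord : List ℕ) (a : Config) : Prop where
  ord_eq : ord = a.done ++ a.todo
  lab_iff : ∀ x, a.lab x ≠ 0 ↔ x ∈ a.stk ∨ x ∈ a.fin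
  nodup : (a.stk ++ a.fin).Nodup
  lt : ∀ x, a.lab x ≠ 0 → x < n
  adj_sub : ∀ v, ∀ u ∈ a.adj v, E v u
  scanned : ∀ v u, E v u → u ∈ a.adj v ∨ (a.lab u ≠ 0 ∧ a.lab u ≤ a.lab v)
  adj_fin : ∀ v ∈ a.fin, a.adj v = []
  chain : a.stk.Pairwise fun x y => ReflTransGen E y x
  lab_stk : ∀ x ∈ a.stk, a.lab x = a.k
  lab_le : ∀ x, a.lab x ≤ a.k
  finOK : FinOK E a.fin
  done_lab : ∀ x ∈ a.done, a.lab x ≠ 0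
  roots : ∀ j, 1 ≤ j → j ≤ a.k → ∃ r, a.lab r = j ∧
    (∀ x, a.lab x = j → ReflTransGen E r x) ∧
    ∃ pre post, ord = pre ++ r :: post ∧ ∀ x ∈ pre, a.lab x ≠ 0 ∧ a.lab x < j

variable {n : ℕ} {E : ℕ → ℕ → Prop} {ord : List ℕ}

theorem Inv.init {adj : ℕ → List ℕ} (h : ∀ v u, u ∈ adj v ↔ E v u) :
    Inv n E ord ⟨[], [], fun _ => 0, 0, adj, [], ord⟩ where
  ord_eq := rfl
  lab_iff := by simp
  nodup := by simp
  lt := by simp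
  adj_sub v u hu := (h v u).1 hu
  scanned v u hu := .inl ((h v u).2 hu)
  adj_fin := by simp
  chain := by simp
  lab_stk := by simp
  lab_le := by simp
  finOK := trivial
  done_lab := by simp
  roots j h₁ h₂ := by simp at h₂; omega

/-- Labels number the trees in the order of their creation. A vertex on the stack belongs to the
current tree, which has the largest label so far, so an arc scanned from it never leads to a larger
label. -/
theorem Inv.step (hE : ∀ v u, E v u → u < n) (hord : ∀ x ∈ ord, x < n) {a b : Config}
    (h : Inv n E ord a) (hs : Step a b) : Inv n E ord b := by
  cases hs with
  | @old fin lab k adj dn r td hr =>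
    refine { h with ord_eq := by simpa using h.ord_eq, done_lab := ?_ }
    intro x hx
    rcases List.mem_append.1 hx with hx | hx
    · exact h.done_lab x hx
    · simp only [List.mem_singleton] at hx
      exact hx ▸ hr
  | @root fin lab k adj dn r td hr =>
    have hlab := h.lab_iff
    have hle := h.lab_le
    simp only [List.not_mem_nil, false_or] at hlab hle
    have hrf : r ∉ fin := fun hf => (hlab r).2 hf hr
    refine
      { ord_eq := by simpa using h.ord_eq
        lab_iff := ?_, nodup := ?_, lt := ?_, adj_sub := h.adj_sub, scanned := ?_
        adj_fin := h.adj_fin, chain := by simp, lab_stk := by simp, lab_le := ?_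
        finOK := h.finOK, done_lab := ?_, roots := ?_ }
    · intro x
      by_cases hx : x = r
      · simp [hx]
      · simp [hx, hlab x]
    · simpa [hrf] using h.nodup
    · intro x hx
      by_cases hxr : x = r
      · exact hord x (by rw [h.ord_eq]; simp [hxr])
      · exact h.lt x (by simpa [Function.update_of_ne hxr] using hx)
    · intro v u hvu
      rcases h.scanned v u hvu with hu | ⟨hu, huv⟩
      · exact .inl hu
      · have hur : u ≠ r := fun e => hu (e ▸ hr)
        refine .inr ⟨by simpa [Function.update_of_ne hur] using hu, ?_⟩
        by_cases hv : v = r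
        · simp only [hv, Function.update_self, Function.update_of_ne hur]
          exact (hle u).trans (Nat.le_succ k)
        · simpa [Function.update_of_ne hur, Function.update_of_ne hv] using huv
    · intro x
      by_cases hx : x = r
      · simp [hx]
      · simp only [Function.update_of_ne hx]
        exact (hle x).trans (Nat.le_succ k)
    · intro x hx
      by_cases hxr : x = r
      · simp [hxr]
      · rcases List.mem_append.1 hx with hx | hx
        · simpa [Function.update_of_ne hxr] using h.done_lab x hx
        · exact absurd (by simpa using hx) hxr
    · intro j h₁ h₂
      simp only at h₂
      rcases Nat.lt_or_ge k j with hj | hj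
      · obtain rfl : j = k + 1 := by omega
        -- The prefix before the new root consists of the roots already considered; they are all
        -- labelled, hence belong to older trees.
        refine ⟨r, by simp, ?_, dn, td, h.ord_eq, ?_⟩
        · intro x hx
          by_cases hxr : x = r
          · rw [hxr]
          · simp only [Function.update_of_ne hxr] at hx
            have := hle x
            omega
        · intro x hx
          have hx0 := h.done_lab x hx
          simp only at hx0
          have hxr : x ≠ r := fun e => hx0 (e ▸ hr)
          have := hle x
          simp only [Function.update_of_ne hxr]
          exact ⟨hx0, by omega⟩
      · obtain ⟨r', hr', hreach, pre, post, he, hpre⟩ := h.roots j h₁ hj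
        simp only at hr' hreach hpre
        have hrr : r' ≠ r := fun e => by rw [e, hr] at hr'; omega
        refine ⟨r', by simpa [Function.update_of_ne hrr] using hr', ?_, pre, post, he, ?_⟩
        · intro x hx
          by_cases hxr : x = r
          · rw [hxr] at hx
            simp at hx
            omega
          · exact hreach x (by simpa [Function.update_of_ne hxr] using hx)
        · intro x hx
          have hxr : x ≠ r := fun e => (hpre x hx).1 (e ▸ hr)
          simpa [Function.update_of_ne hxr] using hpre x hx
  | @pop v st fin lab k adj dn td hv =>
    have hch := h.chain
    simp only [List.pairwise_cons] at hch
    refine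
      { ord_eq := h.ord_eq, lab_iff := ?_, nodup := ?_, lt := h.lt, adj_sub := h.adj_sub
        scanned := h.scanned, adj_fin := ?_, chain := hch.2
        lab_stk := fun x hx => h.lab_stk x (by simp at hx ⊢; exact .inr hx), lab_le := h.lab_le
        finOK := ?_, done_lab := h.done_lab, roots := h.roots }
    · intro x
      rw [h.lab_iff x]
      simp only [List.mem_cons]
      tauto
    · have := h.nodup
      simp only [List.cons_append] at this
      exact (List.perm_middle.nodup_iff).2 this
    · intro x hx
      rcases List.mem_cons.1 hx with rfl | hx
      · exact hv
      · exact h.adj_fin x hx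
    -- All arcs leaving finished vertices have been scanned, so an arc out of the finished set ends
    -- below `v` on the stack, and `chain` says that `v` can be reached from there.
    · refine ⟨h.finOK, fun x hx y hxy => ?_⟩
      have hadj : adj x = [] := by
        rcases List.mem_cons.1 hx with rfl | hx
        · exact hv
        · exact h.adj_fin x hx
      rcases h.scanned x y hxy with hy | ⟨hy, -⟩
      · simp [hadj] at hy
      · rcases (h.lab_iff y).1 hy with hy | hy
        · rcases List.mem_cons.1 hy with rfl | hy
          · simp
          · exact .inr (hch.1 y hy)
        · exact .inl (List.mem_cons_of_mem _ hy)
  | @skip v st fin lab k adj dn td u us hv hu =>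
    have hvs : lab v = k := h.lab_stk v (by simp)
    refine { h with adj_sub := ?_, scanned := ?_, adj_fin := ?_ }
    · intro x y hy
      by_cases hx : x = v
      · subst hx
        simp only [Function.update_self] at hy
        exact h.adj_sub x y (by simp only [hv]; exact List.mem_cons_of_mem _ hy)
      · exact h.adj_sub x y (by simpa [Function.update_of_ne hx] using hy)
    · intro x y hxy
      by_cases hx : x = v
      · subst hx
        rcases h.scanned x y hxy with hy | hy
        · simp only [hv, List.mem_cons] at hy
          rcases hy with rfl | hy
          · exact .inr ⟨hu, by simpa only [hvs] using h.lab_le y⟩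
          · exact .inl (by simpa using hy)
        · exact .inr hy
      · simpa [Function.update_of_ne hx] using h.scanned x y hxy
    · intro x hx
      have hxv : x ≠ v := by
        rintro rfl
        have := h.adj_fin x hx
        simp [hv] at this
      simpa [Function.update_of_ne hxv] using h.adj_fin x hx
  | @push v st fin lab k adj dn td u us hv hu =>
    have hvs : lab v = k := h.lab_stk v (by simp)
    have hk : k ≠ 0 := by
      rw [← hvs]; exact (h.lab_iff v).2 (by simp)
    have hEvu : E v u := h.adj_sub v u (by simp [hv])
    have hun : ∀ x, lab x ≠ 0 → x ≠ u := fun x hx e => hx (e ▸ hu)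
    have hus : ¬ (u ∈ v :: st ∨ u ∈ fin) := fun hc => (h.lab_iff u).2 hc hu
    push Not at hus
    refine
      { ord_eq := h.ord_eq
        lab_iff := ?_, nodup := ?_, lt := ?_, adj_sub := ?_, scanned := ?_
        adj_fin := ?_, chain := ?_, lab_stk := ?_, lab_le := ?_
        finOK := h.finOK, done_lab := ?_, roots := ?_ }
    · intro x
      by_cases hx : x = u
      · simp [hx, hk]
      · simpa [Function.update_of_ne hx, hx] using h.lab_iff x
    · rw [List.cons_append, List.nodup_cons, List.mem_append]
      exact ⟨by tauto, h.nodup⟩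
    · intro x hx
      by_cases hxr : x = u
      · exact hxr ▸ hE _ _ hEvu
      · exact h.lt x (by simpa [Function.update_of_ne hxr] using hx)
    · intro x y hy
      by_cases hx : x = v
      · subst hx
        simp only [Function.update_self] at hy
        exact h.adj_sub x y (by simp only [hv]; exact List.mem_cons_of_mem _ hy)
      · exact h.adj_sub x y (by simpa [Function.update_of_ne hx] using hy)
    · have hlle : ∀ x y, (lab y ≠ 0 ∧ lab y ≤ lab x) →
          Function.update lab u k y ≠ 0 ∧
            Function.update lab u k y ≤ Function.update lab u k x := by
        intro x y ⟨hy, hyx⟩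
        have hx : lab x ≠ 0 := by omega
        simpa [Function.update_of_ne (hun y hy), Function.update_of_ne (hun x hx)] using ⟨hy, hyx⟩
      intro x y hxy
      by_cases hx : x = v
      · subst hx
        rcases h.scanned x y hxy with hy | hy
        · simp only [hv, List.mem_cons] at hy
          rcases hy with rfl | hy
          · refine .inr ?_
            have : x ≠ y := hun x (by omega)
            simp [Function.update_of_ne this, hvs, hk]
          · exact .inl (by simpa using hy)
        · exact .inr (hlle _ _ hy)
      · rcases h.scanned x y hxy with hy | hy
        · exact .inl (by simpa [Function.update_of_ne hx] using hy)
        · exact .inr (hlle _ _ hy)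
    · intro x hx
      have hxv : x ≠ v := by
        rintro rfl
        have := h.adj_fin x hx
        simp [hv] at this
      simpa [Function.update_of_ne hxv] using h.adj_fin x hx
    · refine List.pairwise_cons.2 ⟨fun y hy => ?_, h.chain⟩
      rcases List.mem_cons.1 hy with rfl | hy'
      · exact .single hEvu
      · exact ((List.pairwise_cons.1 h.chain).1 y hy').tail hEvu
    · intro x hx
      by_cases hxu : x = u
      · simp [hxu]
      · simp only [Function.update_of_ne hxu]
        exact h.lab_stk x ((List.mem_cons.1 hx).resolve_left hxu)
    · intro x
      by_cases hxu : x = u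
      · simp [hxu]
      · simp only [Function.update_of_ne hxu]
        exact h.lab_le x
    · intro x hx
      have := h.done_lab x hx
      simpa [Function.update_of_ne (hun x this)] using this
    · intro j h₁ h₂
      obtain ⟨r, hr, hreach, pre, post, he, hpre⟩ := h.roots j h₁ h₂
      simp only at hr hreach hpre
      have hru : r ≠ u := hun r (by omega)
      refine ⟨r, by simpa [Function.update_of_ne hru] using hr, fun x hx => ?_, pre, post, he,
        fun x hx => ?_⟩
      · by_cases hxu : x = u
        · subst hxu
          simp only [Function.update_self] at hx
          exact (hreach v (by omega)).tail hEvu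
        · exact hreach x (by simpa [Function.update_of_ne hxu] using hx)
      · simpa [Function.update_of_ne (hun x (hpre x hx).1)] using hpre x hx

/-- A bound for the number of steps to come. -/
def Config.potential (n : ℕ) (a : Config) : ℕ :=
  a.todo.length + (∑ v ∈ Finset.range n, (a.adj v).length) + (n - a.fin.length)

theorem Inv.length_le {a : Config} (h : Inv n E ord a) : a.stk.length + a.fin.length ≤ n := by
  rw [← List.length_append, ← List.toFinset_card_of_nodup h.nodup]
  calc _ ≤ (Finset.range n).card := Finset.card_le_card fun x hx => by
        simp only [List.toFinset_append, Finset.mem_union, List.mem_toFinset] at hx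
        exact Finset.mem_range.2 (h.lt x ((h.lab_iff x).2 hx))
    _ = n := Finset.card_range n

theorem sum_length_update {adj : ℕ → List ℕ} {v u : ℕ} {us : List ℕ} (hv : v < n)
    (h : adj v = u :: us) :
    (∑ x ∈ Finset.range n, (Function.update adj v us x).length) + 1 =
      ∑ x ∈ Finset.range n, (adj x).length := by
  rw [← Finset.add_sum_erase _ _ (Finset.mem_range.2 hv),
    ← Finset.add_sum_erase (Finset.range n) (fun x => (adj x).length) (Finset.mem_range.2 hv)]
  have : ∑ x ∈ (Finset.range n).erase v, (Function.update adj v us x).length =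
      ∑ x ∈ (Finset.range n).erase v, (adj x).length :=
    Finset.sum_congr rfl fun x hx => by rw [Function.update_of_ne (Finset.ne_of_mem_erase hx)]
  simp only [this, Function.update_self, h, List.length_cons]
  omega

/-- Each step consumes a root, an arc or an unfinished vertex. For `pop`, `length_le` ensures that
the truncated difference `n - a.fin.length` really drops. -/
theorem Inv.potential_step {a b : Config} (h : Inv n E ord a) (hs : Step a b) :
    b.potential n + 1 ≤ a.potential n := by
  cases hs with
  | old _ => simp only [Config.potential, List.length_cons]; omega
  | root _ => simp only [Config.potential, List.length_cons]; omega
  | pop _ =>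
    have := h.length_le
    simp only [Config.potential, List.length_cons] at this ⊢
    omega
  | @skip v st fin lab k adj dn td u us hv _ =>
    have := sum_length_update (h.lt v ((h.lab_iff v).2 (by simp))) hv
    simp only [Config.potential]; omega
  | @push v st fin lab k adj dn td u us hv _ =>
    have := sum_length_update (h.lt v ((h.lab_iff v).2 (by simp))) hv
    simp only [Config.potential]; omega

/-- While there are unfinished vertices, the stack is not empty or a root is left. -/
theorem Inv.todo_ne_nil (hall : ∀ x < n, x ∈ ord) {a : Config} (h : Inv n E ord a)
    (hf : a.fin.length < n) (hs : a.stk = []) : a.todo ≠ [] := by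
  intro ht
  have : Finset.range n ⊆ a.fin.toFinset := fun x hx => by
    have hx' := hall x (Finset.mem_range.1 hx)
    rw [h.ord_eq, ht, List.append_nil] at hx'
    have := (h.lab_iff x).1 (h.done_lab x hx')
    simpa [hs] using this
  have := (Finset.card_le_card this).trans (List.toFinset_card_le _)
  simp at this
  omega

theorem Inv.fin_eq {a : Config} (h : Inv n E ord a) (hf : n ≤ a.fin.length) :
    a.stk = [] ∧ a.fin.length = n ∧ a.fin.Nodup ∧ ∀ x, x ∈ a.fin ↔ x < n := by
  have hle := h.length_le
  have hn : a.fin.Nodup := (List.nodup_append.1 h.nodup).2.1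
  have hs : a.stk = [] := List.length_eq_zero_iff.1 (by omega)
  have hsub : a.fin.toFinset ⊆ Finset.range n := fun x hx =>
    Finset.mem_range.2 (h.lt x ((h.lab_iff x).2 (.inr (List.mem_toFinset.1 hx))))
  have := Finset.eq_of_subset_of_card_le hsub (by
    rw [List.toFinset_card_of_nodup hn, Finset.card_range]; omega)
  refine ⟨hs, by omega, hn, fun x => ?_⟩
  rw [← List.mem_toFinset, this, Finset.mem_range]

/-- A walk that leaves an initial segment of the finished vertices does so to a vertex from which
its last vertex can be reached. -/
theorem FinOK.exit {l : List ℕ} {x y z : ℕ} (h : FinOK E (x :: l)) (hy : y ∈ x :: l)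
    (hyz : ReflTransGen E y z) (hz : z ∉ x :: l) :
    ∃ b, b ∉ x :: l ∧ ReflTransGen E b x ∧ ReflTransGen E y b ∧ ReflTransGen E b z := by
  induction hyz using ReflTransGen.head_induction_on with
  | refl => exact absurd hy hz
  | @head y b hyb hbz ih =>
    by_cases hb : b ∈ x :: l
    · obtain ⟨b', h1, h2, h3, h4⟩ := ih hb
      exact ⟨b', h1, h2, h3.head hyb, h4⟩
    · exact ⟨b, hb, (h.2 y hy b hyb).resolve_left hb, .single hyb, hbz⟩

theorem FinOK.of_append {l₁ l₂ : List ℕ} (h : FinOK E (l₁ ++ l₂)) : FinOK E l₂ := by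
  induction l₁ with
  | nil => exact h
  | cons x l ih => exact ih h.1

/-- The search in the reversed digraph, with the roots in the order `fin` in which the first search
finished its vertices, last one first, labels the strongly connected components. -/
theorem strong_of_lab {a : Config} {fin : List ℕ} (hfin : FinOK E fin) (hnd : fin.Nodup)
    (h : Inv n (fun u v => E v u) fin a) (hadj : ∀ v, a.lab v ≠ 0 → a.adj v = []) {r x : ℕ}
    {pre post : List ℕ} (hmem : ∀ x, a.lab x ≠ 0 → x ∈ fin) (hr : a.lab r ≠ 0)
    (he : fin = pre ++ r :: post) (hpre : ∀ x ∈ pre, a.lab x ≠ 0 ∧ a.lab x < a.lab r)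
    (hreach : ∀ x, a.lab x = a.lab r → ReflTransGen E x r) (hx : a.lab x = a.lab r) :
    ReflTransGen E r x := by
  -- The labels come from a search along reversed arcs, so they do not decrease along walks of `E`.
  have hmono : ∀ y z, ReflTransGen E y z → a.lab z ≠ 0 → a.lab y ≤ a.lab z ∧ a.lab y ≠ 0 := by
    intro y z hyz hz
    induction hyz using ReflTransGen.head_induction_on with
    | refl => exact ⟨le_rfl, hz⟩
    | @head y b hyb _ ih =>
      rcases h.scanned b y hyb with hm | hm
      · simp [hadj b ih.2] at hm
      · exact ⟨hm.2.trans ih.1, hm.1⟩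
  suffices H : ∀ l₁ l₂ x, post = l₁ ++ x :: l₂ → a.lab x = a.lab r → ReflTransGen E r x by
    have hx' := hmem x (by omega)
    rw [he] at hx'
    rcases List.mem_append.1 hx' with hx' | hx'
    · exact absurd hx (hpre x hx').2.ne
    · rcases List.mem_cons.1 hx' with rfl | hx'
      · exact .refl
      · obtain ⟨l₁, l₂, hl⟩ := List.append_of_mem hx'
        exact H l₁ l₂ x hl hx
  intro l₁
  -- The induction is on the number of vertices between `r` and `x` in the finishing order.
  induction hlen : l₁.length using Nat.strong_induction_on generalizing l₁ with
  | _ N ih =>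
    intro l₂ x hl hx
    subst hlen
    have hsplit : fin = (pre ++ r :: l₁) ++ x :: l₂ := by simp [he, hl]
    have hF : FinOK E (x :: l₂) := by rw [hsplit] at hfin; exact hfin.of_append
    have hrx : r ∉ x :: l₂ := by
      rw [hsplit, List.nodup_append] at hnd
      exact fun hm => hnd.2.2 r (by simp) r hm rfl
    -- The walk from `x` to `r` leaves the vertices finished no later than `x` at some `b` that
    -- reaches `x`. The label of `b` is squeezed between those of `x` and `r`, so `b` is `r` or lies
    -- strictly between `r` and `x`, where induction applies.
    obtain ⟨b, hb, hbx, hxb, hbr⟩ := hF.exit (List.mem_cons_self) (hreach x hx) hrx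
    have hb0 := hmono b r hbr hr
    have hlabb : a.lab b = a.lab r := le_antisymm hb0.1 (hx ▸ (hmono x b hxb hb0.2).1)
    have hbf := hmem b hb0.2
    rw [hsplit] at hbf
    rcases List.mem_append.1 hbf with hbf | hbf
    · rcases List.mem_append.1 hbf with hbf | hbf
      · exact absurd hlabb (hpre b hbf).2.ne
      · rcases List.mem_cons.1 hbf with rfl | hbf
        · exact hbx
        · obtain ⟨l₃, l₄, h34⟩ := List.append_of_mem hbf
          refine (ih l₃.length ?_ l₃ rfl (l₄ ++ x :: l₂) b ?_ hlabb).trans hbx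
          · simp [h34]
          · simp [hl, h34]
    · exact absurd hbf hb

end DFS

/-! ### Depth-first search on the machine. -/

namespace DFS

open RAM Relation

/-- `p` is the head of a linked list with entries `l` (`0` is the null pointer, `e + 1` points to
cell `e`). -/
def Chain (nxt val : ℕ → ℕ) : ℕ → List ℕ → Prop
  | p, [] => p = 0
  | p, u :: l => ∃ e, p = e + 1 ∧ val e = u ∧ Chain nxt val (nxt e) l

/-- The list `l` is stored in `f`, its last entry first. -/
def Stored (f : ℕ → ℕ) : List ℕ → Prop
  | [] => True
  | v :: l => f l.length = v ∧ Stored f l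

theorem Stored.update {f : ℕ → ℕ} {l : List ℕ} (h : Stored f l) {i x : ℕ} (hi : l.length ≤ i) :
    Stored (Function.update f i x) l := by
  induction l with
  | nil => trivial
  | cons v l ih =>
    simp only [List.length_cons] at hi
    exact ⟨by rw [Function.update_of_ne (by omega)]; exact h.1, ih h.2 (by omega)⟩

theorem Stored.cons {f : ℕ → ℕ} {l : List ℕ} (h : Stored f l) (x : ℕ) :
    Stored (Function.update f l.length x) (x :: l) :=
  ⟨by simp, h.update le_rfl⟩

theorem Stored.getElem {f : ℕ → ℕ} {l : List ℕ} (h : Stored f l) {i : ℕ} (hi : i < l.length) :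
    l[i] = f (l.length - 1 - i) := by
  induction l generalizing i with
  | nil => simp at hi
  | cons v l ih =>
    cases i with
    | zero => simpa using h.1.symm
    | succ i =>
      simp only [List.length_cons, Nat.add_lt_add_iff_right] at hi
      simp only [List.getElem_cons_succ, List.length_cons, ih h.2 hi]
      congr 1
      omega

/-- Depth-first search. The arrays `10`, `11`, `12` contain the adjacency lists, array `13` the
roots; array `14` receives the labels, array `15` the finished vertices; array `16` is the stack. -/
def search : Prog :=
  .instr (.const 20 0) ;; .instr (.const 21 0) ;; .instr (.const 22 0) ;; .instr (.const 23 0) ;;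
  .while (.lt 23 0)
    (.ite (.eq 21 3)
      (.instr (.load 24 13 20) ;; .instr (.add 20 20 2) ;; .instr (.load 25 14 24) ;;
        .ite (.eq 25 3)
          (.instr (.add 22 22 2) ;; .instr (.store 14 24 22) ;; .instr (.store 16 21 24) ;;
            .instr (.add 21 21 2))
          .skip)
      (.instr (.sub 26 21 2) ;; .instr (.load 24 16 26) ;; .instr (.load 25 10 24) ;;
        .ite (.eq 25 3)
          (.instr (.copy 21 26) ;; .instr (.store 15 23 24) ;; .instr (.add 23 23 2))
          (.instr (.sub 25 25 2) ;; .instr (.load 27 11 25) ;; .instr (.store 10 24 27) ;;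
            .instr (.load 24 12 25) ;; .instr (.load 25 14 24) ;;
            .ite (.eq 25 3)
              (.instr (.store 14 24 22) ;; .instr (.store 16 21 24) ;; .instr (.add 21 21 2))
              .skip)))

/-- The memory represents the configuration. -/
structure Rep (ord : List ℕ) (s : State) (a : Config) : Prop where
  ord : ∀ i (h : i < ord.length), s.arr 13 i = ord[i]
  done : s.reg 20 = a.done.length
  sp : s.reg 21 = a.stk.length
  k : s.reg 22 = a.k
  nf : s.reg 23 = a.fin.length
  stk : Stored (s.arr 16) a.stk
  fin : Stored (s.arr 15) a.fin
  lab : s.arr 14 = a.lab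
  adj : ∀ v, Chain (s.arr 11) (s.arr 12) (s.arr 10 v) (a.adj v)

theorem chain_update {nxt val ptr : ℕ → ℕ} {adj : ℕ → List ℕ}
    (h : ∀ v, Chain nxt val (ptr v) (adj v)) {v p : ℕ} {us : List ℕ} (hv : Chain nxt val p us)
    (x : ℕ) : Chain nxt val (Function.update ptr v p x) (Function.update adj v us x) := by
  by_cases hx : x = v
  · subst hx; simpa using hv
  · simpa [Function.update_of_ne hx] using h x

/-- Each round of the loop simulates exactly one `Step`, so the time is a multiple of the initial
potential. The loop stops when `n` vertices are finished; until then `todo_ne_nil` provides a root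
whenever the stack is empty. -/
theorem wp_search {n : ℕ} {E : ℕ → ℕ → Prop} {ord : List ℕ} {adj : ℕ → List ℕ} {s : State}
    (hE : ∀ v u, E v u → u < n) (hord : ∀ x, x ∈ ord ↔ x < n)
    (hadj : ∀ v u, u ∈ adj v ↔ E v u)
    (h0 : s.reg 0 = n) (h2 : s.reg 2 = 1) (h3 : s.reg 3 = 0)
    (ho : ∀ i (h : i < ord.length), s.arr 13 i = ord[i]) (hl : ∀ v, s.arr 14 v = 0)
    (hc : ∀ v, Chain (s.arr 11) (s.arr 12) (s.arr 10 v) (adj v)) :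
    wp search s fun s' t =>
      t ≤ 20 * (ord.length + (∑ v ∈ Finset.range n, (adj v).length) + n) + 5 ∧
      ∃ a, Inv n E ord a ∧ Rep ord s' a ∧ n ≤ a.fin.length := by
  unfold search
  simp only [wp_seq, wp_instr, Instr.apply]
  refine (wp_while (M := 20 * (ord.length + (∑ v ∈ Finset.range n, (adj v).length) + n))
    (fun m s' => ∃ a, Inv n E ord a ∧ Rep ord s' a ∧ m = 20 * a.potential n) ?_ ?_).mono ?_
  · rintro _ s' hF ⟨a, hI, hR, rfl⟩ hlt
    have h0 : s'.reg 0 = n := by rw [hF.reg 0 rfl]; simpa using h0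
    have h2 : s'.reg 2 = 1 := by rw [hF.reg 2 rfl]; simpa using h2
    have h3 : s'.reg 3 = 0 := by rw [hF.reg 3 rfl]; simpa using h3
    -- With the loop test a round takes at most `20` steps, which the drop of the potential by one
    -- pays for.
    have hstep : ∀ (b : Config) (s'' : State) (t : ℕ), t ≤ 19 → Step a b → Rep ord s'' b →
        ∃ m', t + 1 + m' ≤ 20 * a.potential n ∧
          ∃ a, Inv n E ord a ∧ Rep ord s'' a ∧ m' = 20 * a.potential n := by
      intro b s'' t ht hs hb
      refine ⟨_, ?_, b, hI.step hE (fun x => (hord x).1) hs, hb, rfl⟩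
      have := hI.potential_step hs
      omega
    obtain ⟨stk, fin, lab, k, ad, dn, td⟩ := a
    obtain ⟨r13, r20, r21, r22, r23, r16, r15, r14, rad⟩ := hR
    simp only at r20 r21 r22 r23 r16 r15 r14 rad
    simp only [Test.Holds, h0, r23] at hlt
    simp only [wp_seq, wp_instr, wp_ite, wp_skip, Instr.apply, Test.Holds, State.reg_setReg,
      State.arr_setReg, State.reg_setArr, State.arr_setArr, h2, h3, r20, r21, r22, r23, r14,
      Nat.reduceEqDiff, if_true, if_false]
    constructor
    · intro hst
      have hst := List.length_eq_zero_iff.1 hst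
      subst hst
      obtain ⟨r, td, rfl⟩ :=
        List.exists_cons_of_ne_nil (hI.todo_ne_nil (fun x => (hord x).2) hlt rfl)
      have hlen : dn.length < ord.length := by rw [hI.ord_eq]; simp
      have hr : s'.arr 13 dn.length = r := by
        rw [r13 _ hlen]
        simp [hI.ord_eq]
      rw [hr]
      constructor
      · intro hlr
        refine hstep _ _ _ ?_ (.root hlr) ?_
        · norm_num
        · constructor <;> simp_all [Stored]
      · intro hlr
        refine hstep _ _ _ ?_ (.old hlr) ?_
        · norm_num
        · constructor <;> simp_all [Stored]
    · intro hst
      obtain ⟨v, st, rfl⟩ := List.exists_cons_of_ne_nil (fun e : stk = [] => hst (by simp [e]))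
      have hv : s'.arr 16 ((v :: st).length - 1) = v := by simpa using r16.1
      rw [hv]
      have hch := rad v
      constructor
      · intro hp
        have had : ad v = [] := by
          cases hadv : ad v with
          | nil => rfl
          | cons u us =>
            rw [hadv] at hch
            obtain ⟨e, he, -⟩ := hch
            omega
        refine hstep _ _ _ ?_ (.pop had) ?_
        · norm_num
        · have := r15.cons v
          constructor <;> simp_all [Stored]
      · intro hp
        obtain ⟨u, us, had⟩ : ∃ u us, ad v = u :: us := by
          cases hadv : ad v with
          | nil => rw [hadv] at hch; exact absurd hch hp
          | cons u us => exact ⟨u, us, rfl⟩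
        rw [had] at hch
        obtain ⟨e, he, hu, hch⟩ := hch
        have he' : s'.arr 10 v - 1 = e := by omega
        rw [he', hu]
        constructor
        · intro hlu
          refine hstep _ _ _ ?_ (.push had hlu) ?_
          · norm_num
          · have := chain_update (v := v) rad hch
            have hst := r16.cons u
            constructor <;> simp_all [Stored]
        · intro hlu
          refine hstep _ _ _ ?_ (.skip had hlu) ?_
          · norm_num
          · have := chain_update (v := v) rad hch
            constructor <;> simp_all [Stored]
  · refine ⟨_, Inv.init hadj, ?_, ?_⟩
    · constructor <;> simp_all [Stored]
      exact funext hl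
    · simp [Config.potential]
  · rintro s' t hF ⟨m, ht, ⟨a, hI, hR, -⟩, hlt⟩
    have h0 : s'.reg 0 = n := by rw [hF.reg 0 rfl]; simpa using h0
    refine ⟨by omega, a, hI, hR, ?_⟩
    simp only [Test.Holds, hR.nf, h0] at hlt
    omega

end DFS

/-! ### Kosaraju's algorithm on the machine. -/

namespace DFS

open RAM Relation

/-- The terminal vertices of those arcs `e < k` that leave `v` and satisfy `ok`. -/
def adjList (src dst : ℕ → ℕ) (ok : ℕ → Prop) [DecidablePred ok] : ℕ → ℕ → List ℕ
  | 0, _ => []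
  | k + 1, v =>
    if src k = v ∧ ok k then dst k :: adjList src dst ok k v else adjList src dst ok k v

section

variable {src dst : ℕ → ℕ} {ok : ℕ → Prop} [DecidablePred ok]

theorem mem_adjList {k v u : ℕ} :
    u ∈ adjList src dst ok k v ↔ ∃ e < k, ok e ∧ src e = v ∧ dst e = u := by
  induction k with
  | zero => simp [adjList]
  | succ k ih =>
    simp only [adjList, Nat.lt_succ_iff_lt_or_eq, or_and_right, exists_or, exists_eq_left, ← ih]
    split_ifs with h
    · simp only [List.mem_cons, h, true_and, eq_comm (a := u)]
      exact or_comm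
    · constructor
      · exact .inl
      · rintro (h' | h')
        · exact h'
        · exact absurd ⟨h'.2.1, h'.1⟩ h

theorem sum_length_adjList (n k : ℕ) :
    ∑ v ∈ Finset.range n, (adjList src dst ok k v).length ≤ k := by
  induction k with
  | zero => simp [adjList]
  | succ k ih =>
    have : ∀ v, (adjList src dst ok (k + 1) v).length ≤
        (if src k = v then 1 else 0) + (adjList src dst ok k v).length := by
      intro v
      simp only [adjList]
      split_ifs with h1 h2 h2 <;> simp_all [add_comm]
    calc _ ≤ ∑ v ∈ Finset.range n,
          ((if src k = v then 1 else 0) + (adjList src dst ok k v).length) :=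
          Finset.sum_le_sum fun v _ => this v
      _ ≤ 1 + k := by
          rw [Finset.sum_add_distrib, Finset.sum_ite_eq]
          split_ifs <;> omega
      _ = k + 1 := add_comm _ _

end

/-- A pointer `e + 1` stands for cell `e`, so `nxt e ≤ e` says that links lead to strictly smaller
cells. A chain with head `p ≤ k` thus lives in cells below `k` and is not affected by writing to
cell `k`. -/
theorem Chain.update {nxt val : ℕ → ℕ} {k p : ℕ} {l : List ℕ} (h : Chain nxt val p l) (hp : p ≤ k)
    (hn : ∀ e, nxt e ≤ e) (x y : ℕ) :
    Chain (Function.update nxt k x) (Function.update val k y) p l := by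
  induction l generalizing p with
  | nil => exact h
  | cons u l ih =>
    obtain ⟨e, rfl, hu, h⟩ := h
    have hek : e ≠ k := by omega
    refine ⟨e, rfl, by rwa [Function.update_of_ne hek], ?_⟩
    rw [Function.update_of_ne hek]
    exact ih h ((hn e).trans (by omega))

/-- Builds the adjacency lists of the arcs of the obligatory subgraph, each of them directed from
the vertex in array `a` to the vertex in array `b`. -/
def build (a b : ℕ) : Prog :=
  forUp 10 1
    (.instr (.load 11 0 10) ;; .instr (.load 12 2 10) ;; .instr (.load 13 3 11) ;;
      .ite (.lt 13 12) .skip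
        (.instr (.load 11 a 10) ;; .instr (.load 14 10 11) ;; .instr (.store 11 10 14) ;;
          .instr (.add 15 10 2) ;; .instr (.store 10 11 15) ;; .instr (.load 16 b 10) ;;
          .instr (.store 12 10 16)))

/-- The link array is only required to point downwards, not to be zero: the second call finds the
cells left behind by the first one. -/
theorem wp_build {a b m : ℕ} {s : State} {ok : ℕ → Prop} [DecidablePred ok]
    (ha : a < 4) (hb : b < 4) (h1 : s.reg 1 = m)
    (h2 : s.reg 2 = 1) (hptr : ∀ v, s.arr 10 v = 0) (hnxt : ∀ e, s.arr 11 e ≤ e)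
    (hok : ∀ e, ok e ↔ s.arr 2 e ≤ s.arr 3 (s.arr 0 e)) :
    wp (build a b) s fun s' t => t ≤ m * 14 + 2 ∧
      (∀ v, Chain (s'.arr 11) (s'.arr 12) (s'.arr 10 v) (adjList (s.arr a) (s.arr b) ok m v)) ∧
      ∀ e, s'.arr 11 e ≤ e := by
  unfold build
  refine (wp_forUp (K := 12) (fun k s' =>
    (∀ v, Chain (s'.arr 11) (s'.arr 12) (s'.arr 10 v) (adjList (s.arr a) (s.arr b) ok k v)) ∧
    (∀ v, s'.arr 10 v ≤ k) ∧ ∀ e, s'.arr 11 e ≤ e) rfl h2 h1 ?_ ?_).mono ?_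
  · simp [hptr, adjList, Chain, hnxt]
  · rintro k hk s' hF ⟨hC, hle, hn⟩ hi
    have e0 : s'.arr 0 = s.arr 0 := hF.arr 0 rfl
    have e2 : s'.arr 2 = s.arr 2 := hF.arr 2 rfl
    have e3 : s'.arr 3 = s.arr 3 := hF.arr 3 rfl
    have e1 : s'.reg 2 = 1 := (hF.reg 2 rfl).trans h2
    have ea : s'.arr a = s.arr a := hF.arr a (by
      simp [forUp, Prog.keepsArr, Instr.keepsArr]; omega)
    have eb : s'.arr b = s.arr b := hF.arr b (by
      simp [forUp, Prog.keepsArr, Instr.keepsArr]; omega)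
    have hb' : b ≠ 10 ∧ b ≠ 11 ∧ b ≠ 12 := by omega
    simp only [wp_seq, wp_instr, wp_ite, wp_skip, Instr.apply, Test.Holds, State.reg_setReg,
      State.arr_setReg, State.reg_setArr, State.arr_setArr, e0, e2, e3, ea, eb, hi, e1,
      hb', Nat.reduceEqDiff, if_true, if_false, not_lt, ← hok]
    constructor
    · intro hlt
      have hnok : ¬ ok k := by rw [hok]; omega
      exact ⟨by norm_num, fun v => by simpa [adjList, hnok] using hC v,
        fun v => (hle v).trans (Nat.le_succ k), hn⟩
    · intro hk'
      refine ⟨by norm_num, fun v => ?_, fun v => ?_, fun e => ?_⟩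
      · by_cases hv : s.arr a k = v
        · subst hv
          simp only [adjList, hk', and_self, if_true, Function.update_self]
          exact ⟨k, rfl, by simp, by simpa using (hC _).update (hle _) hn _ _⟩
        · simp only [adjList, hv, false_and, if_false, Function.update_of_ne (Ne.symm hv)]
          exact (hC v).update (hle v) hn _ _
      · by_cases hv : v = s.arr a k
        · simp [hv]
        · rw [Function.update_of_ne hv]
          exact (hle v).trans (Nat.le_succ k)
      · by_cases he : e = k
        · simpa [he] using hle _
        · rw [Function.update_of_ne he]
          exact hn e
  · exact fun s' t _ h => ⟨h.1, h.2.1, h.2.2.2⟩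

/-- The order of the roots in the first search. -/
def initRoots : Prog := forUp 10 0 (.instr (.store 13 10 10))

theorem wp_initRoots {n : ℕ} {s : State} (h0 : s.reg 0 = n) (h2 : s.reg 2 = 1) :
    wp initRoots s fun s' t => t ≤ n * 3 + 2 ∧ ∀ i < n, s'.arr 13 i = i := by
  refine (wp_forUp (K := 1) (fun k s' => ∀ i < k, s'.arr 13 i = i) rfl h2 h0 (by simp) ?_)
  rintro k hk s' - hI hi
  simp only [wp_instr, Instr.apply, State.arr_setReg, State.arr_setArr, if_true, hi]
  refine ⟨le_rfl, fun i hik => ?_⟩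
  by_cases hik' : i = k
  · simp [hik']
  · rw [Function.update_of_ne hik']
    exact hI i (by omega)

/-- The order of the roots in the second search. The labels are cleared. -/
def nextRoots : Prog :=
  forUp 10 0 (.instr (.sub 11 0 10) ;; .instr (.sub 11 11 2) ;; .instr (.load 11 15 11) ;;
    .instr (.store 13 10 11) ;; .instr (.store 14 10 3))

theorem wp_nextRoots {n : ℕ} {s : State} (h0 : s.reg 0 = n) (h2 : s.reg 2 = 1)
    (h3 : s.reg 3 = 0) :
    wp nextRoots s fun s' t => t ≤ n * 7 + 2 ∧ (∀ i < n, s'.arr 13 i = s.arr 15 (n - i - 1)) ∧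
      ∀ i, s'.arr 14 i = if i < n then 0 else s.arr 14 i := by
  refine (wp_forUp (K := 5) (fun k s' => (∀ i < k, s'.arr 13 i = s.arr 15 (n - i - 1)) ∧
      ∀ i, s'.arr 14 i = if i < k then 0 else s.arr 14 i) rfl h2 h0 (by simp) ?_)
  rintro k hk s' hF ⟨hI, hJ⟩ hi
  have e0 : s'.reg 0 = n := (hF.reg 0 rfl).trans h0
  have e2 : s'.reg 2 = 1 := (hF.reg 2 rfl).trans h2
  have e3 : s'.reg 3 = 0 := (hF.reg 3 rfl).trans h3
  have ea : s'.arr 15 = s.arr 15 := hF.arr 15 rfl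
  simp only [wp_seq, wp_instr, Instr.apply, State.reg_setReg,
      State.arr_setReg, State.reg_setArr, State.arr_setArr, e0, e2, e3, ea, hi,
      Nat.reduceEqDiff, if_true, if_false]
  refine ⟨by norm_num, fun i hik => ?_, fun i => ?_⟩
  · by_cases hik' : i = k
    · simp [hik']
    · rw [Function.update_of_ne hik']
      exact hI i (by omega)
  · by_cases hik' : i = k
    · simp [hik']
    · rw [Function.update_of_ne hik', hJ i]
      have : i < k ↔ i < k + 1 := by omega
      simp only [this]

/-- The components are numbered from `0`. -/
def shiftLabels : Prog :=
  forUp 10 0 (.instr (.load 11 14 10) ;; .instr (.sub 11 11 2) ;; .instr (.store 17 10 11)) ;;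
    .instr (.copy 4 22)

theorem wp_shiftLabels {n : ℕ} {s : State} (h0 : s.reg 0 = n) (h2 : s.reg 2 = 1) :
    wp shiftLabels s fun s' t => t ≤ n * 5 + 3 ∧ (∀ i < n, s'.arr 17 i = s.arr 14 i - 1) ∧
      s'.reg 4 = s.reg 22 := by
  refine (wp_forUp (K := 3) (fun k s' => ∀ i < k, s'.arr 17 i = s.arr 14 i - 1) rfl h2 h0
    (by simp) ?_).seq ?_
  · rintro k hk s' hF hI hi
    have e2 : s'.reg 2 = 1 := (hF.reg 2 rfl).trans h2
    have ea : s'.arr 14 = s.arr 14 := hF.arr 14 rfl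
    simp only [wp_seq, wp_instr, Instr.apply, State.reg_setReg,
      State.arr_setReg, State.arr_setArr, e2, ea, hi,
      Nat.reduceEqDiff, if_true, if_false]
    refine ⟨by norm_num, fun i hik => ?_⟩
    by_cases hik' : i = k
    · simp [hik']
    · rw [Function.update_of_ne hik']
      exact hI i (by omega)
  · rintro s' t hF ⟨ht, hI⟩
    have e : s'.reg 22 = s.reg 22 := hF.reg 22 rfl
    simp only [wp_instr, Instr.apply, State.arr_setReg, State.reg_setReg, if_true, e]
    exact ⟨by omega, hI, trivial⟩

/-- Kosaraju's algorithm: array `17` receives the numbers of the strongly connected components of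
the obligatory subgraph, register `4` the number of components. -/
def components : Prog :=
  build 0 1 ;; initRoots ;; search ;; nextRoots ;; build 1 0 ;; search ;; shiftLabels

/-- `comp` numbers the strongly connected components of the digraph `E` on `{0, …, n - 1}`. -/
structure IsComp (n : ℕ) (E : ℕ → ℕ → Prop) (c : ℕ) (comp : ℕ → ℕ) : Prop where
  lt : ∀ v < n, comp v < c
  surj : ∀ j < c, ∃ v < n, comp v = j
  reach : ∀ u < n, ∀ v < n, comp u = comp v → ReflTransGen E u v
  mono : ∀ v u, E v u → comp v ≤ comp u

/-- Vertices with equal numbers are mutually reachable by `strong_of_lab`. That different numbers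
mean different components is recorded as monotonicity of the numbers along arcs, which is what the
second search yields directly. -/
theorem wp_components {n m : ℕ} {s : State} (h0 : s.reg 0 = n) (h1 : s.reg 1 = m)
    (h2 : s.reg 2 = 1) (h3 : s.reg 3 = 0)
    (hsrc : ∀ e < m, s.arr 0 e < n) (hdst : ∀ e < m, s.arr 1 e < n)
    (hz : ∀ a, 10 ≤ a → ∀ i, s.arr a i = 0) :
    wp components s fun s' t => t ≤ 1000 * (n + m) + 1000 ∧
      IsComp n (fun v u => ∃ e < m, s.arr 2 e ≤ s.arr 3 (s.arr 0 e) ∧ s.arr 0 e = v ∧ s.arr 1 e = u)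
        (s'.reg 4) (s'.arr 17) := by
  set E : ℕ → ℕ → Prop :=
    fun v u => ∃ e < m, s.arr 2 e ≤ s.arr 3 (s.arr 0 e) ∧ s.arr 0 e = v ∧ s.arr 1 e = u with hEdef
  have hE1 : ∀ v u, E v u → u < n := by rintro v u ⟨e, he, -, -, rfl⟩; exact hdst e he
  have hE0 : ∀ v u, E v u → v < n := by rintro v u ⟨e, he, -, rfl, -⟩; exact hsrc e he
  have hadj1 : ∀ v u, u ∈ adjList (s.arr 0) (s.arr 1)
      (fun e => s.arr 2 e ≤ s.arr 3 (s.arr 0 e)) m v ↔ E v u := fun v u => mem_adjList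
  have hadj2 : ∀ v u, u ∈ adjList (s.arr 1) (s.arr 0)
      (fun e => s.arr 2 e ≤ s.arr 3 (s.arr 0 e)) m v ↔ E u v := fun v u => mem_adjList.trans
    ⟨fun ⟨e, h1, h2, h3, h4⟩ => ⟨e, h1, h2, h4, h3⟩, fun ⟨e, h1, h2, h3, h4⟩ => ⟨e, h1, h2, h4, h3⟩⟩
  have hs1 := sum_length_adjList (src := s.arr 0) (dst := s.arr 1)
    (ok := fun e => s.arr 2 e ≤ s.arr 3 (s.arr 0 e)) n m
  have hs2 := sum_length_adjList (src := s.arr 1) (dst := s.arr 0)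
    (ok := fun e => s.arr 2 e ≤ s.arr 3 (s.arr 0 e)) n m
  unfold components
  refine (wp_build (ok := fun e => s.arr 2 e ≤ s.arr 3 (s.arr 0 e)) (by norm_num) (by norm_num) h1
    h2 (hz 10 (by norm_num)) (fun e => by simp [hz 11]) fun e => Iff.rfl).seq ?_
  rintro s₁ t₁ F₁ ⟨ht₁, hC₁, hn₁⟩
  refine (wp_initRoots ((F₁.reg 0 rfl).trans h0) ((F₁.reg 2 rfl).trans h2)).seq ?_
  rintro s₂ t₂ F₂ ⟨ht₂, ho₂⟩
  have e11 : s₂.arr 11 = s₁.arr 11 := F₂.arr 11 rfl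
  have e12 : s₂.arr 12 = s₁.arr 12 := F₂.arr 12 rfl
  have e10 : s₂.arr 10 = s₁.arr 10 := F₂.arr 10 rfl
  have F₂' : ∀ r, (build 0 1).keepsReg r = true → initRoots.keepsReg r = true →
    s₂.reg r = s.reg r := fun r h h' => (F₂.reg r h').trans (F₁.reg r h)
  have F₂'' : ∀ r, (build 0 1).keepsArr r = true → initRoots.keepsArr r = true →
    s₂.arr r = s.arr r := fun r h h' => (F₂.arr r h').trans (F₁.arr r h)
  refine (wp_search (ord := List.range n) hE1 (by simp) hadj1 ((F₂' 0 rfl rfl).trans h0)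
    ((F₂' 2 rfl rfl).trans h2) ((F₂' 3 rfl rfl).trans h3) (by simpa using ho₂)
    (fun v => by rw [F₂'' 14 rfl rfl]; exact hz 14 (by norm_num) v)
    (by rw [e10, e11, e12]; exact hC₁)).seq ?_
  rintro s₃ t₃ F₃ ⟨ht₃, a, hI, hR, hf⟩
  obtain ⟨hstk, hlen, hnd, hmem⟩ := hI.fin_eq hf
  have F₃' : ∀ r, (build 0 1 ;; initRoots ;; search).keepsReg r = true → s₃.reg r = s.reg r := by
    intro r hr
    simp only [Prog.keepsReg, Bool.and_eq_true] at hr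
    rw [F₃.reg r hr.2.2, F₂' r hr.1 hr.2.1]
  refine (wp_nextRoots ((F₃' 0 rfl).trans h0) ((F₃' 2 rfl).trans h2) ((F₃' 3 rfl).trans h3)).seq ?_
  rintro s₄ t₄ F₄ ⟨ht₄, ho₄, hl₄⟩
  have F₄' : ∀ r, (build 0 1 ;; initRoots ;; search ;; nextRoots).keepsReg r = true →
      s₄.reg r = s.reg r := by
    intro r hr
    simp only [Prog.keepsReg, Bool.and_eq_true] at hr
    rw [F₄.reg r hr.2.2.2, F₃.reg r hr.2.2.1, F₂' r hr.1 hr.2.1]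
  have A₄' : ∀ r, (build 0 1 ;; initRoots ;; search ;; nextRoots).keepsArr r = true →
      s₄.arr r = s.arr r := by
    intro r hr
    simp only [Prog.keepsArr, Bool.and_eq_true] at hr
    rw [F₄.arr r hr.2.2.2, F₃.arr r hr.2.2.1, F₂'' r hr.1 hr.2.1]
  -- The search consumes the adjacency lists, so all head pointers are null again and the same
  -- arrays can hold the reversed arcs.
  have hadja : ∀ v, a.adj v = [] := by
    intro v
    by_cases hv : v < n
    · exact hI.adj_fin v ((hmem v).2 hv)
    · exact List.eq_nil_iff_forall_not_mem.2 fun u hu => hv (hE0 v u (hI.adj_sub v u hu))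
  refine (wp_build (ok := fun e => s.arr 2 e ≤ s.arr 3 (s.arr 0 e)) (m := m) (a := 1) (b := 0)
    (by norm_num) (by norm_num)
    ((F₄' 1 rfl).trans h1) ((F₄' 2 rfl).trans h2) ?_ ?_ ?_).seq ?_
  · intro v
    have := hR.adj v
    rw [hadja v] at this
    rw [F₄.arr 10 rfl]
    exact this
  · rw [F₄.arr 11 rfl, F₃.arr 11 rfl, e11]
    exact hn₁
  · rw [A₄' 0 rfl, A₄' 2 rfl, A₄' 3 rfl]
    exact fun e => Iff.rfl
  rintro s₅ t₅ F₅ ⟨ht₅, hC₅, -⟩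
  rw [A₄' 0 rfl, A₄' 1 rfl] at hC₅
  have F₅' : ∀ r, (build 0 1 ;; initRoots ;; search ;; nextRoots).keepsReg r = true →
      (build 1 0).keepsReg r = true → s₅.reg r = s.reg r := fun r h h' =>
    (F₅.reg r h').trans (F₄' r h)
  refine (wp_search (n := n) (ord := a.fin) (E := fun u v => E v u) (fun v u h => hE0 u v h) hmem
    hadj2 ((F₅' 0 rfl rfl).trans h0) ((F₅' 2 rfl rfl).trans h2) ((F₅' 3 rfl rfl).trans h3)
    ?_ ?_ hC₅).seq ?_
  · intro i hi
    rw [F₅.arr 13 rfl, ho₄ i (by omega), hR.fin.getElem hi, hlen, Nat.sub_right_comm]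
  · intro v
    rw [F₅.arr 14 rfl, hl₄ v]
    split_ifs with hv
    · rfl
    · rw [hR.lab]
      by_contra h
      exact hv (hI.lt v h)
  rintro s₆ t₆ F₆ ⟨ht₆, b, hJ, hS, hg⟩
  refine (wp_shiftLabels (n := n) ?_ ?_).mono ?_
  · rw [F₆.reg 0 rfl, F₅' 0 rfl rfl, h0]
  · rw [F₆.reg 2 rfl, F₅' 2 rfl rfl, h2]
  rintro s₇ t₇ F₇ ⟨ht₇, hcomp, hc⟩
  obtain ⟨-, -, -, hmemb⟩ := hJ.fin_eq hg
  have hlab : ∀ v, b.lab v ≠ 0 ↔ v < n := by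
    intro v
    refine ⟨hJ.lt v, fun hv => (hJ.lab_iff v).2 (.inr ((hmemb v).2 hv))⟩
  have hadjb : ∀ v, b.lab v ≠ 0 → b.adj v = [] := fun v hv =>
    hJ.adj_fin v ((hmemb v).2 ((hlab v).1 hv))
  rw [hS.lab] at hcomp
  rw [hS.k] at hc
  rw [hc]
  refine ⟨?_, fun v hv => ?_, fun j hj => ?_, fun u hu v hv huv => ?_, fun v u hvu => ?_⟩
  · rw [List.length_range] at ht₃
    omega
  · rw [hcomp v hv]
    have := (hlab v).2 hv
    have := hJ.lab_le v
    omega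
  · obtain ⟨r, hr, -⟩ := hJ.roots (j + 1) (by omega) (by omega)
    have hrn : r < n := (hlab r).1 (by omega)
    exact ⟨r, hrn, by rw [hcomp r hrn]; omega⟩
  · rw [hcomp u hu, hcomp v hv] at huv
    have hu0 := (hlab u).2 hu
    have hv0 := (hlab v).2 hv
    have huv : b.lab u = b.lab v := by omega
    obtain ⟨r, hr, hreach, pre, post, he, hpre⟩ := hJ.roots (b.lab v) (by omega) (hJ.lab_le v)
    have hreach' : ∀ x, b.lab x = b.lab r → ReflTransGen E x r := fun x hx =>
      (reflTransGen_swap).1 (hreach x (hx.trans hr))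
    exact (hreach' u (huv.trans hr.symm)).trans
      (strong_of_lab hI.finOK hnd hJ hadjb (fun x hx => (hmem x).2 ((hlab x).1 hx))
        (by omega) he (by rw [hr]; exact hpre) hreach' hr.symm)
  · have hv := hE0 v u hvu
    have hu := hE1 v u hvu
    rw [hcomp u hu, hcomp v hv]
    rcases hJ.scanned u v hvu with h | h
    · simp [hadjb u ((hlab u).2 hu)] at h
    · omega

end DFS

/-! ### Powers and digits -/

namespace RAM

/-- Array `a` receives the powers of the number in register `b`, up to the exponent in
register `r`. -/
def powers (a b r : ℕ) : Prog :=
  .instr (.const 10 0) ;; .instr (.store a 10 2) ;; .instr (.copy 11 2) ;;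
  forUp 10 r
    (.instr (.copy 12 3) ;; forUp 13 b (.instr (.add 12 12 11)) ;; .instr (.copy 11 12) ;;
      .instr (.add 14 10 2) ;; .instr (.store a 14 11))

theorem wp_powers {a b r B R : ℕ} {s : State} (hb : b < 10) (hr : r < 10)
    (h2 : s.reg 2 = 1) (h3 : s.reg 3 = 0)
    (hB : s.reg b = B) (hR : s.reg r = R) :
    wp (powers a b r) s fun s' t => t ≤ R * (3 * B + 8) + 5 ∧ ∀ k ≤ R, s'.arr a k = B ^ k := by
  unfold powers
  simp only [wp_seq, wp_instr, Instr.apply]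
  have hkr : ∀ x, 10 ≤ x → r ≠ x ∧ x ≠ r := by omega
  have hkb : ∀ x, 10 ≤ x → b ≠ x ∧ x ≠ b := by omega
  refine (wp_forUp (N := R) (K := 3 * B + 6)
    (fun k s' => s'.reg 11 = B ^ k ∧ ∀ j ≤ k, s'.arr a j = B ^ j) ?_ ?_ ?_ ?_ ?_).mono ?_
  · simp [Prog.keepsReg, Instr.keepsReg, forUp]
    omega
  · simpa using h2
  · simpa [hkr] using hR
  · simp [h2]
  · rintro k hk s' hF ⟨hI, hJ⟩ hi
    have e2 : s'.reg 2 = 1 := by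
      rw [hF.reg 2 (by simp [forUp, Prog.keepsReg, Instr.keepsReg])]; simp [h2]
    have e3 : s'.reg 3 = 0 := by
      rw [hF.reg 3 (by simp [forUp, Prog.keepsReg, Instr.keepsReg])]; simp [h3]
    have eb : s'.reg b = B := by
      rw [hF.reg b (by simp [forUp, Prog.keepsReg, Instr.keepsReg]; omega)]
      simp [hkb, hB]
    rw [wp_seq, wp_instr]
    refine (wp_forUp (N := B) (K := 1) (fun j s'' => s''.reg 12 = j * B ^ k) ?_ ?_ ?_ ?_ ?_).seq ?_
    · simp [Prog.keepsReg, Instr.keepsReg]; omega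
    · simpa [Instr.apply] using e2
    · simpa [Instr.apply, hkb] using eb
    · simp [Instr.apply, e3]
    · rintro j hj s'' hF' hI' -
      have e11 : s''.reg 11 = B ^ k := by
        rw [hF'.reg 11 (by simp [forUp, Prog.keepsReg, Instr.keepsReg])]
        simp [Instr.apply, hI]
      simp only [wp_instr, Instr.apply, State.reg_setReg, Nat.reduceEqDiff, if_true, if_false,
        hI', e11]
      exact ⟨le_rfl, by ring⟩
    · rintro s'' t hF' ⟨ht, hI'⟩
      have e2' : s''.reg 2 = 1 := by
        rw [hF'.reg 2 (by simp [forUp, Prog.keepsReg, Instr.keepsReg])]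
        simp [Instr.apply, e2]
      have e10 : s''.reg 10 = k := by
        rw [hF'.reg 10 (by simp [forUp, Prog.keepsReg, Instr.keepsReg])]
        simp [Instr.apply, hi]
      have ea : s''.arr a = s'.arr a := by
        rw [hF'.arr a (by simp [forUp, Prog.keepsArr, Instr.keepsArr])]
        simp [Instr.apply]
      simp only [wp_seq, wp_instr, Instr.apply, State.reg_setReg, State.arr_setReg,
        State.reg_setArr, State.arr_setArr, Nat.reduceEqDiff, if_true, if_false, hI', e2', e10, ea]
      refine ⟨by omega, by ring, fun j hj => ?_⟩
      by_cases hjk : j = k + 1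
      · subst hjk
        rw [Function.update_self]
        ring
      · rw [Function.update_of_ne hjk]
        exact hJ j (by omega)
  · rintro s' t - ⟨ht, -, hJ⟩
    refine ⟨?_, hJ⟩
    have : R * (3 * B + 6 + 2) = R * (3 * B + 8) := by ring
    omega

/-- Array `22` receives the digits of the number in register `40`; array `a` contains the powers
of the base, register `r` the number of digits. -/
def digits (a r : ℕ) : Prog :=
  .instr (.copy 41 40) ;;
  forUp 42 r
    (.instr (.sub 43 r 42) ;; .instr (.sub 43 43 2) ;; .instr (.load 44 a 43) ;;
      .instr (.const 45 0) ;; .instr (.add 46 41 2) ;;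
      .while (.lt 44 46)
        (.instr (.sub 41 41 44) ;; .instr (.sub 46 46 44) ;; .instr (.add 45 45 2)) ;;
      .instr (.store 22 43 45))

/-- The digits are split off from the most significant one downwards. Lacking division, the program
finds each digit by counting subtractions of a power, and there are fewer than `B` of these. -/
theorem wp_digits {a r B R N : ℕ} {s : State} (hr : r < 10) (ha : a ≠ 22)
    (h2 : s.reg 2 = 1) (hR : s.reg r = R) (hN : s.reg 40 = N) (hlt : N < B ^ R)
    (hp : ∀ k < R, s.arr a k = B ^ k) :
    wp (digits a r) s fun s' t => t ≤ R * (4 * B + 9) + 3 ∧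
      ∀ k < R, s'.arr 22 k = N / B ^ k % B := by
  unfold digits
  have hkr : ∀ x, 10 ≤ x → r ≠ x ∧ x ≠ r := by omega
  rw [wp_seq, wp_instr]
  refine (wp_forUp (N := R) (K := 4 * B + 7)
    (fun i s' => s'.reg 41 = N % B ^ (R - i) ∧
      ∀ k, R - i ≤ k → k < R → s'.arr 22 k = N / B ^ k % B) ?_ ?_ ?_ ?_ ?_).mono ?_
  · simp [Prog.keepsReg, Instr.keepsReg, hkr]
  · simp [Instr.apply, h2]
  · simp [Instr.apply, hkr, hR]
  · simp [Instr.apply, hN, Nat.mod_eq_of_lt hlt]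
    intro k h h'
    omega
  · rintro i hi s' hF ⟨hI, hJ⟩ hreg
    have e2 : s'.reg 2 = 1 := by
      rw [hF.reg 2 (by simp [forUp, Prog.keepsReg, Instr.keepsReg])]; simp [h2, Instr.apply]
    have er : s'.reg r = R := by
      rw [hF.reg r (by simp [forUp, Prog.keepsReg, Instr.keepsReg, hkr])]
      simp [hkr, hR, Instr.apply]
    have ea : s'.arr a = s.arr a := by
      rw [hF.arr a (by simp [forUp, Prog.keepsArr, Instr.keepsArr, ha.symm])]
      simp [Instr.apply]
    obtain ⟨k, hk⟩ : ∃ k, R - i = k + 1 := ⟨R - i - 1, by omega⟩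
    have hk' : R - (i + 1) = k := by omega
    have hB : 0 < B := by
      rcases Nat.eq_zero_or_pos B with rfl | h
      · rw [zero_pow (by omega)] at hlt; omega
      · exact h
    have hBk : 0 < B ^ k := Nat.pow_pos hB
    have hq : N % B ^ (k + 1) / B ^ k = N / B ^ k % B := by
      rw [pow_succ, Nat.mod_mul_right_div_self]
    have hm : N % B ^ (k + 1) % B ^ k = N % B ^ k :=
      Nat.mod_mod_of_dvd _ (pow_dvd_pow _ (Nat.le_succ k))
    rw [hk] at hI
    simp only [wp_seq, wp_instr, Instr.apply, State.reg_setReg, State.arr_setReg, hreg, er, e2, ea,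
      Nat.reduceEqDiff, if_true, if_false, hk, Nat.add_sub_cancel, hp k (by omega), hI]
    -- Register `46` is kept one above the remainder, which turns the available strict test into `B
    -- ^ k ≤ remainder`.
    refine (wp_while (M := 4 * (N % B ^ (k + 1) / B ^ k)) (fun m s'' =>
      s''.reg 45 * B ^ k + s''.reg 41 = N % B ^ (k + 1) ∧ s''.reg 46 = s''.reg 41 + 1 ∧
        m = 4 * (s''.reg 41 / B ^ k)) ?_ ?_).mono ?_
    · rintro _ s'' hF' ⟨h45, h46, rfl⟩ hb
      have e2' : s''.reg 2 = 1 := by rw [hF'.reg 2 rfl]; simp [e2]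
      have e44 : s''.reg 44 = B ^ k := by rw [hF'.reg 44 rfl]; simp
      simp only [Test.Holds, e44, h46] at hb
      simp only [wp_seq, wp_instr, Instr.apply, State.reg_setReg, e2', e44, h46, Nat.reduceEqDiff,
        if_true, if_false]
      refine ⟨_, ?_, ?_, ?_, rfl⟩
      · rw [Nat.div_eq_sub_div hBk (by omega : B ^ k ≤ s''.reg 41)]
        omega
      · rw [add_mul]; omega
      · omega
    · simp [hI]
    · rintro s'' t hF' ⟨m, ht, ⟨h45, h46, -⟩, hb⟩
      have e44 : s''.reg 44 = B ^ k := by rw [hF'.reg 44 rfl]; simp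
      have e43 : s''.reg 43 = k := by rw [hF'.reg 43 rfl]; simp
      have ea22 : s''.arr 22 = s'.arr 22 := by rw [hF'.arr 22 rfl]; simp
      simp only [Test.Holds, e44, h46, not_lt] at hb
      obtain ⟨hd, hmod⟩ := (Nat.div_mod_unique (a := N % B ^ (k + 1)) (c := s''.reg 41)
        (d := s''.reg 45) hBk).2 ⟨by rw [← h45]; ring, by omega⟩
      rw [hq] at hd
      rw [hm] at hmod
      simp only [State.arr_setArr, State.reg_setArr, State.arr_setReg, State.reg_setReg,
        Nat.reduceEqDiff, if_true, if_false, hk', e43, ← hd, ← hmod, ea22]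
      refine ⟨?_, trivial, fun j hj hjR => ?_⟩
      · have : N % B ^ (k + 1) / B ^ k < B := by rw [hq]; exact Nat.mod_lt _ hB
        omega
      · by_cases hjk : j = k
        · simp [hjk]
        · rw [Function.update_of_ne hjk]
          exact hJ j (by omega) hjR
  · rintro s' t - ⟨ht, -, hJ⟩
    refine ⟨?_, fun k hk => hJ k (by omega) hk⟩
    have : R * (4 * B + 7 + 2) = R * (4 * B + 9) := by ring
    omega

end RAM

/-! ### The cost of connecting a vertex to a component. -/

namespace MinPAC

open RAM

/-- Computes the costs of connecting a vertex to a component. -/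
def costTable : Prog :=
  .instr (.const 5 1) ;;
  forUp 10 1 (.instr (.load 11 2 10) ;; .instr (.add 5 5 11)) ;;
  .instr (.copy 11 3) ;;
  forUp 10 0
    (.instr (.store 18 10 11) ;; .instr (.load 12 17 10) ;; .instr (.add 13 11 12) ;;
      forUp 14 4 (.instr (.store 19 11 5) ;; .instr (.add 11 11 2)) ;; .instr (.store 19 13 3)) ;;
  forUp 10 1
    (.instr (.load 11 0 10) ;; .instr (.load 12 1 10) ;; .instr (.load 13 18 11) ;;
      .instr (.load 14 17 12) ;; .instr (.add 13 13 14) ;; .instr (.load 15 2 10) ;;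
      .instr (.load 16 3 11) ;; .instr (.sub 15 15 16) ;; .instr (.load 17 19 13) ;;
      .ite (.lt 15 17) (.instr (.store 19 13 15)) .skip)

/-- `W v d` is the least increase over `l v` of the power of `v` that gives an arc from `v` to
component `d`, and at least `top` if there is no such arc. -/
structure IsCostTable (n m c top : ℕ) (src dst wt lb comp : ℕ → ℕ) (W : ℕ → ℕ → ℕ) : Prop where
  own : ∀ v < n, W v (comp v) = 0
  le : ∀ e < m, W (src e) (comp (dst e)) ≤ wt e - lb (src e)
  exists_arc : ∀ v < n, ∀ d < c, W v d < top →
    d = comp v ∨ ∃ e < m, src e = v ∧ comp (dst e) = d ∧ wt e ≤ lb v + W v d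

theorem index_inj {c v d v' d' : ℕ} (hd : d < c) (hd' : d' < c) (h : v * c + d = v' * c + d') :
    v = v' ∧ d = d' := by
  have hc : 0 < c := by omega
  have h1 : (v * c + d) / c = v := by
    rw [mul_comm, Nat.mul_add_div hc, Nat.div_eq_of_lt hd, add_zero]
  have h2 : (v' * c + d') / c = v' := by
    rw [mul_comm, Nat.mul_add_div hc, Nat.div_eq_of_lt hd', add_zero]
  have hv : v = v' := by rw [← h1, ← h2, h]
  subst hv
  exact ⟨rfl, by omega⟩

/-- The table is stored row by row. A running counter produces the row offsets `v * c`, which are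
kept in array `18` for later use, so no multiplication is needed. The last loop lowers one entry for
each arc when this improves it. -/
theorem wp_costTable {n m c : ℕ} {s : State} (h0 : s.reg 0 = n) (h1 : s.reg 1 = m)
    (h2 : s.reg 2 = 1) (h3 : s.reg 3 = 0) (h4 : s.reg 4 = c)
    (hsrc : ∀ e < m, s.arr 0 e < n) (hdst : ∀ e < m, s.arr 1 e < n)
    (hcomp : ∀ v < n, s.arr 17 v < c) :
    wp costTable s fun s' t => t ≤ 100 * (m + n * c + n) + 100 ∧
      s'.reg 5 = 1 + ∑ e ∈ Finset.range m, s.arr 2 e ∧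
      (∀ v < n, s'.arr 18 v = v * c) ∧
      IsCostTable n m c (s'.reg 5) (s.arr 0) (s.arr 1) (s.arr 2) (s.arr 3) (s.arr 17)
        fun v d => s'.arr 19 (v * c + d) := by
  unfold costTable
  rw [wp_seq, wp_instr]
  refine (wp_forUp (N := m) (K := 2) (fun k s' => s'.reg 5 = 1 + ∑ e ∈ Finset.range k, s.arr 2 e)
    rfl (by simp [Instr.apply, h2]) (by simp [Instr.apply, h1]) (by simp [Instr.apply]) ?_).seq ?_
  · rintro k - s₁ F₁ hI hi
    have : s₁.arr 2 = s.arr 2 := by rw [F₁.arr 2 rfl]; simp [Instr.apply]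
    simp only [wp_seq, wp_instr, Instr.apply, State.reg_setReg, Nat.reduceEqDiff, if_true, if_false,
      hI, hi, this, Finset.sum_range_succ]
    exact ⟨by norm_num, by ring⟩
  rintro s₁ t₁ F₁ ⟨ht₁, hI₁⟩
  have g : ∀ r, r < 5 → s₁.reg r = s.reg r := by
    intro r hr
    rw [F₁.reg r (by simp [forUp, Prog.keepsReg, Instr.keepsReg]; omega)]
    simp [Instr.apply]; omega
  have g' : ∀ a, s₁.arr a = s.arr a := by
    intro a
    rw [F₁.arr a (by simp [forUp, Prog.keepsArr, Instr.keepsArr])]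
    simp [Instr.apply]
  rw [wp_seq, wp_instr]
  -- This number exceeds the cost of every solution and plays the role of infinity.
  set top := 1 + ∑ e ∈ Finset.range m, s.arr 2 e with htop
  refine (wp_forUp (N := n) (K := 4 * c + 10) (fun k s' => s'.reg 11 = k * c ∧
      (∀ v < k, s'.arr 18 v = v * c) ∧
      ∀ v < k, ∀ d < c, s'.arr 19 (v * c + d) = if d = s.arr 17 v then 0 else top)
    rfl (by simp [Instr.apply, g, h2]) (by simp [Instr.apply, g, h0])
    (by simp [Instr.apply, g, h3]) ?_).seq ?_
  · rintro k hk s₂ F₂ ⟨hI, hJ, hK⟩ hi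
    have q2 : s₂.reg 2 = 1 := by rw [F₂.reg 2 rfl]; simp [Instr.apply, g, h2]
    have q3 : s₂.reg 3 = 0 := by rw [F₂.reg 3 rfl]; simp [Instr.apply, g, h3]
    have q4 : s₂.reg 4 = c := by rw [F₂.reg 4 rfl]; simp [Instr.apply, g, h4]
    have q5 : s₂.reg 5 = top := by rw [F₂.reg 5 rfl]; simp [Instr.apply, hI₁]
    have q17 : s₂.arr 17 = s.arr 17 := by rw [F₂.arr 17 rfl]; simp [Instr.apply, g']
    simp only [wp_seq, wp_instr, Instr.apply, State.reg_setReg, State.arr_setReg, State.reg_setArr,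
      State.arr_setArr, Nat.reduceEqDiff, if_true, if_false, hI, hi, q17]
    refine (wp_forUp (N := c) (K := 2) (fun j s' => s'.reg 11 = k * c + j ∧
      ∀ x, s'.arr 19 x = if k * c ≤ x ∧ x < k * c + j then top else s₂.arr 19 x)
      rfl (by simp [q2]) (by simp [q4]) ?_ ?_).mono ?_
    · simp only [State.reg_setReg, State.arr_setReg, State.reg_setArr, State.arr_setArr,
        Nat.reduceEqDiff, if_true, if_false, hI, add_zero, true_and]
      intro x
      rw [if_neg (by omega)]
    · rintro j hj s₃ F₃ ⟨hI', hJ'⟩ -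
      have e5 : s₃.reg 5 = top := by rw [F₃.reg 5 rfl]; simp [q5]
      have e2 : s₃.reg 2 = 1 := by rw [F₃.reg 2 rfl]; simp [q2]
      simp only [wp_seq, wp_instr, Instr.apply, State.reg_setReg, State.arr_setReg,
        State.reg_setArr, State.arr_setArr, Nat.reduceEqDiff, if_true, if_false, hI', e5, e2]
      refine ⟨by norm_num, by ring, fun x => ?_⟩
      by_cases hx : x = k * c + j
      · subst hx
        rw [Function.update_self, if_pos (by omega)]
      · rw [Function.update_of_ne hx, hJ' x]
        have : (k * c ≤ x ∧ x < k * c + j) ↔ (k * c ≤ x ∧ x < k * c + (j + 1)) := by omega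
        simp only [this]
    · rintro s₃ t₃ F₃ ⟨ht₃, hI', hJ'⟩
      have e3 : s₃.reg 3 = 0 := by rw [F₃.reg 3 rfl]; simp [q3]
      have e13 : s₃.reg 13 = k * c + s.arr 17 k := by rw [F₃.reg 13 rfl]; simp
      have e18 : s₃.arr 18 = Function.update (s₂.arr 18) k (k * c) := by
        rw [F₃.arr 18 rfl]; simp
      simp only [State.reg_setReg, State.arr_setReg,
        State.reg_setArr, State.arr_setArr, Nat.reduceEqDiff, if_true, if_false, hI', e3, e13, e18]
      refine ⟨by omega, by ring, fun v hv => ?_, fun v hv d hd => ?_⟩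
      · by_cases hvk : v = k
        · simp [hvk]
        · rw [Function.update_of_ne hvk]
          exact hJ v (by omega)
      · by_cases hx : v * c + d = k * c + s.arr 17 k
        · obtain ⟨rfl, rfl⟩ := index_inj hd (hcomp k hk) hx
          simp
        · rw [Function.update_of_ne hx, hJ' (v * c + d)]
          by_cases hvk : v = k
          · subst hvk
            rw [if_pos (by omega), if_neg (by rintro rfl; exact hx rfl)]
          · have : (v + 1) * c ≤ k * c := Nat.mul_le_mul_right c (by omega)
            rw [add_mul] at this
            rw [if_neg (by omega)]
            exact hK v (by omega) d hd
  rintro s₂ t₂ F₂ ⟨ht₂, -, hJ₂, hK₂⟩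
  have f5 : s₂.reg 5 = top := by rw [F₂.reg 5 rfl]; simp [Instr.apply, hI₁]
  have f1 : s₂.reg 1 = m := by rw [F₂.reg 1 rfl]; simp [Instr.apply, g, h1]
  have f2 : s₂.reg 2 = 1 := by rw [F₂.reg 2 rfl]; simp [Instr.apply, g, h2]
  have fa : ∀ a, a < 18 → s₂.arr a = s.arr a := by
    intro a ha
    rw [F₂.arr a (by simp [forUp, Prog.keepsArr, Instr.keepsArr]; omega)]
    simp [Instr.apply, g']
  refine (wp_forUp (N := m) (K := 12) (fun k s' =>
      IsCostTable n k c top (s.arr 0) (s.arr 1) (s.arr 2) (s.arr 3) (s.arr 17)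
        fun v d => s'.arr 19 (v * c + d)) rfl f2 f1 ?_ ?_).mono ?_
  · refine ⟨fun v hv => ?_, by simp, fun v hv d hd h => ?_⟩
    · simp only [State.arr_setReg]
      rw [hK₂ v hv _ (hcomp v hv), if_pos rfl]
    · simp only [State.arr_setReg] at h
      rw [hK₂ v hv d hd] at h
      split_ifs at h with hd'
      · exact .inl hd'
      · omega
  · rintro k hk s₃ F₃ hI hi
    have e18 : s₃.arr 18 = s₂.arr 18 := F₃.arr 18 rfl
    have e0 : s₃.arr 0 = s.arr 0 := by rw [F₃.arr 0 rfl, fa 0 (by norm_num)]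
    have e1 : s₃.arr 1 = s.arr 1 := by rw [F₃.arr 1 rfl, fa 1 (by norm_num)]
    have e2 : s₃.arr 2 = s.arr 2 := by rw [F₃.arr 2 rfl, fa 2 (by norm_num)]
    have e3 : s₃.arr 3 = s.arr 3 := by rw [F₃.arr 3 rfl, fa 3 (by norm_num)]
    have e17 : s₃.arr 17 = s.arr 17 := by rw [F₃.arr 17 rfl, fa 17 (by norm_num)]
    simp only [wp_seq, wp_instr, wp_ite, wp_skip, Instr.apply, Test.Holds, State.reg_setReg,
      State.arr_setReg, State.reg_setArr, State.arr_setArr, Nat.reduceEqDiff, if_true, if_false,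
      hi, e18, e0, e1, e2, e3, e17, hJ₂ _ (hsrc k hk)]
    have hd := hcomp _ (hdst k hk)
    constructor
    · intro hlt
      refine ⟨by norm_num, ?_, ?_, ?_⟩
      · intro v hv
        by_cases hx : v * c + s.arr 17 v = s.arr 0 k * c + s.arr 17 (s.arr 1 k)
        -- The entry for the own component is `0` and cannot be improved, so this case contradicts
        -- the test.
        · obtain ⟨rfl, h⟩ := index_inj (hcomp v hv) hd hx
          have := hI.own _ hv
          simp only [h] at this
          omega
        · rw [Function.update_of_ne hx]
          exact hI.own v hv
      · intro e he
        by_cases hx : s.arr 0 e * c + s.arr 17 (s.arr 1 e) =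
            s.arr 0 k * c + s.arr 17 (s.arr 1 k)
        · rw [hx, Function.update_self]
          by_cases hek : e = k
          · rw [hek]
          · have := hI.le e (by omega)
            rw [hx] at this
            omega
        · rw [Function.update_of_ne hx]
          exact hI.le e (by
            rcases Nat.lt_succ_iff_lt_or_eq.1 he with h | rfl
            · exact h
            · exact absurd rfl hx)
      · intro v hv d hd'
        by_cases hx : v * c + d = s.arr 0 k * c + s.arr 17 (s.arr 1 k)
        · obtain ⟨rfl, rfl⟩ := index_inj hd' hd hx
          rw [Function.update_self]
          exact fun _ => .inr ⟨k, Nat.lt_succ_self k, rfl, rfl, by omega⟩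
        · rw [Function.update_of_ne hx]
          intro h
          rcases hI.exists_arc v hv d hd' h with h | ⟨e, he, h⟩
          · exact .inl h
          · exact .inr ⟨e, by omega, h⟩
    · intro hlt
      refine ⟨by norm_num, hI.own, fun e he => ?_, fun v hv d hd' h => ?_⟩
      · rcases Nat.lt_succ_iff_lt_or_eq.1 he with h | rfl
        · exact hI.le e h
        · omega
      · rcases hI.exists_arc v hv d hd' h with h | ⟨e, he, h⟩
        · exact .inl h
        · exact .inr ⟨e, by omega, h⟩
  · rintro s₃ t₃ F₃ ⟨ht₃, hI⟩
    have e5 : s₃.reg 5 = top := by rw [F₃.reg 5 rfl, f5]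
    rw [e5]
    refine ⟨?_, rfl, fun v hv => ?_, hI⟩
    · have : n * (4 * c + 10 + 2) = 4 * (n * c) + 12 * n := by ring
      omega
    · rw [F₃.arr 18 rfl]
      exact hJ₂ v hv

end MinPAC

/-! ### The combinatorics of the algorithm -/

namespace MinPAC

open RAM DFS Relation

/-- The set `{d < c | P d}`, coded in binary. -/
def mask (c : ℕ) (P : ℕ → Prop) [DecidablePred P] : ℕ :=
  ∑ d ∈ Finset.range c, if P d then 2 ^ d else 0

theorem mask_succ (c : ℕ) (P : ℕ → Prop) [DecidablePred P] :
    mask (c + 1) P = mask c P + if P c then 2 ^ c else 0 :=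
  Finset.sum_range_succ _ _

theorem mask_lt (c : ℕ) (P : ℕ → Prop) [DecidablePred P] : mask c P < 2 ^ c := by
  induction c with
  | zero => simp [mask]
  | succ c ih =>
    rw [mask_succ, pow_succ]
    split_ifs <;> omega

theorem add_mul_pow_digit {b R N x k : ℕ} (hk : k < R) :
    (N + x * b ^ R) / b ^ k % b = N / b ^ k % b := by
  rcases Nat.eq_zero_or_pos b with rfl | hb
  · rw [zero_pow (by omega), mul_zero, add_zero]
  · obtain ⟨d, rfl⟩ : ∃ d, R = k + (d + 1) := ⟨R - k - 1, by omega⟩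
    have : N + x * b ^ (k + (d + 1)) = N + b ^ k * (b * (x * b ^ d)) := by ring
    rw [this, Nat.add_mul_div_left _ _ (Nat.pow_pos hb), Nat.add_mul_mod_self_left]

theorem top_digit {b R N x : ℕ} (hN : N < b ^ R) (hx : x < b) :
    (N + x * b ^ R) / b ^ R % b = x := by
  rw [Nat.add_mul_div_right _ _ (by omega), Nat.div_eq_of_lt hN, zero_add, Nat.mod_eq_of_lt hx]

theorem mask_digit {c d : ℕ} (P : ℕ → Prop) [DecidablePred P] (hd : d < c) :
    mask c P / 2 ^ d % 2 = 1 ↔ P d := by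
  induction c with
  | zero => omega
  | succ c ih =>
    rw [mask_succ, ← one_mul (2 ^ c), ← ite_zero_mul]
    rcases Nat.lt_succ_iff_lt_or_eq.1 hd with h | rfl
    · rw [add_mul_pow_digit h, ih h]
    · rw [top_digit (mask_lt _ _) (by split_ifs <;> omega)]
      split_ifs with h <;> simp [h]

theorem eq_zero_of_digits {c S : ℕ} (hS : S < 2 ^ c) (h : ∀ d < c, S / 2 ^ d % 2 ≠ 1) : S = 0 := by
  refine Nat.eq_of_testBit_eq fun d => ?_
  rw [Nat.zero_testBit, Nat.testBit_eq_decide_div_mod_eq, decide_eq_false_iff_not]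
  by_cases hd : d < c
  · exact h d hd
  · rw [Nat.div_eq_of_lt (hS.trans_le (Nat.pow_le_pow_right (by norm_num) (by omega)))]
    simp

/-- This makes the enumeration exhaustive: counting up to `b ^ R` meets every sequence of `R`
digits. -/
theorem exists_digits {b : ℕ} (R : ℕ) (e : ℕ → ℕ) (he : ∀ k < R, e k < b) :
    ∃ N < b ^ R, ∀ k < R, N / b ^ k % b = e k := by
  induction R with
  | zero => exact ⟨0, by simp, by simp⟩
  | succ R ih =>
    obtain ⟨N, hN, hd⟩ := ih fun k hk => he k (by omega)
    have hR := he R (Nat.lt_succ_self R)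
    refine ⟨N + e R * b ^ R, ?_, fun k hk => ?_⟩
    · calc N + e R * b ^ R < b ^ R + e R * b ^ R := by omega
        _ = (e R + 1) * b ^ R := by ring
        _ ≤ b * b ^ R := Nat.mul_le_mul_right _ hR
        _ = b ^ (R + 1) := by ring
    · rcases Nat.lt_succ_iff_lt_or_eq.1 hk with h | rfl
      · rw [add_mul_pow_digit h, hd k h]
      · exact top_digit hN hR

/-- If all numbers below `c` have a walk to `0`, then there is a spanning tree directed to `0`. -/
theorem exists_tree {c : ℕ} (hc : 0 < c) {R : ℕ → ℕ → Prop} (hR : ∀ x y, R x y → x < c)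
    (h : ∀ x < c, ReflTransGen R x 0) :
    ∃ q : ℕ → ℕ, (∀ x < c, q x < c) ∧ (∀ x < c, x = q x ∨ R x (q x)) ∧ ∀ x < c, q^[c] x = 0 := by
  -- The tree grows by one vertex at a time; `A` is its current vertex set. The root is its own
  -- parent, which is why `x = q x` is allowed.
  have key : ∀ k < c, ∃ (A : Finset ℕ) (q : ℕ → ℕ), A ⊆ Finset.range c ∧ A.card = k + 1 ∧ 0 ∈ A ∧
      q 0 = 0 ∧ (∀ x ∈ A, q x ∈ A) ∧ (∀ x ∈ A, x = q x ∨ R x (q x)) ∧ ∀ x ∈ A, q^[k] x = 0 := by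
    intro k
    induction k with
    | zero =>
      intro _
      exact ⟨{0}, fun _ => 0, by simpa using hc, by simp, by simp, rfl, by simp, by simp, by simp⟩
    | succ k ih =>
      intro hk
      obtain ⟨A, q, hA, hcard, h0, hq0, hcl, hRq, hit⟩ := ih (by omega)
      obtain ⟨x, hx, hxA⟩ : ∃ x < c, x ∉ A := by
        by_contra! hall
        have := Finset.card_le_card fun x hx => hall x (Finset.mem_range.1 hx)
        rw [Finset.card_range] at this
        omega
      -- A walk from a vertex outside `A` to `0` contains an arc that enters `A`; its tail becomes
      -- the new leaf.
      obtain ⟨y, z, hyz, hy, hz⟩ : ∃ y z, R y z ∧ y ∉ A ∧ z ∈ A := by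
        have hw := h x hx
        clear hx
        induction hw using ReflTransGen.head_induction_on with
        | refl => exact absurd h0 hxA
        | @head y z hyz _ ih' =>
          by_cases hz : z ∈ A
          · exact ⟨y, z, hyz, hxA, hz⟩
          · exact ih' hz
      have hne : ∀ x ∈ A, x ≠ y := fun x hx e => hy (e ▸ hx)
      have hup : ∀ x ∈ A, Function.update q y z x = q x := fun x hx =>
        Function.update_of_ne (hne x hx) _ _
      have hiter : ∀ j, ∀ x ∈ A, (Function.update q y z)^[j] x = q^[j] x ∧ q^[j] x ∈ A := by
        intro j
        induction j with
        | zero => exact fun x hx => ⟨rfl, hx⟩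
        | succ j ihj =>
          intro x hx
          rw [Function.iterate_succ_apply, Function.iterate_succ_apply, hup x hx]
          exact ihj _ (hcl x hx)
      refine ⟨insert y A, Function.update q y z, ?_, ?_, ?_, ?_, ?_, ?_, ?_⟩
      · exact Finset.insert_subset (Finset.mem_range.2 (hR _ _ hyz)) hA
      · rw [Finset.card_insert_of_notMem hy, hcard]
      · exact Finset.mem_insert_of_mem h0
      · rw [hup 0 h0, hq0]
      · intro x hx
        rcases Finset.mem_insert.1 hx with rfl | hx
        · simp [hz]
        · rw [hup x hx]; exact Finset.mem_insert_of_mem (hcl x hx)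
      · intro x hx
        rcases Finset.mem_insert.1 hx with rfl | hx
        · simp [hyz]
        · rw [hup x hx]; exact hRq x hx
      · intro x hx
        rcases Finset.mem_insert.1 hx with rfl | hx
        · rw [Function.iterate_succ_apply, Function.update_self, (hiter k z hz).1, hit z hz]
        · rw [(hiter _ x hx).1, Function.iterate_succ_apply', hit x hx, hq0]
  obtain ⟨A, q, hA, hcard, h0, hq0, hcl, hRq, hit⟩ := key (c - 1) (by omega)
  have hAc : A = Finset.range c :=
    Finset.eq_of_subset_of_card_le hA (by rw [Finset.card_range]; omega)
  have hmem : ∀ x < c, x ∈ A := fun x hx => by rw [hAc]; exact Finset.mem_range.2 hx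
  refine ⟨q, fun x hx => ?_, fun x hx => hRq x (hmem x hx), fun x hx => ?_⟩
  · have := hcl x (hmem x hx)
    rwa [hAc, Finset.mem_range] at this
  · obtain ⟨k, rfl⟩ : ∃ k, c = k + 1 := ⟨c - 1, by omega⟩
    rw [Function.iterate_succ_apply', show q^[k] x = 0 from hit x (hmem x hx), hq0]

theorem mask_congr {c : ℕ} {P Q : ℕ → Prop} [DecidablePred P] [DecidablePred Q]
    (h : ∀ d < c, P d ↔ Q d) : mask c P = mask c Q :=
  Finset.sum_congr rfl fun d hd => by simp only [h d (Finset.mem_range.1 hd)]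

theorem iterate_eq_of_lt {c : ℕ} {f g : ℕ → ℕ} (hfg : ∀ x < c, f x = g x) (hg : ∀ x < c, g x < c)
    (j : ℕ) {x : ℕ} (hx : x < c) : f^[j] x = g^[j] x := by
  induction j generalizing x with
  | zero => rfl
  | succ j ih =>
    rw [Function.iterate_succ_apply, Function.iterate_succ_apply, hfg x hx]
    exact ih (hg x hx)

/-- The number of the table of component `C` before vertex `i` is considered. -/
def lastTable (comp : ℕ → ℕ) : ℕ → ℕ → ℕ
  | 0, _ => 0
  | i + 1, C => if comp i = C then i + 1 else lastTable comp i C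

/-- The elements of `S` that remain to be covered if the power of `v` is increased
by `W v j`. -/
def rest (c : ℕ) (W : ℕ → ℕ → ℕ) (v S j : ℕ) : ℕ :=
  mask c fun d => S / 2 ^ d % 2 = 1 ∧ W v j < W v d

theorem rest_lt (c : ℕ) (W : ℕ → ℕ → ℕ) (v S j : ℕ) : rest c W v S j < 2 ^ c := mask_lt _ _

/-- The tables of the dynamic program: `F (v + 1) S` is the least increase of the powers of the
vertices up to `v` in the component of `v` that connects this component to all components in `S`. -/
structure IsTables (n c top : ℕ) (comp : ℕ → ℕ) (W F I T : ℕ → ℕ → ℕ) : Prop where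
  zero : ∀ S < 2 ^ c, F 0 S = if S = 0 then 0 else top
  le : ∀ i < n, ∀ S < 2 ^ c, ∀ j < c,
    F (i + 1) S ≤ F (lastTable comp i (comp i)) (rest c W i S j) + W i j
  eq : ∀ i < n, ∀ S < 2 ^ c, F (i + 1) S < top → ∃ j < c, T (i + 1) S = rest c W i S j ∧
    I (i + 1) S = W i j ∧ F (i + 1) S = F (lastTable comp i (comp i)) (T (i + 1) S) + I (i + 1) S

section

variable {n c top : ℕ} {comp : ℕ → ℕ} {W F I T : ℕ → ℕ → ℕ}

theorem lastTable_le (i C : ℕ) : lastTable comp i C ≤ i := by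
  induction i with
  | zero => exact le_rfl
  | succ i ih =>
    rw [lastTable]
    split_ifs <;> omega

/-- The recursion refers only to tables with numbers at most `i` (`lastTable_le`), so adding a table
leaves the earlier equations intact. -/
theorem IsTables.succ (h : IsTables n c top comp W F I T) {F' I' T' : ℕ → ℕ → ℕ}
    (hF : ∀ t ≤ n, ∀ S < 2 ^ c, F' t S = F t S) (hI : ∀ t ≤ n, ∀ S < 2 ^ c, I' t S = I t S)
    (hT : ∀ t ≤ n, ∀ S < 2 ^ c, T' t S = T t S)
    (hle : ∀ S < 2 ^ c, ∀ j < c,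
      F' (n + 1) S ≤ F (lastTable comp n (comp n)) (rest c W n S j) + W n j)
    (heq : ∀ S < 2 ^ c, F' (n + 1) S < top → ∃ j < c, T' (n + 1) S = rest c W n S j ∧
      I' (n + 1) S = W n j ∧
      F' (n + 1) S = F (lastTable comp n (comp n)) (T' (n + 1) S) + I' (n + 1) S) :
    IsTables (n + 1) c top comp W F' I' T' where
  zero S hS := by rw [hF 0 (Nat.zero_le _) S hS, h.zero S hS]
  le i hi S hS j hj := by
    have hl := lastTable_le (comp := comp) i (comp i)
    rw [hF (lastTable comp i (comp i)) (by omega) _ (rest_lt _ _ _ _ _)]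
    rcases Nat.lt_succ_iff_lt_or_eq.1 hi with hi | rfl
    · rw [hF (i + 1) hi S hS]
      exact h.le i hi S hS j hj
    · exact hle S hS j hj
  eq i hi S hS hlt := by
    have hl := lastTable_le (comp := comp) i (comp i)
    rcases Nat.lt_succ_iff_lt_or_eq.1 hi with hi | rfl
    · rw [hF (i + 1) hi S hS] at hlt
      obtain ⟨j, hj, hTj, h'⟩ := h.eq i hi S hS hlt
      rw [hF (i + 1) hi S hS, hI (i + 1) hi S hS, hT (i + 1) hi S hS]
      refine ⟨j, hj, hTj, ?_⟩
      rwa [hF (lastTable comp i (comp i)) (by omega) _ (by rw [hTj]; exact rest_lt _ _ _ _ _)]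
    · obtain ⟨j, hj, hTj, h'⟩ := heq S hS hlt
      refine ⟨j, hj, hTj, ?_⟩
      rwa [hF (lastTable comp i (comp i)) hl _ (by rw [hTj]; exact rest_lt _ _ _ _ _)]

/-- No increases `q` covering `S` from component `C` are cheaper than the table entry. The last
vertex `i` of `C` may as well use the highest level among the elements of `S` it reaches with `q i`;
the earlier vertices have to cover whatever lies above that level. -/
theorem IsTables.le_sum (h : IsTables n c top comp W F I T) (hcomp : ∀ v < n, comp v < c)
    (hown : ∀ v < n, W v (comp v) = 0) (q : ℕ → ℕ) {i : ℕ} (hi : i ≤ n) (C : ℕ) {S : ℕ}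
    (hS : S < 2 ^ c)
    (hq : ∀ d < c, S / 2 ^ d % 2 = 1 → ∃ v < i, comp v = C ∧ W v d ≤ q v) :
    F (lastTable comp i C) S ≤ ∑ v ∈ Finset.range i with comp v = C, q v := by
  induction i generalizing S with
  | zero =>
    have : S = 0 := eq_zero_of_digits hS fun d hd hb => by
      obtain ⟨v, hv, -⟩ := hq d hd hb
      omega
    subst this
    simp [lastTable, h.zero 0 hS]
  | succ i ih =>
    rw [Finset.range_add_one, Finset.filter_insert, lastTable]
    by_cases hC : comp i = C
    · rw [if_pos hC, if_pos hC, Finset.sum_insert (by simp)]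
      obtain ⟨j, hj, hmax⟩ := Finset.exists_max_image
        -- Inserting the own component, at level `0`, covers the case that vertex `i` reaches no
        -- element of `S`.
        (insert (comp i) ((Finset.range c).filter fun d => S / 2 ^ d % 2 = 1 ∧ W i d ≤ q i))
        (W i) ⟨_, Finset.mem_insert_self _ _⟩
      have hj' : j < c ∧ W i j ≤ q i := by
        rcases Finset.mem_insert.1 hj with rfl | hj
        · exact ⟨hcomp i hi, by rw [hown i hi]; exact Nat.zero_le _⟩
        · simp only [Finset.mem_filter, Finset.mem_range] at hj
          exact ⟨hj.1, hj.2.2⟩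
      refine (h.le i hi S hS j hj'.1).trans ?_
      rw [add_comm, hC]
      refine add_le_add hj'.2 (ih (by omega) (mask_lt _ _) fun d hd hb => ?_)
      rw [rest, mask_digit _ hd] at hb
      obtain ⟨v, hv, hvC, hvd⟩ := hq d hd hb.1
      refine ⟨v, (Nat.lt_succ_iff_lt_or_eq.1 hv).resolve_right ?_, hvC, hvd⟩
      rintro rfl
      have := hmax d (Finset.mem_insert_of_mem (by simp [hd, hb.1, hvd]))
      omega
    · rw [if_neg hC, if_neg hC]
      refine ih (by omega) hS fun d hd hb => ?_
      obtain ⟨v, hv, hvC, hvd⟩ := hq d hd hb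
      refine ⟨v, (Nat.lt_succ_iff_lt_or_eq.1 hv).resolve_right ?_, hvC, hvd⟩
      rintro rfl
      exact hC hvC

/-- The sets that remain to be covered after `k` steps of reading off a solution, the vertices
being considered in decreasing order. -/
def remaining (n : ℕ) (comp : ℕ → ℕ) (T : ℕ → ℕ → ℕ) (M : ℕ → ℕ) : ℕ → ℕ → ℕ
  | 0 => M
  | k + 1 => Function.update (remaining n comp T M k) (comp (n - k - 1))
      (T (n - k - 1 + 1) (remaining n comp T M k (comp (n - k - 1))))

/-- The increase of the power of `v` in the solution that is read off from the tables. -/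
def increase (n : ℕ) (comp : ℕ → ℕ) (I T : ℕ → ℕ → ℕ) (M : ℕ → ℕ) (v : ℕ) : ℕ :=
  I (v + 1) (remaining n comp T M (n - v - 1) (comp v))

/-- The vertices are undone from the last to the first. The table values still open plus the
increases already fixed keep a constant sum, and each required element is either still to be covered
or covered by a vertex already treated. -/
theorem IsTables.remaining (h : IsTables n c top comp W F I T) (hcomp : ∀ v < n, comp v < c)
    {M : ℕ → ℕ} (hM : ∀ C < c, M C < 2 ^ c)
    (htot : ∑ C ∈ Finset.range c, F (lastTable comp n C) (M C) < top) {i : ℕ} (hi : i ≤ n) :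
    (∀ C < c, remaining n comp T M (n - i) C < 2 ^ c) ∧
    ∑ C ∈ Finset.range c, F (lastTable comp i C) (MinPAC.remaining n comp T M (n - i) C) +
      ∑ v ∈ Finset.Ico i n, increase n comp I T M v =
      ∑ C ∈ Finset.range c, F (lastTable comp n C) (M C) ∧
    ∀ C < c, ∀ d < c, M C / 2 ^ d % 2 = 1 →
      MinPAC.remaining n comp T M (n - i) C / 2 ^ d % 2 = 1 ∨
        ∃ v, i ≤ v ∧ v < n ∧ comp v = C ∧ W v d ≤ increase n comp I T M v := by
  induction hi using Nat.decreasingInduction with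
  | self => simp [MinPAC.remaining]; exact ⟨hM, fun _ _ _ _ h => .inl h⟩
  | of_succ i hin ih =>
    obtain ⟨hlt, hsum, hcov⟩ := ih
    have hk : n - i = (n - (i + 1)) + 1 := by omega
    have hk' : n - (n - (i + 1)) - 1 = i := by omega
    have hk'' : n - i - 1 = n - (i + 1) := by omega
    have hci := hcomp i hin
    set B := MinPAC.remaining n comp T M (n - (i + 1)) with hB
    have hB' : MinPAC.remaining n comp T M (n - i) =
        Function.update B (comp i) (T (i + 1) (B (comp i))) := by
      rw [hk, MinPAC.remaining, hk', ← hB]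
    have hinc : increase n comp I T M i = I (i + 1) (B (comp i)) := by
      rw [increase, hk'']
    -- The entry is a summand of the conserved total, hence below `top`, and so it comes with a
    -- recorded choice.
    have hFlt : F (i + 1) (B (comp i)) < top := by
      have := Finset.single_le_sum (f := fun C => F (lastTable comp (i + 1) C) (B C))
        (fun _ _ => Nat.zero_le _) (Finset.mem_range.2 hci)
      simp only [lastTable, if_true] at this
      simp only [lastTable] at hsum
      omega
    obtain ⟨j, hj, hT, hI, hF⟩ := h.eq i hin _ (hlt _ hci) hFlt
    rw [hB']
    refine ⟨fun C hC => ?_, ?_, fun C hC d hd hb => ?_⟩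
    · by_cases hCi : C = comp i
      · subst hCi
        rw [Function.update_self, hT]
        exact mask_lt _ _
      · rw [Function.update_of_ne hCi]
        exact hlt C hC
    · rw [← hsum, Finset.sum_eq_sum_Ico_succ_bot hin, hinc, ← add_assoc]
      congr 1
      rw [← Finset.add_sum_erase _ _ (Finset.mem_range.2 hci),
        ← Finset.add_sum_erase (Finset.range c) (fun C => F (lastTable comp (i + 1) C) (B C))
          (Finset.mem_range.2 hci)]
      simp only [Function.update_self, lastTable, if_true]
      rw [hF, add_right_comm]
      congr 1
      refine Finset.sum_congr rfl fun C hC => ?_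
      have := Finset.ne_of_mem_erase hC
      rw [Function.update_of_ne this, if_neg (Ne.symm this)]
    · rcases hcov C hC d hd hb with hb' | ⟨v, hv, h'⟩
      · by_cases hCi : C = comp i
        · subst hCi
          by_cases hW : W i d ≤ I (i + 1) (B (comp i))
          · exact .inr ⟨i, le_rfl, hin, rfl, by rw [hinc]; exact hW⟩
          · left
            rw [Function.update_self, hT, rest, mask_digit _ hd]
            exact ⟨hb', by omega⟩
        · left
          rw [Function.update_of_ne hCi]
          exact hb'
      · exact .inr ⟨v, by omega, h'⟩

/-- After all vertices only table `0` is left, whose entry is `top` for every nonempty set. A total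
below `top` therefore leaves nothing uncovered. -/
theorem IsTables.increase (h : IsTables n c top comp W F I T) (hcomp : ∀ v < n, comp v < c)
    {M : ℕ → ℕ} (hM : ∀ C < c, M C < 2 ^ c)
    (htot : ∑ C ∈ Finset.range c, F (lastTable comp n C) (M C) < top) :
    ∑ v ∈ Finset.range n, increase n comp I T M v =
      ∑ C ∈ Finset.range c, F (lastTable comp n C) (M C) ∧
    ∀ C < c, ∀ d < c, M C / 2 ^ d % 2 = 1 →
      ∃ v < n, comp v = C ∧ W v d ≤ MinPAC.increase n comp I T M v := by
  obtain ⟨hlt, hsum, hcov⟩ := h.remaining hcomp hM htot (Nat.zero_le n)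
  have h0 : ∀ C < c, MinPAC.remaining n comp T M (n - 0) C = 0 := by
    intro C hC
    by_contra hne
    have := Finset.single_le_sum
      (f := fun C => F (lastTable comp 0 C) (MinPAC.remaining n comp T M (n - 0) C))
      (fun _ _ => Nat.zero_le _) (Finset.mem_range.2 hC)
    simp only [lastTable, h.zero _ (hlt C hC), if_neg hne] at this
    simp only [lastTable] at hsum
    omega
  have hz : ∑ C ∈ Finset.range c, F (lastTable comp 0 C)
      (MinPAC.remaining n comp T M (n - 0) C) = 0 := by
    refine Finset.sum_eq_zero fun C hC => ?_
    rw [h0 C (Finset.mem_range.1 hC), lastTable, h.zero 0 (Nat.pow_pos (by norm_num)), if_pos rfl]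
  rw [hz, zero_add, ← Finset.range_eq_Ico] at hsum
  refine ⟨hsum, fun C hC d hd hb => ?_⟩
  rcases hcov C hC d hd hb with hb' | ⟨v, -, hv⟩
  · rw [h0 C hC] at hb'
    simp at hb'
  · exact ⟨v, hv⟩

end

/-- `N` codes two trees on the components, the first one directed from component `0` and the second
one directed to component `0`. -/
def Valid (c N : ℕ) : Prop :=
  ∀ x < c, (fun y => N / c ^ y % c)^[c] x = 0 ∧ (fun y => N / c ^ (c + y) % c)^[c] x = 0

/-- The components that `C` has to be connected to in the trees coded by `N`. -/
def targets (c N C : ℕ) : ℕ :=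
  mask c fun D => N / c ^ D % c = C ∨ N / c ^ (c + C) % c = D

/-- The cost of the trees coded by `N`. -/
def treeCost (n c : ℕ) (comp : ℕ → ℕ) (F : ℕ → ℕ → ℕ) (N : ℕ) : ℕ :=
  ∑ C ∈ Finset.range c, F (lastTable comp n C) (targets c N C)

/-- The tree directed from `0` comes from applying `exists_tree` to the reversed relation. The
alternative `C = D` stems from the roots, which are their own parents. -/
theorem exists_valid {c : ℕ} (hc : 0 < c) {R : ℕ → ℕ → Prop} (hR : ∀ x y, R x y → x < c ∧ y < c)
    (h : ∀ x < c, ReflTransGen R x 0 ∧ ReflTransGen R 0 x) :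
    ∃ N < c ^ (c + c), Valid c N ∧
      ∀ C < c, ∀ D < c, targets c N C / 2 ^ D % 2 = 1 → C = D ∨ R C D := by
  obtain ⟨q, hq, hRq, hq0⟩ := exists_tree hc (fun x y h => (hR x y h).1) fun x hx => (h x hx).1
  obtain ⟨p, hp, hRp, hp0⟩ := exists_tree (R := fun x y => R y x) hc (fun x y h => (hR y x h).2)
    fun x hx => reflTransGen_swap.1 (h x hx).2
  obtain ⟨N, hN, hd⟩ := exists_digits (b := c) (c + c) (fun k => if k < c then p k else q (k - c))
    fun k hk => by
      split_ifs with hkc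
      · exact hp k hkc
      · exact hq _ (by omega)
  have hdp : ∀ x < c, N / c ^ x % c = p x := fun x hx => by
    rw [hd x (by omega), if_pos hx]
  have hdq : ∀ x < c, N / c ^ (c + x) % c = q x := fun x hx => by
    rw [hd _ (by omega), if_neg (by omega), Nat.add_sub_cancel_left]
  refine ⟨N, hN, fun x hx => ⟨?_, ?_⟩, fun C hC D hD hb => ?_⟩
  · rw [iterate_eq_of_lt hdp hp c hx, hp0 x hx]
  · rw [iterate_eq_of_lt hdq hq c hx, hq0 x hx]
  · rw [targets, mask_digit _ hD, hdp D hD, hdq C hC] at hb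
    rcases hb with rfl | rfl
    · rcases hRp D hD with e | e
      · exact .inl e.symm
      · exact .inr e
    · exact hRq C hC

end MinPAC

/-! ### Optimality of the solution found. -/

namespace MinPAC

open RAM DFS Relation

/-- The arrays contain the instance. -/
structure IsInput {n : ℕ} (L : List (Fin n × Fin n)) (w : Fin n → Fin n → ℕ) (l : Fin n → ℕ)
    (src dst wt lb : ℕ → ℕ) : Prop where
  src_eq : ∀ e (h : e < L.length), src e = L[e].1
  dst_eq : ∀ e (h : e < L.length), dst e = L[e].2
  wt_eq : ∀ e (h : e < L.length), wt e = w L[e].1 L[e].2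
  lb_eq : ∀ v : Fin n, lb v = l v

/-- The arcs of the obligatory subgraph. -/
def Oblig (m : ℕ) (src dst wt lb : ℕ → ℕ) (v u : ℕ) : Prop :=
  ∃ e < m, wt e ≤ lb (src e) ∧ src e = v ∧ dst e = u

/-- The digraph of the arcs that the vertices reach with the powers `P`. -/
def powered {V : Type*} (G : Digraph V) (w : V → V → ℕ) (P : V → ℕ) : Digraph V where
  Adj v u := G.Adj v u ∧ w v u ≤ P v

theorem powered_le {V : Type*} (G : Digraph V) (w : V → V → ℕ) (P : V → ℕ) :
    powered G w P ≤ G := fun _ _ h => h.1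

theorem cost_powered_le {V : Type*} [Fintype V] (G : Digraph V) (w : V → V → ℕ) (P : V → ℕ) :
    cost w (powered G w P) ≤ ∑ v, P v := by
  classical
  refine Finset.sum_le_sum fun v _ => Finset.sup_le fun u hu => ?_
  exact (Finset.mem_filter.1 hu).2.2

theorem le_vertexCost {V : Type*} [Fintype V] {w : V → V → ℕ} {H : Digraph V} {v u : V}
    (h : H.Adj v u) : w v u ≤ vertexCost w H v := by
  classical
  exact Finset.le_sup (f := w v) (Finset.mem_filter.2 ⟨Finset.mem_univ u, h⟩)

theorem exists_optimal {V : Type*} [Fintype V] {G : Digraph V} (w : V → V → ℕ)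
    (hG : StronglyConnected G) : ∃ H, IsOptimal G w H := by
  obtain ⟨H, hH, hmin⟩ := (measure (cost w)).wf.has_min
    {H : Digraph V | H ≤ G ∧ StronglyConnected H} ⟨G, le_rfl, hG⟩
  exact ⟨H, hH, fun H' h₁ h₂ => not_lt.1 (hmin H' ⟨h₁, h₂⟩)⟩

section

variable {n : ℕ} {G : Digraph (Fin n)} {w : Fin n → Fin n → ℕ} {l : Fin n → ℕ}
  {L : List (Fin n × Fin n)} {src dst wt lb : ℕ → ℕ}

theorem IsInput.adj_iff (h : IsInput L w l src dst wt lb) (hL : IsArcList G L) {v u : Fin n} :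
    G.Adj v u ↔ ∃ e < L.length, src e = v ∧ dst e = u ∧ wt e = w v u := by
  rw [← hL.2 v u, List.mem_iff_getElem]
  constructor
  · rintro ⟨e, he, hvu⟩
    exact ⟨e, he, by rw [h.src_eq e he, hvu], by rw [h.dst_eq e he, hvu],
      by rw [h.wt_eq e he, hvu]⟩
  · rintro ⟨e, he, hv, hu, -⟩
    rw [h.src_eq e he] at hv
    rw [h.dst_eq e he] at hu
    exact ⟨e, he, Prod.ext (Fin.ext hv) (Fin.ext hu)⟩

theorem IsInput.oblig_iff (h : IsInput L w l src dst wt lb) (hL : IsArcList G L) {v u : Fin n} :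
    Oblig L.length src dst wt lb v u ↔ (obligatory G w l).Adj v u := by
  constructor
  · rintro ⟨e, he, hle, hv, hu⟩
    have hw : wt e = w v u := by
      rw [h.src_eq e he] at hv
      rw [h.dst_eq e he] at hu
      rw [h.wt_eq e he, Fin.ext hv, Fin.ext hu]
    refine ⟨(h.adj_iff hL).2 ⟨e, he, hv, hu, hw⟩, ?_⟩
    rwa [hw, hv, h.lb_eq] at hle
  · rintro ⟨hadj, hle⟩
    obtain ⟨e, he, hv, hu, hw⟩ := (h.adj_iff hL).1 hadj
    exact ⟨e, he, by rwa [hw, hv, h.lb_eq], hv, hu⟩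

theorem IsInput.reach (h : IsInput L w l src dst wt lb) (hL : IsArcList G L) {v : Fin n} {u : ℕ}
    (hr : ReflTransGen (Oblig L.length src dst wt lb) v u) :
    ∃ u' : Fin n, (u' : ℕ) = u ∧ Reach (obligatory G w l) v u' := by
  induction hr with
  | refl => exact ⟨v, rfl, .refl⟩
  | @tail a b _ hab ih =>
    obtain ⟨a', rfl, ha⟩ := ih
    have hb : ∃ b' : Fin n, (b' : ℕ) = b := by
      obtain ⟨e, he, -, -, hu⟩ := hab
      exact ⟨L[e].2, by rw [← h.dst_eq e he, hu]⟩
    obtain ⟨b', rfl⟩ := hb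
    exact ⟨b', rfl, ha.tail ((h.oblig_iff hL).1 hab)⟩

variable {c : ℕ} {comp : ℕ → ℕ}

/-- Numbers do not decrease along walks, so representatives of different numbers are never mutually
reachable. This inequality suffices, because the time bound is monotone in the number of components.
-/
theorem IsInput.le_numSCC (h : IsInput L w l src dst wt lb) (hL : IsArcList G L)
    (hc : IsComp n (Oblig L.length src dst wt lb) c comp) :
    c ≤ numSCC (obligatory G w l) := by
  have hmono : ∀ u v : Fin n, Reach (obligatory G w l) u v → comp u ≤ comp v := by
    intro u v huv
    induction huv with
    | refl => exact le_rfl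
    | tail _ hab ih => exact ih.trans (hc.mono _ _ ((h.oblig_iff hL).2 hab))
  choose r hr hrc using hc.surj
  let f : Fin c → Set (Fin n) := fun j => scc (obligatory G w l) ⟨r j j.2, hr j j.2⟩
  have hf : Function.Injective f := by
    intro i j hij
    have hi : (⟨r i i.2, hr i i.2⟩ : Fin n) ∈ f j := by
      rw [← hij]; exact ⟨.refl, .refl⟩
    have h1 := hmono _ _ hi.1
    have h2 := hmono _ _ hi.2
    simp only [hrc] at h1 h2
    exact Fin.ext (le_antisymm h2 h1)
  calc c = (Set.range f).ncard := by
        rw [← Nat.card_coe_set_eq, Nat.card_range_of_injective hf, Nat.card_fin]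
    _ ≤ (Set.range (scc (obligatory G w l))).ncard := by
        refine Set.ncard_le_ncard ?_ (Set.finite_range _)
        rintro _ ⟨j, rfl⟩
        exact ⟨_, rfl⟩

variable {top : ℕ} {W F I T : ℕ → ℕ → ℕ}

/-- Contracting the components in `H` gives a strongly connected relation and hence a pair of trees.
The increases that `H` pays cover all tree arcs, so `le_sum` applies in each component, and the
components partition the vertices. -/
theorem IsInput.exists_treeCost_le (h : IsInput L w l src dst wt lb) (hL : IsArcList G L)
    (hn : 0 < n) (hc : IsComp n (Oblig L.length src dst wt lb) c comp)
    (hW : IsCostTable n L.length c top src dst wt lb comp W)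
    (hT : IsTables n c top comp W F I T) {H : Digraph (Fin n)} (hHG : H ≤ G)
    (hH : StronglyConnected H) :
    ∃ N < c ^ (c + c), Valid c N ∧ treeCost n c comp F N ≤ ∑ v, (vertexCost w H v - l v) := by
  have hc0 : 0 < c := (Nat.zero_le _).trans_lt (hc.lt 0 hn)
  let R : ℕ → ℕ → Prop := fun C D => ∃ v u : Fin n, H.Adj v u ∧ comp v = C ∧ comp u = D
  have hreach : ∀ v u : Fin n, ReflTransGen R (comp v) (comp u) := by
    intro v u
    have := hH v u
    induction this with
    | refl => exact .refl
    | tail _ hab ih => exact ih.tail ⟨_, _, hab, rfl, rfl⟩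
  have hR : ∀ x < c, ReflTransGen R x 0 ∧ ReflTransGen R 0 x := by
    intro x hx
    obtain ⟨v, hv, rfl⟩ := hc.surj x hx
    obtain ⟨u, hu, hu0⟩ := hc.surj 0 hc0
    rw [← hu0]
    exact ⟨hreach ⟨v, hv⟩ ⟨u, hu⟩, hreach ⟨u, hu⟩ ⟨v, hv⟩⟩
  obtain ⟨N, hN, hval, hcov⟩ := exists_valid hc0
    (by rintro x y ⟨v, u, -, rfl, rfl⟩; exact ⟨hc.lt v v.2, hc.lt u u.2⟩) hR
  refine ⟨N, hN, hval, ?_⟩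
  let q : ℕ → ℕ := fun v => if hv : v < n then vertexCost w H ⟨v, hv⟩ - l ⟨v, hv⟩ else 0
  have hq : ∀ v : Fin n, q v = vertexCost w H v - l v := fun v => by simp [q]
  calc treeCost n c comp F N
      ≤ ∑ C ∈ Finset.range c, ∑ v ∈ Finset.range n with comp v = C, q v := by
        refine Finset.sum_le_sum fun C hC => ?_
        have hC := Finset.mem_range.1 hC
        refine hT.le_sum hc.lt hW.own q le_rfl C (mask_lt _ _) fun D hD hb => ?_
        rcases hcov C hC D hD hb with rfl | ⟨v, u, hvu, rfl, rfl⟩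
        · obtain ⟨v, hv, rfl⟩ := hc.surj C hC
          exact ⟨v, hv, rfl, by rw [hW.own v hv]; exact Nat.zero_le _⟩
        · refine ⟨v, v.2, rfl, ?_⟩
          obtain ⟨e, he, hev, heu, hew⟩ := (h.adj_iff hL).1 (hHG hvu)
          have := hW.le e he
          rw [hev, heu, hew, h.lb_eq] at this
          rw [hq]
          exact this.trans (Nat.sub_le_sub_right (le_vertexCost hvu) _)
    _ = ∑ v ∈ Finset.range n, q v :=
        Finset.sum_fiberwise_of_maps_to
          (fun v hv => Finset.mem_range.2 (hc.lt v (Finset.mem_range.1 hv))) _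
    _ = ∑ v, (vertexCost w H v - l v) := by
        rw [Finset.sum_range]
        exact Finset.sum_congr rfl fun v _ => hq v

/-- Each vertex pays at most the total weight of its own outgoing arcs. This justifies `top` as
infinity. -/
theorem IsInput.cost_le (h : IsInput L w l src dst wt lb) (hL : IsArcList G L)
    {H : Digraph (Fin n)} (hHG : H ≤ G) : cost w H ≤ ∑ e ∈ Finset.range L.length, wt e := by
  classical
  have hv : ∀ v : Fin n,
      vertexCost w H v ≤ ∑ e ∈ Finset.range L.length with src e = v, wt e := by
    intro v
    refine Finset.sup_le fun u hu => ?_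
    obtain ⟨e, he, hev, -, hew⟩ := (h.adj_iff hL).1 (hHG (Finset.mem_filter.1 hu).2)
    rw [← hew]
    exact Finset.single_le_sum (f := wt) (fun _ _ => Nat.zero_le _)
      (Finset.mem_filter.2 ⟨Finset.mem_range.2 he, hev⟩)
  calc cost w H ≤ ∑ v : Fin n, ∑ e ∈ Finset.range L.length with src e = v, wt e :=
        Finset.sum_le_sum fun v _ => hv v
    _ = ∑ v ∈ Finset.range n, ∑ e ∈ Finset.range L.length with src e = v, wt e :=
        (Finset.sum_range fun v => ∑ e ∈ Finset.range L.length with src e = v, wt e).symm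
    _ = ∑ e ∈ Finset.range L.length, wt e :=
        Finset.sum_fiberwise_of_maps_to (fun e he => by
          rw [Finset.mem_range] at he ⊢
          rw [h.src_eq e he]
          exact L[e].1.2) _

/-- Within a component the powers `l` suffice. Between components one follows the tree directed to
component `0` and then the tree directed from it. The bound `q v < top` guarantees that a covered
target is reached by an actual arc or is the own component. -/
theorem IsInput.stronglyConnected (h : IsInput L w l src dst wt lb) (hL : IsArcList G L)
    (hn : 0 < n) (hc : IsComp n (Oblig L.length src dst wt lb) c comp)
    (hW : IsCostTable n L.length c top src dst wt lb comp W) {N : ℕ} (hN : Valid c N)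
    {q : ℕ → ℕ} (hq : ∀ v < n, q v < top)
    (hcov : ∀ C < c, ∀ D < c, targets c N C / 2 ^ D % 2 = 1 →
      ∃ v < n, comp v = C ∧ W v D ≤ q v) :
    StronglyConnected (powered G w fun v => l v + q v) := by
  have hc0 : 0 < c := (Nat.zero_le _).trans_lt (hc.lt 0 hn)
  set H := powered G w fun v => l v + q v with hHdef
  have hsame : ∀ v u : Fin n, comp v = comp u → Reach H v u := by
    intro v u hvu
    obtain ⟨u', hu', hr⟩ := h.reach hL (hc.reach v v.2 u u.2 hvu)
    obtain rfl := Fin.ext hu'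
    refine ReflTransGen.mono (fun a b hab => ?_) _ _ hr
    exact ⟨hab.1, hab.2.trans (Nat.le_add_right _ _)⟩
  let K : ℕ → ℕ → Prop := fun C D => ∀ v u : Fin n, comp v = C → comp u = D → Reach H v u
  have hKrefl : ∀ C, K C C := fun C v u hv hu => hsame v u (hv.trans hu.symm)
  have hKtrans : ∀ C D E, D < c → K C D → K D E → K C E := by
    intro C D E hD h1 h2 v u hv hu
    obtain ⟨x, hx, hxD⟩ := hc.surj D hD
    exact (h1 v ⟨x, hx⟩ hv hxD).trans (h2 ⟨x, hx⟩ u hxD hu)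
  have hKmask : ∀ C < c, ∀ D < c, (N / c ^ D % c = C ∨ N / c ^ (c + C) % c = D) → K C D := by
    intro C hC D hD hCD v u hv hu
    obtain ⟨x, hx, hxC, hxW⟩ := hcov C hC D hD ((mask_digit _ hD).2 hCD)
    rcases hW.exists_arc x hx D hD (hxW.trans_lt (hq x hx)) with rfl | ⟨e, he, hes, hed, hew⟩
    · exact hsame v u (hv.trans (hxC.symm.trans hu.symm))
    · have hs := h.src_eq e he
      have hd := h.dst_eq e he
      have hvs : comp v = comp (L[e].1 : Fin n) := by rw [← hs, hes, hv, hxC]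
      have hud : comp (L[e].2 : Fin n) = comp u := by rw [← hd, hed, hu]
      refine ((hsame _ _ hvs).tail ?_).trans (hsame _ _ hud)
      refine ⟨(h.adj_iff hL).2 ⟨e, he, hs, hd, h.wt_eq e he⟩, ?_⟩
      change w _ _ ≤ l _ + q _
      rw [← h.wt_eq e he, ← h.lb_eq, ← hs, hes]
      exact hew.trans (Nat.add_le_add_left hxW _)
  have hlt : ∀ y k, N / c ^ (y + k) % c < c := fun y k => Nat.mod_lt _ hc0
  have hlt' : ∀ y, N / c ^ y % c < c := fun y => Nat.mod_lt _ hc0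
  have hp : ∀ j, ∀ x < c, K ((fun y => N / c ^ y % c)^[j] x) x := by
    intro j
    induction j with
    | zero => exact fun x _ => hKrefl x
    | succ j ih =>
      intro x hx
      rw [Function.iterate_succ_apply]
      exact hKtrans _ _ _ (hlt' x) (ih _ (hlt' x)) (hKmask _ (hlt' x) x hx (.inl rfl))
  have hq' : ∀ j, ∀ x < c, K x ((fun y => N / c ^ (c + y) % c)^[j] x) := by
    intro j
    induction j with
    | zero => exact fun x _ => hKrefl x
    | succ j ih =>
      intro x hx
      rw [Function.iterate_succ_apply]
      exact hKtrans _ _ _ (hlt' (c + x)) (hKmask x hx _ (hlt' (c + x)) (.inr rfl))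
        (ih _ (hlt' (c + x)))
  intro v u
  have h1 := hq' c (comp v) (hc.lt v v.2)
  have h2 := hp c (comp u) (hc.lt u u.2)
  rw [(hN _ (hc.lt v v.2)).2] at h1
  rw [(hN _ (hc.lt u u.2)).1] at h2
  exact hKtrans _ _ _ hc0 h1 h2 v u rfl rfl

/-- Comparison with an optimal `H`: the vertex lower bound splits its cost into the sum of `l` and
the increases, without truncation, and the increases bound `best` from above. Hence `best < top`, so
`best` is the cost of an actual pair of trees. -/
theorem IsInput.isOptimal (h : IsInput L w l src dst wt lb) (hL : IsArcList G L) (hn : 0 < n)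
    (hG : StronglyConnected G) (hl : IsVertexLowerBound G w l)
    (hc : IsComp n (Oblig L.length src dst wt lb) c comp)
    (htop : top = 1 + ∑ e ∈ Finset.range L.length, wt e)
    (hW : IsCostTable n L.length c top src dst wt lb comp W)
    (hT : IsTables n c top comp W F I T) {best N : ℕ}
    (hmin : ∀ N' < c ^ (c + c), Valid c N' → best ≤ treeCost n c comp F N')
    (hN : best < top → Valid c N ∧ best = treeCost n c comp F N) {M : ℕ → ℕ}
    (hM : ∀ C < c, M C = targets c N C) :
    IsOptimal G w (powered G w fun v => l v + increase n comp I T M v) := by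
  obtain ⟨H, hH⟩ := exists_optimal w hG
  obtain ⟨N', hN', hval', hle'⟩ := h.exists_treeCost_le hL hn hc hW hT hH.1.1 hH.1.2
  have hlH := hl H hH
  have hsum : ∑ v, l v + ∑ v, (vertexCost w H v - l v) = cost w H := by
    rw [← Finset.sum_add_distrib]
    exact Finset.sum_congr rfl fun v _ => by have := hlH v; omega
  have hbest : best ≤ ∑ v, (vertexCost w H v - l v) := (hmin N' hN' hval').trans hle'
  have hcost := h.cost_le hL hH.1.1
  have hlt : best < top := by omega
  obtain ⟨hval, hbN⟩ := hN hlt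
  have hMc : ∑ C ∈ Finset.range c, F (lastTable comp n C) (M C) = treeCost n c comp F N :=
    Finset.sum_congr rfl fun C hC => by rw [hM C (Finset.mem_range.1 hC)]
  obtain ⟨hs, hcov⟩ := hT.increase hc.lt (fun C hC => by rw [hM C hC]; exact mask_lt _ _) (M := M)
    (by rw [hMc, ← hbN]; exact hlt)
  rw [hMc] at hs
  have hq : ∀ v < n, increase n comp I T M v < top := by
    intro v hv
    have := Finset.single_le_sum (f := increase n comp I T M)
      (fun _ _ => Nat.zero_le _) (Finset.mem_range.2 hv)
    omega
  refine ⟨⟨powered_le _ _ _, h.stronglyConnected hL hn hc hW hval hq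
    fun C hC D hD hb => hcov C hC D hD (by rw [hM C hC]; exact hb)⟩, fun H' h1 h2 => ?_⟩
  refine ((cost_powered_le _ _ _).trans ?_).trans (hH.2 H' h1 h2)
  rw [Finset.sum_add_distrib, ← Finset.sum_range, hs]
  omega

end

end MinPAC

/-! ### The dynamic program -/

namespace MinPAC

open RAM DFS Relation

/-- Computes the elements of a set that remain to be covered. -/
def restLoop : Prog :=
  .instr (.const 53 0) ;;
  forUp 54 4
    (.instr (.load 56 22 54) ;;
      .ite (.eq 56 2)
        (.instr (.add 57 34 54) ;; .instr (.load 57 19 57) ;;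
          .ite (.lt 52 57) (.instr (.load 58 20 54) ;; .instr (.add 53 53 58)) .skip)
        .skip)

theorem wp_restLoop {c b x : ℕ} {s : State} (h2 : s.reg 2 = 1) (h4 : s.reg 4 = c)
    (h34 : s.reg 34 = b) (h52 : s.reg 52 = x) (hp : ∀ k < c, s.arr 20 k = 2 ^ k) :
    wp restLoop s fun s' t => t ≤ c * 9 + 3 ∧
      s'.reg 53 = mask c fun d => s.arr 22 d = 1 ∧ x < s.arr 19 (b + d) := by
  unfold restLoop
  rw [wp_seq, wp_instr]
  refine (wp_forUp (N := c) (K := 7)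
    (fun k s' => s'.reg 53 = mask k fun d => s.arr 22 d = 1 ∧ x < s.arr 19 (b + d))
    rfl (by simp [Instr.apply, h2]) (by simp [Instr.apply, h4]) (by simp [Instr.apply, mask])
    ?_).mono ?_
  · rintro k hk s₁ F₁ hI hi
    have e2 : s₁.reg 2 = 1 := by rw [F₁.reg 2 rfl]; simp [Instr.apply, h2]
    have e34 : s₁.reg 34 = b := by rw [F₁.reg 34 rfl]; simp [Instr.apply, h34]
    have e52 : s₁.reg 52 = x := by rw [F₁.reg 52 rfl]; simp [Instr.apply, h52]
    have a22 : s₁.arr 22 = s.arr 22 := by rw [F₁.arr 22 rfl]; simp [Instr.apply]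
    have a19 : s₁.arr 19 = s.arr 19 := by rw [F₁.arr 19 rfl]; simp [Instr.apply]
    have a20 : s₁.arr 20 = s.arr 20 := by rw [F₁.arr 20 rfl]; simp [Instr.apply]
    simp only [wp_seq, wp_instr, wp_ite, wp_skip, Instr.apply, Test.Holds, State.reg_setReg,
      State.arr_setReg, Nat.reduceEqDiff, if_true, if_false, hi, e2, e34, e52, a22, a19, a20,
      hp k hk, mask_succ, hI]
    refine ⟨fun h => ⟨fun h' => ⟨by norm_num, by rw [if_pos ⟨h, h'⟩]⟩,
      fun h' => ⟨by norm_num, by rw [if_neg fun hc => h' hc.2, add_zero]⟩⟩,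
      fun h => ⟨by norm_num, by rw [if_neg fun hc => h hc.1, add_zero]⟩⟩
  · rintro s' t - ⟨ht, hI⟩
    exact ⟨by omega, hI⟩

/-- Finds the best power of a vertex for a given set. -/
def levelLoop : Prog :=
  .instr (.copy 35 5) ;; .instr (.const 36 0) ;; .instr (.const 37 0) ;;
  forUp 50 4
    (.instr (.add 51 34 50) ;; .instr (.load 52 19 51) ;; restLoop ;; .instr (.add 55 33 53) ;;
      .instr (.load 55 23 55) ;; .instr (.add 55 55 52) ;;
      .ite (.lt 55 35) (.instr (.copy 35 55) ;; .instr (.copy 36 52) ;; .instr (.copy 37 53))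
        .skip)

/-- The running minimum starts at `top`; a recorded level is thus available only if the result is
smaller. -/
theorem wp_levelLoop {c b pb top : ℕ} {s : State} (h2 : s.reg 2 = 1) (h4 : s.reg 4 = c)
    (h5 : s.reg 5 = top) (h33 : s.reg 33 = pb)
    (h34 : s.reg 34 = b) (hp : ∀ k < c, s.arr 20 k = 2 ^ k) {R : ℕ → ℕ}
    (hR : ∀ j, R j = mask c fun d => s.arr 22 d = 1 ∧ s.arr 19 (b + j) < s.arr 19 (b + d)) :
    wp levelLoop s fun s' t => t ≤ c * (c * 9 + 14) + 5 ∧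
      (∀ j < c, s'.reg 35 ≤ s.arr 23 (pb + R j) + s.arr 19 (b + j)) ∧
      (s'.reg 35 < top → ∃ j < c, s'.reg 37 = R j ∧ s'.reg 36 = s.arr 19 (b + j) ∧
        s'.reg 35 = s.arr 23 (pb + s'.reg 37) + s'.reg 36) := by
  unfold levelLoop
  simp only [wp_seq, wp_instr]
  refine (wp_forUp (N := c) (K := c * 9 + 12) (fun k s' =>
      (∀ j < k, s'.reg 35 ≤ s.arr 23 (pb + R j) + s.arr 19 (b + j)) ∧
      (s'.reg 35 < top → ∃ j < c, s'.reg 37 = R j ∧ s'.reg 36 = s.arr 19 (b + j) ∧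
        s'.reg 35 = s.arr 23 (pb + s'.reg 37) + s'.reg 36))
    rfl (by simp [Instr.apply, h2]) (by simp [Instr.apply, h4]) (by simp [Instr.apply, h5])
    ?_).mono ?_
  · rintro k hk s₁ F₁ ⟨hI, hJ⟩ hi
    have e2 : s₁.reg 2 = 1 := by rw [F₁.reg 2 rfl]; simp [Instr.apply, h2]
    have e4 : s₁.reg 4 = c := by rw [F₁.reg 4 rfl]; simp [Instr.apply, h4]
    have e33 : s₁.reg 33 = pb := by rw [F₁.reg 33 rfl]; simp [Instr.apply, h33]
    have e34 : s₁.reg 34 = b := by rw [F₁.reg 34 rfl]; simp [Instr.apply, h34]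
    have a22 : s₁.arr 22 = s.arr 22 := by rw [F₁.arr 22 rfl]; simp [Instr.apply]
    have a19 : s₁.arr 19 = s.arr 19 := by rw [F₁.arr 19 rfl]; simp [Instr.apply]
    have a20 : s₁.arr 20 = s.arr 20 := by rw [F₁.arr 20 rfl]; simp [Instr.apply]
    have a23 : s₁.arr 23 = s.arr 23 := by rw [F₁.arr 23 rfl]; simp [Instr.apply]
    rw [wp_seq, wp_instr, wp_seq, wp_instr]
    refine (wp_restLoop (c := c) (b := b) (x := s.arr 19 (b + k)) (by simp [Instr.apply, e2])
      (by simp [Instr.apply, e4]) (by simp [Instr.apply, e34])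
      (by simp [Instr.apply, e34, hi, a19]) (by simpa [Instr.apply, a20] using hp)).seq ?_
    rintro s₂ t₂ F₂ ⟨ht₂, hI₂⟩
    simp only [Instr.apply, State.arr_setReg, a22, a19, ← hR] at hI₂
    have f33 : s₂.reg 33 = pb := by rw [F₂.reg 33 rfl]; simp [Instr.apply, e33]
    have f35 : s₂.reg 35 = s₁.reg 35 := by rw [F₂.reg 35 rfl]; simp [Instr.apply]
    have f36 : s₂.reg 36 = s₁.reg 36 := by rw [F₂.reg 36 rfl]; simp [Instr.apply]
    have f37 : s₂.reg 37 = s₁.reg 37 := by rw [F₂.reg 37 rfl]; simp [Instr.apply]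
    have f52 : s₂.reg 52 = s.arr 19 (b + k) := by
      rw [F₂.reg 52 rfl]; simp [Instr.apply, e34, hi, a19]
    have b23 : s₂.arr 23 = s.arr 23 := by rw [F₂.arr 23 rfl]; simp [Instr.apply, a23]
    simp only [wp_seq, wp_instr, wp_ite, wp_skip, Instr.apply, Test.Holds, State.reg_setReg,
      State.arr_setReg, Nat.reduceEqDiff, if_true, if_false, hI₂, f33, f35, f36, f37, f52, b23]
    constructor
    · intro hlt
      refine ⟨by omega, fun j hj => ?_, fun _ => ⟨k, hk, by simp⟩⟩
      rcases Nat.lt_succ_iff_lt_or_eq.1 hj with h | rfl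
      · exact hlt.le.trans (hI j h)
      · exact le_rfl
    · intro hlt
      refine ⟨by omega, fun j hj => ?_, hJ⟩
      rcases Nat.lt_succ_iff_lt_or_eq.1 hj with h | rfl
      · exact hI j h
      · exact not_lt.1 hlt
  · rintro s' t - ⟨ht, hI⟩
    have : c * (c * 9 + 12 + 2) = c * (c * 9 + 14) := by ring
    exact ⟨by omega, hI⟩

/-- Computes the table of a vertex. -/
def setLoop : Prog :=
  forUp 40 6
    (digits 20 4 ;; levelLoop ;; .instr (.add 38 30 40) ;; .instr (.store 23 38 35) ;;
      .instr (.store 24 38 36) ;; .instr (.store 25 38 37))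

/-- The new table begins at `base`, the previous one of the same component at `pb`. By `hb` they do
not overlap, so the old entries can be read while the new ones are written. -/
theorem wp_setLoop {c v base pb top : ℕ} {W : ℕ → ℕ → ℕ} {s : State} (h2 : s.reg 2 = 1)
    (h4 : s.reg 4 = c) (h5 : s.reg 5 = top) (h6 : s.reg 6 = 2 ^ c) (h30 : s.reg 30 = base)
    (h33 : s.reg 33 = pb) (h34 : s.reg 34 = v * c) (hp : ∀ k < c, s.arr 20 k = 2 ^ k)
    (hW : ∀ v d, W v d = s.arr 19 (v * c + d)) (hb : pb + 2 ^ c ≤ base) :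
    wp setLoop s fun s' t => t ≤ 2 ^ c * (9 * c ^ 2 + 31 * c + 14) + 2 ∧
      (∀ x < base, s'.arr 23 x = s.arr 23 x) ∧ (∀ x < base, s'.arr 24 x = s.arr 24 x) ∧
      (∀ x < base, s'.arr 25 x = s.arr 25 x) ∧
      ∀ S < 2 ^ c, (∀ j < c, s'.arr 23 (base + S) ≤ s.arr 23 (pb + rest c W v S j) + W v j) ∧
        (s'.arr 23 (base + S) < top → ∃ j < c, s'.arr 25 (base + S) = rest c W v S j ∧
          s'.arr 24 (base + S) = W v j ∧
          s'.arr 23 (base + S) = s.arr 23 (pb + s'.arr 25 (base + S)) +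
            s'.arr 24 (base + S)) := by
  unfold setLoop
  refine (wp_forUp (N := 2 ^ c) (K := 9 * c ^ 2 + 31 * c + 12) (fun k s' =>
      (∀ x < base, s'.arr 23 x = s.arr 23 x) ∧ (∀ x < base, s'.arr 24 x = s.arr 24 x) ∧
      (∀ x < base, s'.arr 25 x = s.arr 25 x) ∧
      ∀ S < k, (∀ j < c, s'.arr 23 (base + S) ≤ s.arr 23 (pb + rest c W v S j) + W v j) ∧
        (s'.arr 23 (base + S) < top → ∃ j < c, s'.arr 25 (base + S) = rest c W v S j ∧
          s'.arr 24 (base + S) = W v j ∧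
          s'.arr 23 (base + S) = s.arr 23 (pb + s'.arr 25 (base + S)) +
            s'.arr 24 (base + S)))
    rfl h2 h6 (by simp) ?_)
  rintro k hk s₁ F₁ ⟨h23, h24, h25, hI⟩ hi
  have e2 : s₁.reg 2 = 1 := (F₁.reg 2 rfl).trans h2
  have e4 : s₁.reg 4 = c := (F₁.reg 4 rfl).trans h4
  have e5 : s₁.reg 5 = top := (F₁.reg 5 rfl).trans h5
  have e30 : s₁.reg 30 = base := (F₁.reg 30 rfl).trans h30
  have e33 : s₁.reg 33 = pb := (F₁.reg 33 rfl).trans h33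
  have e34 : s₁.reg 34 = v * c := (F₁.reg 34 rfl).trans h34
  have a19 : s₁.arr 19 = s.arr 19 := F₁.arr 19 rfl
  have a20 : s₁.arr 20 = s.arr 20 := F₁.arr 20 rfl
  refine (wp_digits (B := 2) (R := c) (N := k) (by norm_num) (by norm_num) e2 e4 hi hk
    (by rw [a20]; exact hp)).seq ?_
  rintro s₂ t₂ F₂ ⟨ht₂, hd⟩
  have b19 : s₂.arr 19 = s.arr 19 := (F₂.arr 19 rfl).trans a19
  have b20 : s₂.arr 20 = s.arr 20 := (F₂.arr 20 rfl).trans a20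
  have b23 : s₂.arr 23 = s₁.arr 23 := F₂.arr 23 rfl
  refine (wp_levelLoop (c := c) (b := v * c) (pb := pb) (top := top) (R := rest c W v k)
    ((F₂.reg 2 rfl).trans e2) ((F₂.reg 4 rfl).trans e4) ((F₂.reg 5 rfl).trans e5)
    ((F₂.reg 33 rfl).trans e33) ((F₂.reg 34 rfl).trans e34) (by rw [b20]; exact hp) ?_).seq ?_
  · intro j
    rw [b19]
    exact mask_congr fun d hd' => by rw [hd d hd', hW, hW]
  rintro s₃ t₃ F₃ ⟨ht₃, hle, heq⟩
  have hle' : ∀ j < c, s₃.reg 35 ≤ s.arr 23 (pb + rest c W v k j) + W v j := by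
    intro j hj
    have := hle j hj
    rwa [b23, b19, ← hW, h23 _ (by have := rest_lt c W v k j; omega)] at this
  have heq' : s₃.reg 35 < top → ∃ j < c, s₃.reg 37 = rest c W v k j ∧ s₃.reg 36 = W v j ∧
        s₃.reg 35 = s.arr 23 (pb + s₃.reg 37) + s₃.reg 36 := by
    intro hlt
    obtain ⟨j, hj, h37, h36, h35⟩ := heq hlt
    refine ⟨j, hj, h37, by rw [h36, b19, hW], ?_⟩
    rwa [b23, h23 _ (by rw [h37]; have := rest_lt c W v k j; omega)] at h35
  have f30 : s₃.reg 30 = base := by rw [F₃.reg 30 rfl, F₂.reg 30 rfl, e30]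
  have f40 : s₃.reg 40 = k := by rw [F₃.reg 40 rfl, F₂.reg 40 rfl, hi]
  have c23 : s₃.arr 23 = s₁.arr 23 := by rw [F₃.arr 23 rfl, b23]
  have c24 : s₃.arr 24 = s₁.arr 24 := by rw [F₃.arr 24 rfl, F₂.arr 24 rfl]
  have c25 : s₃.arr 25 = s₁.arr 25 := by rw [F₃.arr 25 rfl, F₂.arr 25 rfl]
  simp only [wp_seq, wp_instr, Instr.apply, State.reg_setReg, State.arr_setReg, State.reg_setArr,
    State.arr_setArr, Nat.reduceEqDiff, if_true, if_false, f30, f40, c23, c24, c25]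
  have hne : ∀ x < base, x ≠ base + k := by omega
  refine ⟨?_, fun x hx => ?_, fun x hx => ?_, fun x hx => ?_, fun S hS => ?_⟩
  · have : c * (c * 9 + 14) = 9 * c ^ 2 + 14 * c := by ring
    omega
  · rw [Function.update_of_ne (hne x hx), h23 x hx]
  · rw [Function.update_of_ne (hne x hx), h24 x hx]
  · rw [Function.update_of_ne (hne x hx), h25 x hx]
  · by_cases hSk : S = k
    · subst hSk
      simp only [Function.update_self]
      exact ⟨hle', heq'⟩
    · have : base + S ≠ base + k := by omega
      simp only [Function.update_of_ne this]
      exact hI S (by omega)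

/-- Computes all tables. -/
def tables : Prog :=
  .instr (.const 9 2) ;; powers 20 9 4 ;; .instr (.load 6 20 4) ;;
  forUp 10 6 (.instr (.store 23 10 5)) ;; .instr (.store 23 3 3) ;; .instr (.const 30 0) ;;
  forUp 31 0
    (.instr (.load 32 17 31) ;; .instr (.load 33 26 32) ;; .instr (.add 30 30 6) ;;
      .instr (.store 26 32 30) ;; .instr (.load 34 18 31) ;; setLoop)

/-- Table `t` occupies the cells from `t * 2 ^ c` on, and array `26` holds the offset of the latest
table of each component. Its initial zeros point to table `0`, which is shared by all components. -/
theorem wp_tables {n c top : ℕ} {comp : ℕ → ℕ} {W : ℕ → ℕ → ℕ} {s : State} (h0 : s.reg 0 = n)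
    (h2 : s.reg 2 = 1) (h3 : s.reg 3 = 0) (h4 : s.reg 4 = c) (h5 : s.reg 5 = top)
    (h17 : s.arr 17 = comp) (h18 : ∀ v < n, s.arr 18 v = v * c)
    (hW : ∀ v d, W v d = s.arr 19 (v * c + d)) (h26 : ∀ C, s.arr 26 C = 0) :
    wp tables s fun s' t =>
      t ≤ c * 14 + 20 + 2 ^ c * 3 + n * (2 ^ c * (9 * c ^ 2 + 31 * c + 14) + 9) ∧
      s'.reg 6 = 2 ^ c ∧ (∀ k < c, s'.arr 20 k = 2 ^ k) ∧ s'.reg 30 = n * 2 ^ c ∧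
      (∀ C, s'.arr 26 C = lastTable comp n C * 2 ^ c) ∧
      IsTables n c top comp W (fun t S => s'.arr 23 (t * 2 ^ c + S))
        (fun t S => s'.arr 24 (t * 2 ^ c + S)) (fun t S => s'.arr 25 (t * 2 ^ c + S)) := by
  unfold tables
  rw [wp_seq, wp_instr]
  refine (wp_powers (B := 2) (R := c) (by norm_num) (by norm_num) (by simp [Instr.apply, h2])
    (by simp [Instr.apply, h3]) (by simp [Instr.apply]) (by simp [Instr.apply, h4])).seq ?_
  rintro s₁ t₁ F₁ ⟨ht₁, hp⟩
  have e0 : s₁.reg 0 = n := by rw [F₁.reg 0 rfl]; simp [Instr.apply, h0]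
  have e2 : s₁.reg 2 = 1 := by rw [F₁.reg 2 rfl]; simp [Instr.apply, h2]
  have e3 : s₁.reg 3 = 0 := by rw [F₁.reg 3 rfl]; simp [Instr.apply, h3]
  have e4 : s₁.reg 4 = c := by rw [F₁.reg 4 rfl]; simp [Instr.apply, h4]
  have e5 : s₁.reg 5 = top := by rw [F₁.reg 5 rfl]; simp [Instr.apply, h5]
  rw [wp_seq, wp_instr]
  refine (wp_forUp (N := 2 ^ c) (K := 1) (fun k s' => ∀ S < k, s'.arr 23 S = top)
    rfl (by simp [Instr.apply, e2]) (by simp [Instr.apply, e4, hp]) (by simp) ?_).seq ?_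
  · rintro k - s₂ F₂ hI hi
    have f5 : s₂.reg 5 = top := by rw [F₂.reg 5 rfl]; simp [Instr.apply, e5]
    simp only [wp_instr, Instr.apply, State.arr_setReg, State.arr_setArr, if_true, hi, f5]
    refine ⟨le_rfl, fun S hS => ?_⟩
    by_cases hSk : S = k
    · simp [hSk]
    · rw [Function.update_of_ne hSk]
      exact hI S (by omega)
  rintro s₂ t₂ F₂ ⟨ht₂, hI₂⟩
  have f0 : s₂.reg 0 = n := by rw [F₂.reg 0 rfl]; simp [Instr.apply, e0]
  have f2 : s₂.reg 2 = 1 := by rw [F₂.reg 2 rfl]; simp [Instr.apply, e2]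
  have f3 : s₂.reg 3 = 0 := by rw [F₂.reg 3 rfl]; simp [Instr.apply, e3]
  have f4 : s₂.reg 4 = c := by rw [F₂.reg 4 rfl]; simp [Instr.apply, e4]
  have f5 : s₂.reg 5 = top := by rw [F₂.reg 5 rfl]; simp [Instr.apply, e5]
  have f6 : s₂.reg 6 = 2 ^ c := by rw [F₂.reg 6 rfl]; simp [Instr.apply, e4, hp]
  have a17 : s₂.arr 17 = comp := by
    rw [F₂.arr 17 rfl, ← h17]; simpa [Instr.apply] using F₁.arr 17 rfl
  have a18 : s₂.arr 18 = s.arr 18 := by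
    rw [F₂.arr 18 rfl]; simpa [Instr.apply] using F₁.arr 18 rfl
  have a19 : s₂.arr 19 = s.arr 19 := by
    rw [F₂.arr 19 rfl]; simpa [Instr.apply] using F₁.arr 19 rfl
  have a26 : s₂.arr 26 = s.arr 26 := by
    rw [F₂.arr 26 rfl]; simpa [Instr.apply] using F₁.arr 26 rfl
  have a20 : ∀ k ≤ c, s₂.arr 20 k = 2 ^ k := by
    rw [F₂.arr 20 rfl]; simpa [Instr.apply] using hp
  rw [wp_seq, wp_instr, wp_seq, wp_instr]
  refine (wp_forUp (N := n) (K := 2 ^ c * (9 * c ^ 2 + 31 * c + 14) + 7) (fun k s' =>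
      s'.reg 30 = k * 2 ^ c ∧ (∀ C, s'.arr 26 C = lastTable comp k C * 2 ^ c) ∧
      IsTables k c top comp W (fun t S => s'.arr 23 (t * 2 ^ c + S))
        (fun t S => s'.arr 24 (t * 2 ^ c + S)) (fun t S => s'.arr 25 (t * 2 ^ c + S)))
    rfl (by simp [Instr.apply, f2]) (by simp [Instr.apply, f0]) ?_ ?_).mono ?_
  · simp only [Instr.apply, State.reg_setReg, State.arr_setReg, State.arr_setArr, State.reg_setArr,
      Nat.reduceEqDiff, if_true, if_false, f3, a26, h26, lastTable, zero_mul, zero_add,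
      implies_true, true_and]
    refine ⟨fun S hS => ?_, by omega, by omega⟩
    rw [zero_mul, zero_add]
    by_cases hS0 : S = 0
    · simp [hS0]
    · rw [Function.update_of_ne hS0, if_neg hS0, hI₂ S hS]
  · rintro k hk s₃ F₃ ⟨h30, h26', hT⟩ hi
    have g2 : s₃.reg 2 = 1 := by rw [F₃.reg 2 rfl]; simp [Instr.apply, f2]
    have g4 : s₃.reg 4 = c := by rw [F₃.reg 4 rfl]; simp [Instr.apply, f4]
    have g5 : s₃.reg 5 = top := by rw [F₃.reg 5 rfl]; simp [Instr.apply, f5]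
    have g6 : s₃.reg 6 = 2 ^ c := by rw [F₃.reg 6 rfl]; simp [Instr.apply, f6]
    have b17 : s₃.arr 17 = comp := by rw [F₃.arr 17 rfl]; simp [Instr.apply, a17]
    have b18 : s₃.arr 18 = s.arr 18 := by rw [F₃.arr 18 rfl]; simp [Instr.apply, a18]
    have b19 : s₃.arr 19 = s.arr 19 := by rw [F₃.arr 19 rfl]; simp [Instr.apply, a19]
    have b20 : s₃.arr 20 = s₂.arr 20 := by rw [F₃.arr 20 rfl]; simp [Instr.apply]
    have hlast := lastTable_le (comp := comp) k (comp k)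
    have hb : lastTable comp k (comp k) * 2 ^ c + 2 ^ c ≤ k * 2 ^ c + 2 ^ c := by
      have := Nat.mul_le_mul_right (2 ^ c) hlast
      omega
    simp only [wp_seq, wp_instr]
    refine (wp_setLoop (c := c) (v := k) (base := k * 2 ^ c + 2 ^ c)
      (pb := lastTable comp k (comp k) * 2 ^ c) (top := top) (W := W) ?_ ?_ ?_ ?_ ?_ ?_ ?_ ?_ ?_
      hb).mono ?_
    · simp [Instr.apply, g2]
    · simp [Instr.apply, g4]
    · simp [Instr.apply, g5]
    · simp [Instr.apply, g6]
    · simp [Instr.apply, g6, h30]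
    · simp [Instr.apply, hi, b17, h26']
    · simp [Instr.apply, hi, b18, h18 k hk]
    · simp only [Instr.apply, State.arr_setReg, State.arr_setArr, Nat.reduceEqDiff, if_false, b20]
      exact fun j hj => a20 j hj.le
    · simpa [Instr.apply, b19] using hW
    rintro s₄ t₄ F₄ ⟨ht₄, q23, q24, q25, hS⟩
    simp only [Instr.apply, State.reg_setReg, State.arr_setReg, State.arr_setArr, State.reg_setArr,
      Nat.reduceEqDiff, if_true, if_false] at q23 q24 q25 hS ⊢
    have k30 : s₄.reg 30 = k * 2 ^ c + 2 ^ c := by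
      rw [F₄.reg 30 rfl]; simp [Instr.apply, h30, g6]
    have k26 : s₄.arr 26 = Function.update (s₃.arr 26) (comp k) (k * 2 ^ c + 2 ^ c) := by
      rw [F₄.arr 26 rfl]; simp [Instr.apply, h30, g6, hi, b17]
    have hidx : ∀ t ≤ k, ∀ S < 2 ^ c, t * 2 ^ c + S < k * 2 ^ c + 2 ^ c := by
      intro t ht S hS
      have := Nat.mul_le_mul_right (2 ^ c) ht
      omega
    have hbase : ∀ S, (k + 1) * 2 ^ c + S = k * 2 ^ c + 2 ^ c + S := by
      intro S; ring
    refine ⟨by omega, by rw [k30]; ring, fun C => ?_, ?_⟩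
    · rw [k26, lastTable]
      by_cases hC : C = comp k
      · subst hC
        rw [Function.update_self, if_pos rfl]
        ring
      · rw [Function.update_of_ne hC, if_neg (Ne.symm hC), h26']
    · refine hT.succ (fun t ht S hS => q23 _ (hidx t ht S hS))
        (fun t ht S hS => q24 _ (hidx t ht S hS)) (fun t ht S hS => q25 _ (hidx t ht S hS))
        (fun S hS' j hj => ?_) (fun S hS' hlt => ?_)
      · rw [hbase]
        exact (hS S hS').1 j hj
      · simp only [hbase] at hlt ⊢
        exact (hS S hS').2 hlt
  · rintro s₄ t₄ F₄ ⟨ht₄, h30, h26', hT⟩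
    have k6 : s₄.reg 6 = 2 ^ c := by rw [F₄.reg 6 rfl]; simp [Instr.apply, f6]
    have k20 : s₄.arr 20 = s₂.arr 20 := by rw [F₄.arr 20 rfl]; simp [Instr.apply]
    refine ⟨?_, k6, fun k hk => by rw [k20, a20 k hk.le], h30, h26', hT⟩
    have : n * (2 ^ c * (9 * c ^ 2 + 31 * c + 14) + 7 + 2) =
      n * (2 ^ c * (9 * c ^ 2 + 31 * c + 14) + 9) := by ring
    omega

end MinPAC

/-! ### Enumeration of the trees and output -/

namespace MinPAC

open RAM DFS Relation

/-- Tests whether the digits in array `22` code two trees. -/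
def checkTrees : Prog :=
  .instr (.copy 60 2) ;;
  forUp 61 4
    (.instr (.copy 62 61) ;; .instr (.copy 63 61) ;;
      forUp 64 4 (.instr (.load 62 22 62) ;; .instr (.add 63 63 4) ;; .instr (.load 63 22 63)) ;;
      .ite (.eq 62 3) .skip (.instr (.const 60 0)) ;;
      .ite (.eq 63 3) .skip (.instr (.const 60 0)))

theorem wp_checkTrees {c N : ℕ} {s : State} (hc : 0 < c) (h2 : s.reg 2 = 1) (h3 : s.reg 3 = 0)
    (h4 : s.reg 4 = c) (hd : ∀ k < c + c, s.arr 22 k = N / c ^ k % c) :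
    wp checkTrees s fun s' t => t ≤ c * (c * 5 + 12) + 3 ∧ (s'.reg 60 = 1 ↔ Valid c N) := by
  unfold checkTrees
  rw [wp_seq, wp_instr]
  refine (wp_forUp (N := c) (K := c * 5 + 10) (fun k s' => (s'.reg 60 = 1 ↔
      ∀ x < k, (fun y => N / c ^ y % c)^[c] x = 0 ∧ (fun y => N / c ^ (c + y) % c)^[c] x = 0))
    rfl (by simp [Instr.apply, h2]) (by simp [Instr.apply, h4]) (by simp [Instr.apply, h2])
    ?_).mono ?_
  · rintro k hk s₁ F₁ hI hi
    have e2 : s₁.reg 2 = 1 := by rw [F₁.reg 2 rfl]; simp [Instr.apply, h2]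
    have e3 : s₁.reg 3 = 0 := by rw [F₁.reg 3 rfl]; simp [Instr.apply, h3]
    have e4 : s₁.reg 4 = c := by rw [F₁.reg 4 rfl]; simp [Instr.apply, h4]
    have a22 : s₁.arr 22 = s.arr 22 := by rw [F₁.arr 22 rfl]; simp [Instr.apply]
    have hlt : ∀ y, N / c ^ y % c < c := fun y => Nat.mod_lt _ hc
    -- The iterates stay below `c`, so only the `c + c` computed digits are ever read.
    have hit : ∀ j, (fun y => N / c ^ y % c)^[j] k < c ∧
        (fun y => N / c ^ (c + y) % c)^[j] k < c := by
      intro j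
      cases j with
      | zero => exact ⟨hk, hk⟩
      | succ j =>
        rw [Function.iterate_succ_apply', Function.iterate_succ_apply']
        exact ⟨hlt _, hlt _⟩
    rw [wp_seq, wp_instr, wp_seq, wp_instr]
    refine (wp_forUp (N := c) (K := 3) (fun j s' =>
      s'.reg 62 = (fun y => N / c ^ y % c)^[j] k ∧ s'.reg 63 = (fun y => N / c ^ (c + y) % c)^[j] k)
      rfl (by simp [Instr.apply, e2]) (by simp [Instr.apply, e4]) (by simp [Instr.apply, hi])
      ?_).seq ?_
    · rintro j hj s₂ F₂ ⟨h62, h63⟩ -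
      have f4 : s₂.reg 4 = c := by rw [F₂.reg 4 rfl]; simp [Instr.apply, e4]
      have b22 : s₂.arr 22 = s.arr 22 := by rw [F₂.arr 22 rfl]; simp [Instr.apply, a22]
      have hj1 := (hit j).1
      have hj2 := (hit j).2
      simp only [wp_seq, wp_instr, Instr.apply, State.reg_setReg, State.arr_setReg,
        Nat.reduceEqDiff, if_true, if_false, f4, b22, h62, h63, Function.iterate_succ_apply']
      refine ⟨by norm_num, ?_, ?_⟩
      · exact hd _ (by omega)
      · rw [add_comm]
        exact hd _ (by omega)
    rintro s₂ t₂ F₂ ⟨ht₂, h62, h63⟩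
    have f3 : s₂.reg 3 = 0 := by rw [F₂.reg 3 rfl]; simp [Instr.apply, e3]
    have f60 : s₂.reg 60 = s₁.reg 60 := by rw [F₂.reg 60 rfl]; simp [Instr.apply]
    have hsucc : (∀ x < k + 1, (fun y => N / c ^ y % c)^[c] x = 0 ∧
          (fun y => N / c ^ (c + y) % c)^[c] x = 0) ↔
        s₁.reg 60 = 1 ∧ s₂.reg 62 = 0 ∧ s₂.reg 63 = 0 := by
      rw [hI, h62, h63]
      constructor
      · exact fun h => ⟨fun x hx => h x (by omega), h k (by omega)⟩
      · intro h x hx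
        rcases Nat.lt_succ_iff_lt_or_eq.1 hx with hx | rfl
        · exact h.1 x hx
        · exact h.2
    simp only [wp_seq, wp_instr, wp_ite, wp_skip, Instr.apply, Test.Holds, State.reg_setReg,
      Nat.reduceEqDiff, if_true, if_false, f3, f60, hsucc]
    refine ⟨fun h => ⟨fun h' => ⟨by omega, by simp [h, h']⟩, fun h' => ⟨by omega, by simp [h']⟩⟩,
      fun h => ⟨fun h' => ⟨by omega, by simp [h]⟩, fun h' => ⟨by omega, by simp [h]⟩⟩⟩
  · rintro s' t - ⟨ht, hI⟩
    have : c * (c * 5 + 10 + 2) = c * (c * 5 + 12) := by ring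
    exact ⟨by omega, hI⟩

/-- Computes the cost of the trees coded by the digits in array `22`. -/
def sumTrees : Prog :=
  .instr (.copy 65 3) ;;
  forUp 66 4
    (.instr (.add 67 66 4) ;; .instr (.load 67 22 67) ;; .instr (.copy 68 3) ;;
      forUp 69 4
        (.instr (.load 70 22 69) ;;
          .ite (.eq 70 66) (.instr (.load 71 20 69) ;; .instr (.add 68 68 71))
            (.ite (.eq 67 69) (.instr (.load 71 20 69) ;; .instr (.add 68 68 71)) .skip)) ;;
      .instr (.store 27 66 68) ;; .instr (.load 72 26 66) ;; .instr (.add 72 72 68) ;;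
      .instr (.load 72 23 72) ;; .instr (.add 65 65 72))

theorem wp_sumTrees {n c N : ℕ} {comp : ℕ → ℕ} {s : State} (h2 : s.reg 2 = 1)
    (h3 : s.reg 3 = 0) (h4 : s.reg 4 = c) (hd : ∀ k < c + c, s.arr 22 k = N / c ^ k % c)
    (hp : ∀ k < c, s.arr 20 k = 2 ^ k)
    (h26 : ∀ C, s.arr 26 C = lastTable comp n C * 2 ^ c) :
    wp sumTrees s fun s' t => t ≤ c * (c * 7 + 12) + 3 ∧
      s'.reg 65 = treeCost n c comp (fun t S => s.arr 23 (t * 2 ^ c + S)) N ∧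
      ∀ C < c, s'.arr 27 C = targets c N C := by
  unfold sumTrees
  rw [wp_seq, wp_instr]
  refine (wp_forUp (N := c) (K := c * 7 + 10) (fun k s' =>
      s'.reg 65 = ∑ C ∈ Finset.range k, s.arr 23 (lastTable comp n C * 2 ^ c + targets c N C) ∧
      ∀ C < k, s'.arr 27 C = targets c N C)
    rfl (by simp [Instr.apply, h2]) (by simp [Instr.apply, h4]) (by simp [Instr.apply, h3])
    ?_).mono ?_
  · rintro k hk s₁ F₁ ⟨hI, hJ⟩ hi
    have e2 : s₁.reg 2 = 1 := by rw [F₁.reg 2 rfl]; simp [Instr.apply, h2]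
    have e3 : s₁.reg 3 = 0 := by rw [F₁.reg 3 rfl]; simp [Instr.apply, h3]
    have e4 : s₁.reg 4 = c := by rw [F₁.reg 4 rfl]; simp [Instr.apply, h4]
    have a22 : s₁.arr 22 = s.arr 22 := by rw [F₁.arr 22 rfl]; simp [Instr.apply]
    have a20 : s₁.arr 20 = s.arr 20 := by rw [F₁.arr 20 rfl]; simp [Instr.apply]
    have a23 : s₁.arr 23 = s.arr 23 := by rw [F₁.arr 23 rfl]; simp [Instr.apply]
    have a26 : s₁.arr 26 = s.arr 26 := by rw [F₁.arr 26 rfl]; simp [Instr.apply]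
    rw [wp_seq, wp_instr, wp_seq, wp_instr, wp_seq, wp_instr]
    refine (wp_forUp (N := c) (K := 5) (fun j s' =>
      s'.reg 68 = mask j fun D => N / c ^ D % c = k ∨ N / c ^ (c + k) % c = D)
      rfl (by simp [Instr.apply, e2]) (by simp [Instr.apply, e4])
      (by simp [Instr.apply, e3, mask]) ?_).seq ?_
    · rintro j hj s₂ F₂ h68 hj'
      have f66 : s₂.reg 66 = k := by rw [F₂.reg 66 rfl]; simp [Instr.apply, hi]
      have f67 : s₂.reg 67 = N / c ^ (c + k) % c := by
        rw [F₂.reg 67 rfl]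
        simp only [Instr.apply, State.reg_setReg, State.arr_setReg, Nat.reduceEqDiff, if_true,
          if_false, hi, e4, a22, add_comm k c]
        exact hd _ (by omega)
      have b22 : s₂.arr 22 = s.arr 22 := by rw [F₂.arr 22 rfl]; simp [Instr.apply, a22]
      have b20 : s₂.arr 20 = s.arr 20 := by rw [F₂.arr 20 rfl]; simp [Instr.apply, a20]
      simp only [wp_seq, wp_instr, wp_ite, wp_skip, Instr.apply, Test.Holds, State.reg_setReg,
        State.arr_setReg, Nat.reduceEqDiff, if_true, if_false, f66, f67, b22, b20, h68, hj',
        hd j (by omega), hp j hj, mask_succ]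
      -- The second test is reached only if the first one fails, so a target required by both trees
      -- is counted once.
      refine ⟨fun h => ⟨by norm_num, by rw [if_pos (.inl h)]⟩,
        fun h => ⟨fun h' => ⟨by norm_num, by rw [if_pos (.inr h')]⟩,
          fun h' => ⟨by norm_num, by rw [if_neg (not_or.2 ⟨h, h'⟩), add_zero]⟩⟩⟩
    rintro s₂ t₂ F₂ ⟨ht₂, h68⟩
    have f66 : s₂.reg 66 = k := by rw [F₂.reg 66 rfl]; simp [Instr.apply, hi]
    have f65 : s₂.reg 65 = s₁.reg 65 := by rw [F₂.reg 65 rfl]; simp [Instr.apply]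
    have b23 : s₂.arr 23 = s.arr 23 := by rw [F₂.arr 23 rfl]; simp [Instr.apply, a23]
    have b26 : s₂.arr 26 = s.arr 26 := by rw [F₂.arr 26 rfl]; simp [Instr.apply, a26]
    have b27 : s₂.arr 27 = s₁.arr 27 := by rw [F₂.arr 27 rfl]; simp [Instr.apply]
    change _ = targets c N k at h68
    simp only [wp_seq, wp_instr, Instr.apply, State.reg_setReg, State.arr_setReg, State.reg_setArr,
      State.arr_setArr, Nat.reduceEqDiff, if_true, if_false, f66, f65, b23, b26, b27, h68, h26, hI,
      Finset.sum_range_succ, true_and]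
    refine ⟨by omega, fun C hC => ?_⟩
    by_cases hCk : C = k
    · simp [hCk]
    · rw [Function.update_of_ne hCk]
      exact hJ C (by omega)
  · rintro s' t - ⟨ht, hI, hJ⟩
    have : c * (c * 7 + 10 + 2) = c * (c * 7 + 12) := by ring
    exact ⟨by omega, hI, hJ⟩

/-- Evaluates the pair of trees coded by the number in register `40`. -/
def evalTrees : Prog := digits 21 7 ;; checkTrees ;; sumTrees

theorem wp_evalTrees {n c N : ℕ} {comp : ℕ → ℕ} {s : State} (hc : 0 < c) (h2 : s.reg 2 = 1)
    (h3 : s.reg 3 = 0) (h4 : s.reg 4 = c) (h7 : s.reg 7 = c + c) (h40 : s.reg 40 = N)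
    (hN : N < c ^ (c + c)) (hpc : ∀ k < c + c, s.arr 21 k = c ^ k)
    (hp : ∀ k < c, s.arr 20 k = 2 ^ k) (h26 : ∀ C, s.arr 26 C = lastTable comp n C * 2 ^ c) :
    wp evalTrees s fun s' t => t ≤ 20 * c ^ 2 + 42 * c + 9 ∧ (s'.reg 60 = 1 ↔ Valid c N) ∧
      s'.reg 65 = treeCost n c comp (fun t S => s.arr 23 (t * 2 ^ c + S)) N ∧
      ∀ C < c, s'.arr 27 C = targets c N C := by
  unfold evalTrees
  refine (wp_digits (B := c) (R := c + c) (by norm_num) (by norm_num) h2 h7 h40 hN hpc).seq ?_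
  rintro s₁ t₁ F₁ ⟨ht₁, hd⟩
  refine (wp_checkTrees hc ((F₁.reg 2 rfl).trans h2) ((F₁.reg 3 rfl).trans h3)
    ((F₁.reg 4 rfl).trans h4) hd).seq ?_
  rintro s₂ t₂ F₂ ⟨ht₂, hv⟩
  refine (wp_sumTrees (n := n) (comp := comp) (N := N)
    ((F₂.reg 2 rfl).trans ((F₁.reg 2 rfl).trans h2))
    ((F₂.reg 3 rfl).trans ((F₁.reg 3 rfl).trans h3))
    ((F₂.reg 4 rfl).trans ((F₁.reg 4 rfl).trans h4))
    (by rw [F₂.arr 22 rfl]; exact hd) (by rw [F₂.arr 20 rfl, F₁.arr 20 rfl]; exact hp)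
    (by rw [F₂.arr 26 rfl, F₁.arr 26 rfl]; exact h26)).mono ?_
  rintro s₃ t₃ F₃ ⟨ht₃, h65, h27⟩
  rw [F₂.arr 23 rfl, F₁.arr 23 rfl] at h65
  refine ⟨?_, by rw [F₃.reg 60 rfl]; exact hv, h65, h27⟩
  have e1 : (c + c) * (4 * c + 9) = 8 * c ^ 2 + 18 * c := by ring
  have e2 : c * (c * 5 + 12) = 5 * c ^ 2 + 12 * c := by ring
  have e3 : c * (c * 7 + 12) = 7 * c ^ 2 + 12 * c := by ring
  omega

/-- Finds the best pair of trees. -/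
def bestTrees : Prog :=
  .instr (.add 7 4 4) ;; powers 21 4 7 ;; .instr (.load 8 21 7) ;;
  .instr (.copy 73 5) ;; .instr (.copy 74 3) ;;
  forUp 75 8
    (.instr (.copy 40 75) ;; evalTrees ;;
      .ite (.eq 60 2)
        (.ite (.lt 65 73) (.instr (.copy 73 65) ;; .instr (.copy 74 75)) .skip) .skip) ;;
  .instr (.copy 40 74) ;; evalTrees

/-- Every evaluation overwrites the target sets in array `27`, so the best code is evaluated once
more at the end. -/
theorem wp_bestTrees {n c top : ℕ} {comp : ℕ → ℕ} {F : ℕ → ℕ → ℕ} {s : State} (hc : 0 < c)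
    (h2 : s.reg 2 = 1) (h3 : s.reg 3 = 0) (h4 : s.reg 4 = c) (h5 : s.reg 5 = top)
    (hp : ∀ k < c, s.arr 20 k = 2 ^ k) (h26 : ∀ C, s.arr 26 C = lastTable comp n C * 2 ^ c)
    (hF : F = fun t S => s.arr 23 (t * 2 ^ c + S)) :
    wp bestTrees s fun s' t =>
      t ≤ c ^ (c + c) * (20 * c ^ 2 + 42 * c + 16) + 26 * c ^ 2 + 58 * c + 22 ∧
      ∃ best N, (∀ N' < c ^ (c + c), Valid c N' → best ≤ treeCost n c comp F N') ∧
        (best < top → Valid c N ∧ best = treeCost n c comp F N) ∧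
        ∀ C < c, s'.arr 27 C = targets c N C := by
  unfold bestTrees
  rw [wp_seq, wp_instr]
  refine (wp_powers (B := c) (R := c + c) (by norm_num) (by norm_num) (by simp [Instr.apply, h2])
    (by simp [Instr.apply, h3]) (by simp [Instr.apply, h4]) (by simp [Instr.apply, h4])).seq ?_
  rintro s₁ t₁ F₁ ⟨ht₁, hpc⟩
  have e2 : s₁.reg 2 = 1 := by rw [F₁.reg 2 rfl]; simp [Instr.apply, h2]
  have e3 : s₁.reg 3 = 0 := by rw [F₁.reg 3 rfl]; simp [Instr.apply, h3]
  have e4 : s₁.reg 4 = c := by rw [F₁.reg 4 rfl]; simp [Instr.apply, h4]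
  have e5 : s₁.reg 5 = top := by rw [F₁.reg 5 rfl]; simp [Instr.apply, h5]
  have e7 : s₁.reg 7 = c + c := by rw [F₁.reg 7 rfl]; simp [Instr.apply, h4]
  have a20 : s₁.arr 20 = s.arr 20 := F₁.arr 20 rfl
  have a23 : s₁.arr 23 = s.arr 23 := F₁.arr 23 rfl
  have a26 : s₁.arr 26 = s.arr 26 := F₁.arr 26 rfl
  rw [wp_seq, wp_instr, wp_seq, wp_instr, wp_seq, wp_instr]
  refine (wp_forUp (N := c ^ (c + c)) (K := 20 * c ^ 2 + 42 * c + 14) (fun k s' =>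
      -- The default code `0` is in range as well, so the final evaluation is legitimate even if
      -- nothing below `top` was found.
      s'.reg 74 < c ^ (c + c) ∧
      (∀ N' < k, Valid c N' → s'.reg 73 ≤ treeCost n c comp F N') ∧
      (s'.reg 73 < top → Valid c (s'.reg 74) ∧ s'.reg 73 = treeCost n c comp F (s'.reg 74)))
    rfl (by simp [Instr.apply, e2]) (by simp [Instr.apply, e7, hpc])
    (by simp [Instr.apply, e3, e5, hc]) ?_).seq ?_
  · rintro k hk s₂ F₂ ⟨hI, hJ, hK⟩ hi
    have f2 : s₂.reg 2 = 1 := by rw [F₂.reg 2 rfl]; simp [Instr.apply, e2]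
    have f3 : s₂.reg 3 = 0 := by rw [F₂.reg 3 rfl]; simp [Instr.apply, e3]
    have f4 : s₂.reg 4 = c := by rw [F₂.reg 4 rfl]; simp [Instr.apply, e4]
    have f7 : s₂.reg 7 = c + c := by rw [F₂.reg 7 rfl]; simp [Instr.apply, e7]
    have b20 : s₂.arr 20 = s.arr 20 := by rw [F₂.arr 20 rfl]; simp [Instr.apply, a20]
    have b21 : s₂.arr 21 = s₁.arr 21 := by rw [F₂.arr 21 rfl]; simp [Instr.apply]
    have b23 : s₂.arr 23 = s.arr 23 := by rw [F₂.arr 23 rfl]; simp [Instr.apply, a23]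
    have b26 : s₂.arr 26 = s.arr 26 := by rw [F₂.arr 26 rfl]; simp [Instr.apply, a26]
    rw [wp_seq, wp_instr]
    refine (wp_evalTrees (n := n) (comp := comp) (N := k) hc (by simp [Instr.apply, f2])
      (by simp [Instr.apply, f3]) (by simp [Instr.apply, f4]) (by simp [Instr.apply, f7])
      (by simp [Instr.apply, hi]) hk (by
        simp only [Instr.apply, State.arr_setReg, b21]; exact fun j hj => hpc j hj.le)
      (by simpa [Instr.apply, b20] using hp) (by simpa [Instr.apply, b26] using h26)).seq ?_
    rintro s₃ t₃ F₃ ⟨ht₃, hv, h65, -⟩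
    simp only [Instr.apply, State.arr_setReg, b23, ← hF] at h65
    have g2 : s₃.reg 2 = 1 := by rw [F₃.reg 2 rfl]; simp [Instr.apply, f2]
    have g73 : s₃.reg 73 = s₂.reg 73 := by rw [F₃.reg 73 rfl]; simp [Instr.apply]
    have g74 : s₃.reg 74 = s₂.reg 74 := by rw [F₃.reg 74 rfl]; simp [Instr.apply]
    have g75 : s₃.reg 75 = k := by rw [F₃.reg 75 rfl]; simp [Instr.apply, hi]
    simp only [wp_seq, wp_instr, wp_ite, wp_skip, Instr.apply, Test.Holds, State.reg_setReg,
      Nat.reduceEqDiff, if_true, if_false, g2, g73, g74, g75, h65, hv]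
    refine ⟨fun h => ⟨fun h' => ⟨by omega, hk, fun N' hN' hV => ?_, fun _ => ⟨h, trivial⟩⟩,
      fun h' => ⟨by omega, hI, fun N' hN' hV => ?_, hK⟩⟩,
      fun h => ⟨by omega, hI, fun N' hN' hV => ?_, hK⟩⟩
    · rcases Nat.lt_succ_iff_lt_or_eq.1 hN' with hN' | rfl
      · exact h'.le.trans (hJ N' hN' hV)
      · exact le_rfl
    · rcases Nat.lt_succ_iff_lt_or_eq.1 hN' with hN' | rfl
      · exact hJ N' hN' hV
      · exact not_lt.1 h'
    · rcases Nat.lt_succ_iff_lt_or_eq.1 hN' with hN' | rfl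
      · exact hJ N' hN' hV
      · exact absurd hV h
  rintro s₂ t₂ F₂ ⟨ht₂, hI, hJ, hK⟩
  have f2 : s₂.reg 2 = 1 := by rw [F₂.reg 2 rfl]; simp [Instr.apply, e2]
  have f3 : s₂.reg 3 = 0 := by rw [F₂.reg 3 rfl]; simp [Instr.apply, e3]
  have f4 : s₂.reg 4 = c := by rw [F₂.reg 4 rfl]; simp [Instr.apply, e4]
  have f7 : s₂.reg 7 = c + c := by rw [F₂.reg 7 rfl]; simp [Instr.apply, e7]
  have b20 : s₂.arr 20 = s.arr 20 := by rw [F₂.arr 20 rfl]; simp [Instr.apply, a20]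
  have b21 : s₂.arr 21 = s₁.arr 21 := by rw [F₂.arr 21 rfl]; simp [Instr.apply]
  have b26 : s₂.arr 26 = s.arr 26 := by rw [F₂.arr 26 rfl]; simp [Instr.apply, a26]
  rw [wp_seq, wp_instr]
  refine (wp_evalTrees (n := n) (comp := comp) (N := s₂.reg 74) hc (by simp [Instr.apply, f2])
    (by simp [Instr.apply, f3]) (by simp [Instr.apply, f4]) (by simp [Instr.apply, f7])
    (by simp [Instr.apply]) hI (by
      simp only [Instr.apply, State.arr_setReg, b21]; exact fun j hj => hpc j hj.le)
    (by simpa [Instr.apply, b20] using hp) (by simpa [Instr.apply, b26] using h26)).mono ?_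
  rintro s₃ t₃ - ⟨ht₃, -, -, h27⟩
  refine ⟨?_, s₂.reg 73, s₂.reg 74, hJ, hK, h27⟩
  have q1 : (c + c) * (3 * c + 8) = 6 * c ^ 2 + 16 * c := by ring
  have q2 : c ^ (c + c) * (20 * c ^ 2 + 42 * c + 14 + 2) =
    c ^ (c + c) * (20 * c ^ 2 + 42 * c + 16) := by ring
  omega

/-- Reads off the powers of the vertices from the tables. -/
def readPowers : Prog :=
  forUp 80 0
    (.instr (.sub 81 0 80) ;; .instr (.sub 81 81 2) ;; .instr (.load 82 17 81) ;;
      .instr (.load 83 27 82) ;; .instr (.add 84 30 83) ;; .instr (.load 85 24 84) ;;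
      .instr (.load 86 3 81) ;; .instr (.add 86 86 85) ;; .instr (.store 28 81 86) ;;
      .instr (.load 87 25 84) ;; .instr (.store 27 82 87) ;; .instr (.sub 30 30 6))

/-- Vertex `v` owns table `v + 1`, so register `30` starts at the table of the last vertex and goes
down by one table per round. Array `27` is overwritten with the sets in `remaining`. -/
theorem wp_readPowers {n b : ℕ} {s : State} (h0 : s.reg 0 = n) (h2 : s.reg 2 = 1)
    (h6 : s.reg 6 = b) (h30 : s.reg 30 = n * b) :
    wp readPowers s fun s' t => t ≤ n * 14 + 2 ∧
      ∀ v < n, s'.arr 28 v = s.arr 3 v + increase n (s.arr 17) (fun t S => s.arr 24 (t * b + S))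
        (fun t S => s.arr 25 (t * b + S)) (s.arr 27) v := by
  unfold readPowers
  refine (wp_forUp (N := n) (K := 12) (fun k s' =>
      s'.reg 30 = (n - k) * b ∧
      s'.arr 27 = remaining n (s.arr 17) (fun t S => s.arr 25 (t * b + S)) (s.arr 27) k ∧
      ∀ v < n, n - k ≤ v → s'.arr 28 v = s.arr 3 v + increase n (s.arr 17)
        (fun t S => s.arr 24 (t * b + S)) (fun t S => s.arr 25 (t * b + S)) (s.arr 27) v)
    rfl h2 h0 ?_ ?_).mono ?_
  · refine ⟨by simpa using h30, rfl, fun v hv hv' => by omega⟩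
  · rintro k hk s₁ F₁ ⟨hI, hJ, hK⟩ hi
    have e0 : s₁.reg 0 = n := (F₁.reg 0 rfl).trans h0
    have e2 : s₁.reg 2 = 1 := (F₁.reg 2 rfl).trans h2
    have e6 : s₁.reg 6 = b := (F₁.reg 6 rfl).trans h6
    have a3 : s₁.arr 3 = s.arr 3 := F₁.arr 3 rfl
    have a17 : s₁.arr 17 = s.arr 17 := F₁.arr 17 rfl
    have a24 : s₁.arr 24 = s.arr 24 := F₁.arr 24 rfl
    have a25 : s₁.arr 25 = s.arr 25 := F₁.arr 25 rfl
    have hnk : n - k = n - k - 1 + 1 := by omega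
    simp only [wp_seq, wp_instr, Instr.apply, State.reg_setReg, State.arr_setReg, State.reg_setArr,
      State.arr_setArr, Nat.reduceEqDiff, if_true, if_false, e0, e2, e6, hi, a3, a17, a24, a25,
      hI, hJ]
    refine ⟨by norm_num, ?_, ?_, fun v hv hkv => ?_⟩
    · rw [hnk, add_mul, one_mul, Nat.add_sub_cancel]
      rfl
    · rw [remaining, ← hnk]
    · by_cases hvk : v = n - k - 1
      · subst hvk
        rw [Function.update_self, increase, ← hnk]
        have : n - (n - k - 1) - 1 = k := by omega
        rw [this]
      · rw [Function.update_of_ne hvk]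
        exact hK v hv (by omega)
  · rintro s' t - ⟨ht, -, -, hK⟩
    exact ⟨ht, fun v hv => hK v hv (by omega)⟩

/-- Outputs the arcs that the vertices reach. -/
def output : Prog :=
  .instr (.copy 90 3) ;;
  forUp 10 1
    (.instr (.load 91 0 10) ;; .instr (.load 92 2 10) ;; .instr (.load 93 28 91) ;;
      .ite (.lt 93 92) .skip
        (.instr (.load 94 1 10) ;; .instr (.store 0 90 91) ;; .instr (.store 1 90 94) ;;
          .instr (.add 90 90 2))) ;;
  .instr (.copy 0 90)

theorem wp_output {n : ℕ} {L : List (Fin n × Fin n)} {w : Fin n → Fin n → ℕ} {l P : Fin n → ℕ}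
    {s : State} (h1 : s.reg 1 = L.length) (h2 : s.reg 2 = 1) (h3 : s.reg 3 = 0)
    (hin : IsInput L w l (s.arr 0) (s.arr 1) (s.arr 2) (s.arr 3))
    (hP : ∀ v : Fin n, s.arr 28 v = P v) :
    wp output s fun s' t => t ≤ L.length * 10 + 4 ∧
      Outputs s' (L.filter fun a => w a.1 a.2 ≤ P a.1) := by
  unfold output
  rw [wp_seq, wp_instr]
  refine (wp_forUp (N := L.length) (K := 8) (fun k s' =>
      s'.reg 90 = ((L.take k).filter fun a => w a.1 a.2 ≤ P a.1).length ∧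
      (∀ (i : ℕ) (h : i < ((L.take k).filter fun a => w a.1 a.2 ≤ P a.1).length),
        s'.arr 0 i = (((L.take k).filter fun a => w a.1 a.2 ≤ P a.1)[i].1 : ℕ) ∧
        s'.arr 1 i = (((L.take k).filter fun a => w a.1 a.2 ≤ P a.1)[i].2 : ℕ)) ∧
      -- The arcs are filtered in place: the writing position never overtakes the reading position,
      -- so the unread arcs are intact.
      ∀ e, k ≤ e → s'.arr 0 e = s.arr 0 e ∧ s'.arr 1 e = s.arr 1 e)
    rfl (by simp [Instr.apply, h2]) (by simp [Instr.apply, h1])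
    (by simp [Instr.apply, h3]) ?_).seq ?_
  · rintro k hk s₁ F₁ ⟨hI, hJ, hK⟩ hi
    have e2 : s₁.reg 2 = 1 := by rw [F₁.reg 2 rfl]; simp [Instr.apply, h2]
    have a2 : s₁.arr 2 = s.arr 2 := by rw [F₁.arr 2 rfl]; simp [Instr.apply]
    have a28 : s₁.arr 28 = s.arr 28 := by rw [F₁.arr 28 rfl]; simp [Instr.apply]
    have hlen : ((L.take k).filter fun a => w a.1 a.2 ≤ P a.1).length ≤ k :=
      (List.length_filter_le _ _).trans (by simp)
    have htake : L.take (k + 1) = L.take k ++ [L[k]] := by simp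
    simp only [wp_seq, wp_instr, wp_ite, wp_skip, Instr.apply, Test.Holds, State.reg_setReg,
      State.arr_setReg, State.reg_setArr, State.arr_setArr, Nat.reduceEqDiff, if_true, if_false,
      hi, e2, a2, a28, (hK k le_rfl).1, (hK k le_rfl).2, hin.src_eq k hk, hin.dst_eq k hk,
      hin.wt_eq k hk, hP, hI, one_ne_zero, zero_ne_one]
    constructor
    · intro hlt
      have hf : (L.take (k + 1)).filter (fun a => w a.1 a.2 ≤ P a.1) =
          (L.take k).filter fun a => w a.1 a.2 ≤ P a.1 := by
        rw [htake, List.filter_append]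
        simp [hlt]
      rw [hf]
      exact ⟨by norm_num, rfl, hJ, fun e he => hK e (by omega)⟩
    · intro hlt
      have hf : (L.take (k + 1)).filter (fun a => w a.1 a.2 ≤ P a.1) =
          ((L.take k).filter fun a => w a.1 a.2 ≤ P a.1) ++ [L[k]] := by
        rw [htake, List.filter_append]
        simp [not_lt.1 hlt]
      simp only [hf]
      refine ⟨by norm_num, by simp, fun i hi' => ?_, fun e he => ?_⟩
      · by_cases hik : i = ((L.take k).filter fun a => w a.1 a.2 ≤ P a.1).length
        · subst hik
          simp
        · have hi'' : i < ((L.take k).filter fun a => w a.1 a.2 ≤ P a.1).length := by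
            simp only [List.length_append, List.length_singleton] at hi'
            omega
          rw [Function.update_of_ne hik, Function.update_of_ne hik, List.getElem_append_left hi'']
          exact hJ i hi''
      · rw [Function.update_of_ne (by omega), Function.update_of_ne (by omega)]
        exact hK e (by omega)
  · rintro s₁ t₁ F₁ ⟨ht₁, hI, hJ, -⟩
    rw [List.take_length] at hI hJ
    simp only [wp_instr, Instr.apply, Outputs, State.reg_setReg, State.arr_setReg, if_true, hI]
    exact ⟨by omega, trivial, hJ⟩

end MinPAC

/-! ### The whole algorithm and its running time. -/

namespace MinPAC

open RAM DFS Relation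

/-- The algorithm. -/
def algorithm : Prog :=
  .instr (.const 2 1) ;; components ;; costTable ;; tables ;; bestTrees ;; readPowers ;; output

/-- A bound for the running time. -/
def timeBound (n m c : ℕ) : ℕ := c ^ 2 * 2 ^ c * n + m + c ^ 2 * c ^ (c + c)

theorem timeBound_mono {n m c c' : ℕ} (hc : 0 < c) (h : c ≤ c') :
    timeBound n m c ≤ timeBound n m c' := by
  unfold timeBound
  gcongr
  · norm_num
  · omega

theorem time_le {n m c t : ℕ} (hn : 0 < n) (hc : 0 < c)
    (ht : t ≤ 1 + (1000 * (n + m) + 1000) + (100 * (m + n * c + n) + 100) +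
      (c * 14 + 20 + 2 ^ c * 3 + n * (2 ^ c * (9 * c ^ 2 + 31 * c + 14) + 9)) +
      (c ^ (c + c) * (20 * c ^ 2 + 42 * c + 16) + 26 * c ^ 2 + 58 * c + 22) +
      (n * 14 + 2) + (m * 10 + 4)) :
    t ≤ 5000 * timeBound n m c := by
  unfold timeBound
  set p := 2 ^ c
  set q := c ^ (c + c)
  have hp : 1 ≤ p := Nat.one_le_two_pow
  have hq : 1 ≤ q := Nat.pow_pos hc
  have h1 : n ≤ c ^ 2 * p * n := Nat.le_mul_of_pos_left _ (by positivity)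
  have h2 : n * c ≤ c ^ 2 * p * n := by
    calc n * c ≤ n * c * (c * p) := Nat.le_mul_of_pos_right _ (by positivity)
      _ = c ^ 2 * p * n := by ring
  have h3 : n * (p * c ^ 2) = c ^ 2 * p * n := by ring
  have h4 : n * (p * c) ≤ c ^ 2 * p * n := by
    calc n * (p * c) ≤ n * (p * c) * c := Nat.le_mul_of_pos_right _ hc
      _ = c ^ 2 * p * n := by ring
  have h5 : n * p ≤ c ^ 2 * p * n := by
    calc n * p ≤ n * p * c ^ 2 := Nat.le_mul_of_pos_right _ (by positivity)
      _ = c ^ 2 * p * n := by ring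
  have h6 : p ≤ c ^ 2 * p * n := (Nat.le_mul_of_pos_left _ hn).trans h5
  have h7 : q * c ^ 2 = c ^ 2 * q := by ring
  have h8 : q * c ≤ c ^ 2 * q := by
    calc q * c ≤ q * c * c := Nat.le_mul_of_pos_right _ hc
      _ = c ^ 2 * q := by ring
  have h9 : q ≤ c ^ 2 * q := Nat.le_mul_of_pos_left _ (by positivity)
  have h10 : c ^ 2 ≤ c ^ 2 * q := Nat.le_mul_of_pos_right _ hq
  have h11 : c ≤ c ^ 2 * q := (Nat.le_mul_of_pos_left _ hq).trans h8
  have e1 : n * (p * (9 * c ^ 2 + 31 * c + 14) + 9) =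
      9 * (n * (p * c ^ 2)) + 31 * (n * (p * c)) + 14 * (n * p) + 9 * n := by ring
  have e2 : q * (20 * c ^ 2 + 42 * c + 16) = 20 * (q * c ^ 2) + 42 * (q * c) + 16 * q := by ring
  rw [e1, e2] at ht
  omega

theorem sq_le_four_mul_two_pow (c : ℕ) : c ^ 2 ≤ 4 * 2 ^ c := by
  induction c with
  | zero => simp
  | succ c ih =>
    rcases Nat.lt_or_ge c 3 with h | h
    · interval_cases c <;> norm_num
    · calc (c + 1) ^ 2 ≤ 2 * c ^ 2 := by nlinarith
        _ ≤ 2 * (4 * 2 ^ c) := by omega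
        _ = 4 * 2 ^ (c + 1) := by ring

theorem timeBound_le {n m c : ℕ} (hc : 0 < c) :
    (timeBound n m c : ℝ) ≤
      16 * ((c : ℝ) ^ 2 * 2 ^ c * n + m + 4 ^ c * (c : ℝ) ^ (2 * (c : ℝ) - 3 / 2)) := by
  have hc0 : (0 : ℝ) < c := Nat.cast_pos.2 hc
  have hc1 : (1 : ℝ) ≤ c := Nat.one_le_cast.2 hc
  -- The enumeration exceeds `c ^ (2 * c - 3 / 2)` by the factor `c ^ (7 / 2)`, which `16 * 4 ^ c`
  -- absorbs.
  have h1 : (c : ℝ) ^ 2 * (c : ℝ) ^ (c + c) =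
      (c : ℝ) ^ (7 / 2 : ℝ) * (c : ℝ) ^ (2 * (c : ℝ) - 3 / 2) := by
    rw [← pow_add, ← Real.rpow_add hc0, ← Real.rpow_natCast]
    congr 1
    push_cast
    ring
  have h2 : (c : ℝ) ^ (7 / 2 : ℝ) ≤ 16 * 4 ^ c := by
    calc (c : ℝ) ^ (7 / 2 : ℝ) ≤ (c : ℝ) ^ (4 : ℝ) :=
          Real.rpow_le_rpow_of_exponent_le hc1 (by norm_num)
      _ = ((c : ℝ) ^ 2) ^ 2 := by
          rw [← pow_mul, ← Real.rpow_natCast]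
          norm_num
      _ ≤ (4 * 2 ^ c) ^ 2 := by
          gcongr
          exact_mod_cast sq_le_four_mul_two_pow c
      _ = 16 * 4 ^ c := by
          rw [mul_pow, ← pow_mul, mul_comm c 2, pow_mul]
          norm_num
  have h3 : 0 ≤ (c : ℝ) ^ (2 * (c : ℝ) - 3 / 2) := by positivity
  have h4 : (0 : ℝ) ≤ (c : ℝ) ^ 2 * 2 ^ c * n := by positivity
  have h5 : (0 : ℝ) ≤ m := by positivity
  have h6 := mul_le_mul_of_nonneg_right h2 h3
  unfold timeBound
  push_cast
  rw [h1]
  nlinarith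

theorem isInput_inputState {n : ℕ} (L : List (Fin n × Fin n)) (w : Fin n → Fin n → ℕ)
    (l : Fin n → ℕ) :
    IsInput L w l ((inputState L w l).arr 0) ((inputState L w l).arr 1)
      ((inputState L w l).arr 2) ((inputState L w l).arr 3) where
  src_eq e h := by simp [inputState, h]
  dst_eq e h := by simp [inputState, h]
  wt_eq e h := by simp [inputState, h]
  lb_eq v := by simp [inputState]

theorem IsArcList.powered {n : ℕ} {G : Digraph (Fin n)} {L : List (Fin n × Fin n)}
    (hL : IsArcList G L) (w : Fin n → Fin n → ℕ) (P : Fin n → ℕ) :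
    IsArcList (powered G w P) (L.filter fun a => w a.1 a.2 ≤ P a.1) := by
  refine ⟨hL.1.filter _, fun v u => ?_⟩
  rw [List.mem_filter, hL.2, decide_eq_true_iff]
  rfl

theorem wp_algorithm {n c : ℕ} {G : Digraph (Fin n)} {w : Fin n → Fin n → ℕ} {l : Fin n → ℕ}
    {L : List (Fin n × Fin n)} (hn : 0 < n) (hG : StronglyConnected G)
    (hl : IsVertexLowerBound G w l) (hL : IsArcList G L) (hc : c = numSCC (obligatory G w l)) :
    wp algorithm (inputState L w l) fun s t => 0 < c ∧ t ≤ 5000 * timeBound n L.length c ∧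
      ∃ P : Fin n → ℕ, IsOptimal G w (powered G w P) ∧
        Outputs s (L.filter fun a => w a.1 a.2 ≤ P a.1) := by
  unfold algorithm
  rw [wp_seq, wp_instr]
  set s₀ := (Instr.const 2 1).apply (inputState L w l) with hs₀
  have ha : ∀ a, s₀.arr a = (inputState L w l).arr a := fun a => rfl
  have hin : IsInput L w l (s₀.arr 0) (s₀.arr 1) (s₀.arr 2) (s₀.arr 3) := isInput_inputState L w l
  have h0 : s₀.reg 0 = n := by simp [hs₀, Instr.apply, inputState]
  have h1 : s₀.reg 1 = L.length := by simp [hs₀, Instr.apply, inputState]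
  have h2 : s₀.reg 2 = 1 := by simp [hs₀, Instr.apply]
  have h3 : s₀.reg 3 = 0 := by simp [hs₀, Instr.apply, inputState]
  have hz : ∀ a, 10 ≤ a → ∀ i, s₀.arr a i = 0 := by
    intro a ha' i
    have : a ≠ 0 ∧ a ≠ 1 ∧ a ≠ 2 ∧ a ≠ 3 := by omega
    simp [ha, inputState, this]
  have hsrc : ∀ e < L.length, s₀.arr 0 e < n := fun e he => by
    rw [hin.src_eq e he]; exact L[e].1.2
  have hdst : ∀ e < L.length, s₀.arr 1 e < n := fun e he => by
    rw [hin.dst_eq e he]; exact L[e].2.2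
  clear_value s₀
  refine (wp_components h0 h1 h2 h3 hsrc hdst hz).seq ?_
  rintro s₁ t₁ F₁ ⟨ht₁, hcomp⟩
  obtain ⟨k, hk⟩ : ∃ k, s₁.reg 4 = k := ⟨_, rfl⟩
  obtain ⟨comp, hcompdef⟩ : ∃ f, s₁.arr 17 = f := ⟨_, rfl⟩
  rw [hk, hcompdef] at hcomp
  change IsComp n (Oblig L.length (s₀.arr 0) (s₀.arr 1) (s₀.arr 2) (s₀.arr 3)) k comp at hcomp
  have hkc : k ≤ c := hc ▸ hin.le_numSCC hL hcomp
  have hk0 : 0 < k := (Nat.zero_le _).trans_lt (hcomp.lt 0 hn)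
  have a0 : s₁.arr 0 = s₀.arr 0 := F₁.arr 0 rfl
  have a1 : s₁.arr 1 = s₀.arr 1 := F₁.arr 1 rfl
  have a2 : s₁.arr 2 = s₀.arr 2 := F₁.arr 2 rfl
  have a3 : s₁.arr 3 = s₀.arr 3 := F₁.arr 3 rfl
  refine (wp_costTable (n := n) (m := L.length) (c := k) ((F₁.reg 0 rfl).trans h0)
    ((F₁.reg 1 rfl).trans h1) ((F₁.reg 2 rfl).trans h2) ((F₁.reg 3 rfl).trans h3) hk
    (by rwa [a0]) (by rwa [a1]) (by rw [hcompdef]; exact hcomp.lt)).seq ?_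
  rintro s₂ t₂ F₂ ⟨ht₂, htop, h18, hW⟩
  rw [a0, a1, a2, a3, hcompdef] at hW
  rw [a2] at htop
  refine (wp_tables (n := n) (c := k) (top := s₂.reg 5) (comp := comp)
    (W := fun v d => s₂.arr 19 (v * k + d)) ?_ ?_ ?_ ?_ rfl ?_ h18 (fun _ _ => rfl) ?_).seq ?_
  · rw [F₂.reg 0 rfl, F₁.reg 0 rfl, h0]
  · rw [F₂.reg 2 rfl, F₁.reg 2 rfl, h2]
  · rw [F₂.reg 3 rfl, F₁.reg 3 rfl, h3]
  · rw [F₂.reg 4 rfl, hk]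
  · rw [F₂.arr 17 rfl, hcompdef]
  · rw [F₂.arr 26 rfl, F₁.arr 26 rfl]
    exact hz 26 (by norm_num)
  rintro s₃ t₃ F₃ ⟨ht₃, h6, h20, h30, h26, hT⟩
  refine (wp_bestTrees (n := n) (c := k) (top := s₂.reg 5) (comp := comp) hk0 ?_ ?_ ?_ ?_ h20 h26
    rfl).seq ?_
  · rw [F₃.reg 2 rfl, F₂.reg 2 rfl, F₁.reg 2 rfl, h2]
  · rw [F₃.reg 3 rfl, F₂.reg 3 rfl, F₁.reg 3 rfl, h3]
  · rw [F₃.reg 4 rfl, F₂.reg 4 rfl, hk]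
  · rw [F₃.reg 5 rfl]
  rintro s₄ t₄ F₄ ⟨ht₄, best, N, hmin, hbest, h27⟩
  refine (wp_readPowers (n := n) (b := 2 ^ k) ?_ ?_ ?_ ?_).seq ?_
  · rw [F₄.reg 0 rfl, F₃.reg 0 rfl, F₂.reg 0 rfl, F₁.reg 0 rfl, h0]
  · rw [F₄.reg 2 rfl, F₃.reg 2 rfl, F₂.reg 2 rfl, F₁.reg 2 rfl, h2]
  · rw [F₄.reg 6 rfl, h6]
  · rw [F₄.reg 30 rfl, h30]
  rintro s₅ t₅ F₅ ⟨ht₅, h28⟩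
  rw [F₄.arr 24 rfl, F₄.arr 25 rfl, F₄.arr 17 rfl, F₃.arr 17 rfl, F₂.arr 17 rfl, hcompdef,
    F₄.arr 3 rfl, F₃.arr 3 rfl, F₂.arr 3 rfl, a3] at h28
  have hopt := hin.isOptimal hL hn hG hl hcomp htop hW hT hmin hbest h27
  refine (wp_output (L := L) (w := w) (l := l) (P := fun v => l v + increase n comp
    (fun t S => s₃.arr 24 (t * 2 ^ k + S)) (fun t S => s₃.arr 25 (t * 2 ^ k + S)) (s₄.arr 27) v)
    ?_ ?_ ?_ ?_ ?_).mono ?_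
  · rw [F₅.reg 1 rfl, F₄.reg 1 rfl, F₃.reg 1 rfl, F₂.reg 1 rfl, F₁.reg 1 rfl, h1]
  · rw [F₅.reg 2 rfl, F₄.reg 2 rfl, F₃.reg 2 rfl, F₂.reg 2 rfl, F₁.reg 2 rfl, h2]
  · rw [F₅.reg 3 rfl, F₄.reg 3 rfl, F₃.reg 3 rfl, F₂.reg 3 rfl, F₁.reg 3 rfl, h3]
  · rw [F₅.arr 0 rfl, F₄.arr 0 rfl, F₃.arr 0 rfl, F₂.arr 0 rfl, a0,
      F₅.arr 1 rfl, F₄.arr 1 rfl, F₃.arr 1 rfl, F₂.arr 1 rfl, a1,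
      F₅.arr 2 rfl, F₄.arr 2 rfl, F₃.arr 2 rfl, F₂.arr 2 rfl, a2,
      F₅.arr 3 rfl, F₄.arr 3 rfl, F₃.arr 3 rfl, F₂.arr 3 rfl, a3]
    exact hin
  · intro v
    rw [h28 v v.2, hin.lb_eq]
  rintro s₆ t₆ - ⟨ht₆, hout⟩
  refine ⟨hk0.trans_le hkc, ?_, _, hopt, hout⟩
  -- The time is first bounded with the computed number `k` of components and then with `c ≥ k`.
  refine (time_le hn hk0 ?_).trans (Nat.mul_le_mul_left _ (timeBound_mono hk0 hkc))
  omega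

end MinPAC

theorem mainTheorem2 :
    ∃ (P : RAM.Prog) (C : ℝ),
      ∀ (n m c : ℕ) (G : Digraph (Fin n)) (w : Fin n → Fin n → ℕ) (l : Fin n → ℕ)
        (L : List (Fin n × Fin n)),
        0 < n → MinPAC.StronglyConnected G → MinPAC.IsVertexLowerBound G w l →
        MinPAC.IsArcList G L → m = L.length → c = MinPAC.numSCC (MinPAC.obligatory G w l) →
        MinPAC.SolvesWithin P G w l L
          (C * ((c : ℝ) ^ 2 * 2 ^ c * n + m + 4 ^ c * (c : ℝ) ^ (2 * (c : ℝ) - 3 / 2))) := by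
  -- The factor `5000` comes from `time_le`, the factor `16` from `timeBound_le`.
  refine ⟨MinPAC.algorithm, 5000 * 16, fun n m c G w l L hn hG hl hL hm hc => ?_⟩
  obtain ⟨s, t, hexec, hc0, ht, P, hopt, hout⟩ := MinPAC.wp_algorithm hn hG hl hL hc
  refine ⟨s, t, _, _, hexec, ?_, hopt, hL.powered w P, hout⟩
  have h1 : (t : ℝ) ≤ 5000 * MinPAC.timeBound n L.length c := by exact_mod_cast ht
  have h2 := MinPAC.timeBound_le (n := n) (m := L.length) hc0
  rw [hm, mul_assoc]
  linarith
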